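/- Let $E$ be a number field of degree $g=[E:\mathbb{Q}]>2$. (1) There exists a simple complex torus $T=V/\Lambda$ of dimension $g$ such that $\mathrm{End}^0(T):=\mathrm{End}(T)\otimes\mathbb{Q}$ is isomorphic to $E$ as a $\mathbb{Q}$-algebra and, with respect to the resulting structure of an $E$-vector space on $\mathrm{H}_1(T,\mathbb{Q})=\Lambda\otimes\mathbb{Q}$, $$\mathrm{Hdg}(T)=\mathrm{Res}_{E/\mathbb{Q}}\,\mathrm{SL}\bigl(\mathrm{H}_1(T,\mathbb{Q})/E\bigr).$$ Here the Hodge group $\mathrm{Hdg}(T)$ is the smallest algebraic $\mathbb{Q}$-subgroup $G$ of $\mathrm{GL}(\mathrm{H}_1(T,\mathbb{Q}))$ such that $G(\mathbb{R})\subset\mathrm{GL}(V)$ contains multiplication by every $z\in\mathbb{C}$ with $|z|=1$; the right-hand side is the algebraic $\mathbb{Q}$-subgroup of $\mathrm{GL}(\mathrm{H}_1(T,\mathbb{Q}))$ obtained by Weil restriction from the special linear group of the $E$-vector space $\mathrm{H}_1(T,\mathbb{Q})$. (2) Let $T$ be any simple complex torus of dimension $g$ with $\mathrm{End}^0(T)\cong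 E$ and $\mathrm{Hdg}(T)=\mathrm{Res}_{E/\mathbb{Q}}\,\mathrm{SL}(\mathrm{H}_1(T,\mathbb{Q})/E)$. Then $T$ is $2$-simple if and only if $E$ is almost doubly transitive. Here $T$ is called $2$-simple if every rational Hodge substructure $H$ of $\mathrm{H}^2(T,\mathbb{Q})$ with $(H\otimes_{\mathbb{Q}}\mathbb{C})\cap \mathrm{H}^{2,0}(T)\neq\{0\}$ satisfies $\mathrm{H}^{2,0}(T)\subset H\otimes_{\mathbb{Q}}\mathbb{C}$. The field $E$ is called almost doubly transitive if $\mathrm{Aut}(\mathbb{C})$, acting by composition on the $g$-element set of field embeddings $E\hookrightarrow\mathbb{C}$, acts transitively on this set and on the set of its two-element subsets. -/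

import Mathlib

open scoped TensorProduct Topology

universe u v

noncomputable section

/-! ## Algebraic `ℚ`-subgroups of `GL(W)`

For a finite-dimensional `ℚ`-vector space `W`, an algebraic `ℚ`-subgroup `G` of `GL(W)` is given by
its group of complex points, i.e. it is a subgroup of `GL(W_ℂ)` which is the common zero locus of
polynomials with rational coefficients in the matrix entries.  (In characteristic zero algebraic
groups are reduced, so an algebraic `ℚ`-group is determined by its complex points.) -/

section AlgebraicGroups

variable {W : Type u} [AddCommGroup W] [Module ℚ W]

/-- The matrix coefficient `φ(g w)` of a complex operator `g`, for a rational functional `φ` and a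
rational vector `w`. -/
def matrixCoeff (g : (ℂ ⊗[ℚ] W) ≃ₗ[ℂ] (ℂ ⊗[ℚ] W)) (x : Module.Dual ℚ W × W) : ℂ :=
  Module.Dual.baseChange ℂ x.1 (g (1 ⊗ₜ[ℚ] x.2))

/-- A subgroup of `GL(W_ℂ)` is an algebraic `ℚ`-subgroup of `GL(W)` if it is the zero locus of a
set of polynomials with rational coefficients in the matrix coefficients. -/
def IsAlgebraicQSubgroup (G : Subgroup ((ℂ ⊗[ℚ] W) ≃ₗ[ℂ] (ℂ ⊗[ℚ] W))) : Prop :=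
  ∃ S : Set (MvPolynomial (Module.Dual ℚ W × W) ℚ),
    ∀ g, g ∈ G ↔ ∀ p ∈ S, MvPolynomial.aeval (matrixCoeff g) p = 0

/-- The smallest algebraic `ℚ`-subgroup of `GL(W)` whose complex points contain the set `X`. -/
def algebraicQClosure (X : Set ((ℂ ⊗[ℚ] W) ≃ₗ[ℂ] (ℂ ⊗[ℚ] W))) :
    Subgroup ((ℂ ⊗[ℚ] W) ≃ₗ[ℂ] (ℂ ⊗[ℚ] W)) :=
  sInf {G | IsAlgebraicQSubgroup G ∧ X ⊆ G}

/-- The smallest algebraic `ℚ`-subgroup containing `X` exists and is `algebraicQClosure X`. -/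
theorem isLeast_algebraicQClosure (X : Set ((ℂ ⊗[ℚ] W) ≃ₗ[ℂ] (ℂ ⊗[ℚ] W))) :
    IsLeast {G | IsAlgebraicQSubgroup G ∧ X ⊆ G} (algebraicQClosure X) := by
  refine ⟨⟨?_, ?_⟩, fun G hG => sInf_le hG⟩
  · refine ⟨{p | ∃ G : Subgroup ((ℂ ⊗[ℚ] W) ≃ₗ[ℂ] (ℂ ⊗[ℚ] W)), (IsAlgebraicQSubgroup G ∧ X ⊆ G) ∧
      ∀ g ∈ G, MvPolynomial.aeval (matrixCoeff g) p = 0}, fun g => ?_⟩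
    constructor
    · rintro hg p ⟨G, hG, hp⟩
      exact hp g (Subgroup.mem_sInf.1 hg G hG)
    · intro hg
      refine Subgroup.mem_sInf.2 fun G hG => ?_
      obtain ⟨S, hS⟩ := hG.1
      exact (hS g).2 fun p hp => hg p ⟨G, hG, fun g' hg' => (hS g').1 hg' p hp⟩
  · intro x hx
    exact Subgroup.mem_sInf.2 fun G hG => hG.2 hx

variable {E : Type v} [Field E] [Algebra ℚ E]

/-- If `E` acts on `W`, then `ℂ ⊗ E` acts on `W_ℂ = ℂ ⊗ W` by
`(z ⊗ e) (z' ⊗ w) = z z' ⊗ e w`. -/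
def complexAction (ρ : E →ₐ[ℚ] Module.End ℚ W) :
    (ℂ ⊗[ℚ] E) →ₐ[ℂ] Module.End ℂ (ℂ ⊗[ℚ] W) :=
  Algebra.TensorProduct.lift (Algebra.ofId ℂ _) ((Module.End.baseChangeHom ℚ ℂ W).comp ρ)
    fun z _ => Algebra.commutes z _

/-- The `ℂ ⊗ E`-module structure on `ℂ ⊗ W` coming from an action of `E` on `W`. -/
abbrev complexModule (ρ : E →ₐ[ℚ] Module.End ℚ W) : Module (ℂ ⊗[ℚ] E) (ℂ ⊗[ℚ] W) :=
  Module.compHom _ (complexAction ρ).toRingHom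

/-- The algebraic `ℚ`-subgroup `Res_{E/ℚ} SL(W/E)` of `GL(W)`, where the number field `E` acts on
`W` through `ρ`.  Its complex points are the `ℂ ⊗ E`-linear automorphisms of `ℂ ⊗ W` whose
determinant over `ℂ ⊗ E` is `1`. -/
def resSL (ρ : E →ₐ[ℚ] Module.End ℚ W) : Subgroup ((ℂ ⊗[ℚ] W) ≃ₗ[ℂ] (ℂ ⊗[ℚ] W)) :=
  letI : Module (ℂ ⊗[ℚ] E) (ℂ ⊗[ℚ] W) := complexModule ρ
  { carrier := {g | ∃ a : (ℂ ⊗[ℚ] W) ≃ₗ[ℂ ⊗[ℚ] E] (ℂ ⊗[ℚ] W),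
      LinearEquiv.det a = 1 ∧ ∀ x, a x = g x}
    one_mem' := ⟨1, map_one _, fun _ => rfl⟩
    mul_mem' := by
      rintro g h ⟨a, ha, hag⟩ ⟨b, hb, hbh⟩
      refine ⟨a * b, by rw [map_mul, ha, hb, one_mul], fun x => ?_⟩
      change a (b x) = g (h x)
      rw [hbh, hag]
    inv_mem' := by
      rintro g ⟨a, ha, hag⟩
      refine ⟨a⁻¹, by rw [map_inv, ha, inv_one], fun x => ?_⟩
      apply a.injective
      change a (a.symm x) = a (g.symm x)
      rw [a.apply_symm_apply, hag, g.apply_symm_apply] }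

end AlgebraicGroups

/-! ## Almost doubly transitive actions and number fields -/

/-- A transitive action of `G` on `X` is almost doubly transitive if `G` acts transitively on the
set of all two-element subsets of `X`. -/
def IsAlmostDoublyTransitiveAction {G : Type u} {X : Type v} [Group G] (φ : G →* Equiv.Perm X) :
    Prop :=
  (∀ x y : X, ∃ g : G, φ g x = y) ∧
    ∀ A B : Set X, A.ncard = 2 → B.ncard = 2 → ∃ g : G, φ g '' A = B

/-- The action of `Aut(ℂ)` on the set of field embeddings `E → ℂ` by composition. -/
def embeddingAction (E : Type u) [Field E] : (ℂ ≃+* ℂ) →* Equiv.Perm (E →+* ℂ) where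
  toFun t :=
    { toFun := fun σ => (t : ℂ →+* ℂ).comp σ
      invFun := fun σ => (t.symm : ℂ →+* ℂ).comp σ
      left_inv := fun σ => by ext x; simp
      right_inv := fun σ => by ext x; simp }
  map_one' := by ext; rfl
  map_mul' _ _ := by ext; rfl

/-- A number field `E` is almost doubly transitive if the action of `Aut(ℂ)` on the set of field
embeddings of `E` in `ℂ` is. -/
def IsAlmostDoublyTransitive (E : Type u) [Field E] : Prop :=
  IsAlmostDoublyTransitiveAction (embeddingAction E)

/-! ## Complex tori -/

/-- A complex torus `V/Λ`: `V` is a finite-dimensional complex vector space and `Λ` is a discrete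
subgroup which spans `V` over `ℝ` (so that `Λ` has rank `2 dim V`).  The norm on `V` only serves to
specify its topology. -/
structure ComplexTorus where
  V : Type u
  [normedAddCommGroup : NormedAddCommGroup V]
  [normedSpace : NormedSpace ℂ V]
  [finiteDimensional : FiniteDimensional ℂ V]
  Λ : Submodule ℤ V
  [discreteTopology : DiscreteTopology Λ]
  [isZLattice : IsZLattice ℝ Λ]

namespace ComplexTorus

attribute [instance] normedAddCommGroup normedSpace finiteDimensional discreteTopology isZLattice

variable (T : ComplexTorus.{u})

/-- The complex dimension. -/
def dim : ℕ := Module.finrank ℂ T.V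

/-- The underlying group of the torus. -/
abbrev Points : Type u := T.V ⧸ T.Λ

/-- The torus is simple: it is nonzero and its only complex subtori are `0` and itself.  The complex
subtori of `V/Λ` are the images of those complex subspaces `W` of `V` in which `W ∩ Λ` is a lattice
of full rank. -/
def IsSimple : Prop :=
  0 < T.dim ∧ ∀ W : Submodule ℂ T.V,
    Submodule.span ℝ ((W : Set T.V) ∩ (T.Λ : Set T.V)) = W.restrictScalars ℝ → W = ⊥ ∨ W = ⊤

/-! ### Endomorphisms -/

/-- A self-map `f` of `V/Λ` is holomorphic if locally on `V` it lifts to a holomorphic map to `V`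
(the projection `V → V/Λ` is a local biholomorphism). -/
def IsHolomorphic (f : T.Points → T.Points) : Prop :=
  ∀ v : T.V, ∃ U ∈ 𝓝 v, ∃ F : T.V → T.V, DifferentiableOn ℂ F U ∧
    ∀ x ∈ U, (Submodule.Quotient.mk (F x) : T.Points) = f (Submodule.Quotient.mk x)

theorem isClosed_lattice : IsClosed (T.Λ : Set T.V) :=
  have : DiscreteTopology T.Λ.toAddSubgroup := T.discreteTopology
  AddSubgroup.isClosed_of_discrete (H := T.Λ.toAddSubgroup)

/-- A holomorphic endomorphism of the group `V/Λ` lifts to a linear endomorphism of `V`. -/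
theorem exists_lift (f : T.Points →+ T.Points) (hf : T.IsHolomorphic f) :
    ∃ A : T.V →ₗ[ℂ] T.V, ∀ x : T.V,
      (Submodule.Quotient.mk (A x) : T.Points) = f (Submodule.Quotient.mk x) := by
  obtain ⟨U, hU, F, hF, hFf⟩ := hf 0
  have hd : HasFDerivAt F (fderiv ℂ F 0) 0 := (hF.differentiableAt hU).hasFDerivAt
  have h0 : F 0 ∈ T.Λ := by
    have := hFf 0 (mem_of_mem_nhds hU)
    rw [Submodule.Quotient.mk_zero, map_zero] at this
    exact (Submodule.Quotient.mk_eq_zero _).1 this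
  refine ⟨(fderiv ℂ F 0 : T.V →L[ℂ] T.V), fun x => ?_⟩
  obtain ⟨y, hy⟩ := Submodule.Quotient.mk_surjective T.Λ (f (Submodule.Quotient.mk x))
  have hc : Filter.Tendsto (fun n : ℕ => ((n : ℂ))⁻¹ • x) Filter.atTop (𝓝 0) := by
    have h1 : Filter.Tendsto (fun n : ℕ => ((n : ℂ))⁻¹) Filter.atTop (𝓝 0) :=
      tendsto_inv_atTop_nhds_zero_nat
    simpa using h1.smul_const x
  have hlim : Filter.Tendsto (fun n : ℕ => (n : ℂ) • (F (0 + ((n : ℂ))⁻¹ • x) - F 0))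
      Filter.atTop (𝓝 (fderiv ℂ F 0 x)) := by
    refine hd.lim x ?_
    simpa using tendsto_natCast_atTop_atTop (R := ℝ)
  have hmem : ∀ᶠ n : ℕ in Filter.atTop,
      (n : ℂ) • (F (0 + ((n : ℂ))⁻¹ • x) - F 0) - y ∈ (T.Λ : Set T.V) := by
    filter_upwards [Filter.eventually_ne_atTop 0, hc.eventually hU] with n hn hnU
    rw [zero_add]
    set z := ((n : ℂ))⁻¹ • x with hz
    have hx : x = n • z := by
      rw [hz, ← Nat.cast_smul_eq_nsmul ℂ, smul_inv_smul₀ (by exact_mod_cast hn)]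
    have e1 : (Submodule.Quotient.mk (n • F z) : T.Points) = Submodule.Quotient.mk y := by
      rw [hy, hx, Submodule.Quotient.mk_smul, Submodule.Quotient.mk_smul, map_nsmul, hFf z hnU]
    have e2 : n • F z - y ∈ T.Λ := (Submodule.Quotient.eq _).1 e1
    have e3 : (n : ℂ) • (F z - F 0) - y = (n • F z - y) - n • F 0 := by
      rw [Nat.cast_smul_eq_nsmul ℂ, smul_sub]; abel
    rw [e3]
    exact T.Λ.sub_mem e2 (nsmul_mem h0 n)
  have := T.isClosed_lattice.mem_of_tendsto (hlim.sub_const y) hmem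
  rw [← hy]
  exact (Submodule.Quotient.eq _).2 this

/-- The linear lift is unique. -/
theorem lift_unique {A B : T.V →ₗ[ℂ] T.V}
    (h : ∀ x : T.V, (Submodule.Quotient.mk (A x) : T.Points) = Submodule.Quotient.mk (B x)) :
    A = B := by
  have hmem : ∀ x, (A - B) x ∈ T.Λ := fun x => (Submodule.Quotient.eq _).1 (h x)
  ext x
  have hx : (A - B) x = 0 := by
    by_contra hne
    have h1 : Filter.Tendsto (fun n : ℕ => ((n : ℂ))⁻¹) Filter.atTop (𝓝 0) :=
      tendsto_inv_atTop_nhds_zero_nat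
    have h2 : Filter.Tendsto (fun n : ℕ => (⟨((n : ℂ))⁻¹ • (A - B) x, by
        rw [← map_smul]; exact hmem _⟩ : T.Λ)) Filter.atTop (𝓝 0) := by
      rw [tendsto_subtype_rng]
      simpa using h1.smul_const ((A - B) x)
    rw [nhds_discrete, Filter.tendsto_pure] at h2
    obtain ⟨n, hn, hn0⟩ := (h2.and (Filter.eventually_ne_atTop 0)).exists
    have h3 := congrArg Subtype.val hn
    have h4 : ((n : ℂ))⁻¹ • (A - B) x = 0 := h3
    rcases smul_eq_zero.1 h4 with h5 | h5
    · exact hn0 (by exact_mod_cast inv_eq_zero.1 h5)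
    · exact hne h5
  exact sub_eq_zero.1 hx

/-- A group endomorphism of `V/Λ` induced by a `ℂ`-linear map is holomorphic. -/
theorem isHolomorphic_of_lift {f : T.Points →+ T.Points} (A : T.V →ₗ[ℂ] T.V)
    (h : ∀ x : T.V, (Submodule.Quotient.mk (A x) : T.Points) = f (Submodule.Quotient.mk x)) :
    T.IsHolomorphic f := fun _ =>
  ⟨Set.univ, Filter.univ_mem, A,
    (LinearMap.toContinuousLinearMap A).differentiable.differentiableOn, fun x _ => h x⟩

/-- `End(T)`: the ring of endomorphisms of the complex Lie group `T`, i.e. of holomorphic group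
endomorphisms of `V/Λ`. -/
def EndRing : Subring (AddMonoid.End T.Points) where
  carrier := {f | T.IsHolomorphic f}
  one_mem' := T.isHolomorphic_of_lift (f := (1 : AddMonoid.End T.Points)) 1 fun _ => rfl
  zero_mem' := T.isHolomorphic_of_lift (f := (0 : AddMonoid.End T.Points)) 0 fun _ => rfl
  mul_mem' := by
    intro f g hf hg
    obtain ⟨A, hA⟩ := T.exists_lift f hf
    obtain ⟨B, hB⟩ := T.exists_lift g hg
    refine T.isHolomorphic_of_lift (f := f * g) (A * B) fun x => ?_
    rw [Module.End.mul_apply, hA, hB]; rfl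
  add_mem' := by
    intro f g hf hg
    obtain ⟨A, hA⟩ := T.exists_lift f hf
    obtain ⟨B, hB⟩ := T.exists_lift g hg
    refine T.isHolomorphic_of_lift (f := f + g) (A + B) fun x => ?_
    rw [LinearMap.add_apply, Submodule.Quotient.mk_add, hA, hB]; rfl
  neg_mem' := by
    intro f hf
    obtain ⟨A, hA⟩ := T.exists_lift f hf
    refine T.isHolomorphic_of_lift (f := -f) (-A) fun x => ?_
    rw [LinearMap.neg_apply, Submodule.Quotient.mk_neg, hA]; rfl

/-- The `ℂ`-linear endomorphism of `V` that induces a given endomorphism of `T`. -/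
def lift (f : T.EndRing) : Module.End ℂ T.V := (T.exists_lift f.1 f.2).choose

theorem mk_lift (f : T.EndRing) (x : T.V) :
    (Submodule.Quotient.mk (T.lift f x) : T.Points) = f.1 (Submodule.Quotient.mk x) :=
  (T.exists_lift f.1 f.2).choose_spec x

theorem lift_mem (f : T.EndRing) {x : T.V} (hx : x ∈ T.Λ) : T.lift f x ∈ T.Λ := by
  have := T.mk_lift f x
  rw [(Submodule.Quotient.mk_eq_zero _).2 hx, map_zero] at this
  exact (Submodule.Quotient.mk_eq_zero _).1 this

/-- The action of `End(T)` on `Λ = H₁(T, ℤ)`. -/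
def latticeRep : T.EndRing →+* Module.End ℤ T.Λ where
  toFun f := ((T.lift f).restrictScalars ℤ).restrict fun _ hx => T.lift_mem f hx
  map_one' := by
    have h : T.lift 1 = 1 := T.lift_unique fun x => T.mk_lift 1 x
    ext x; simp [h]
  map_zero' := by
    have h : T.lift 0 = 0 := T.lift_unique fun x => T.mk_lift 0 x
    ext x; simp [h]
  map_mul' f g := by
    have h : T.lift (f * g) = T.lift f * T.lift g := T.lift_unique fun x => by
      rw [T.mk_lift, Module.End.mul_apply, T.mk_lift, T.mk_lift]; rfl
    ext x; exact LinearMap.congr_fun h (x : T.V)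
  map_add' f g := by
    have h : T.lift (f + g) = T.lift f + T.lift g := T.lift_unique fun x => by
      rw [T.mk_lift, LinearMap.add_apply, Submodule.Quotient.mk_add, T.mk_lift, T.mk_lift]; rfl
    ext x; exact LinearMap.congr_fun h (x : T.V)

/-- `End⁰(T) = ℚ ⊗ End(T)`. -/
abbrev EndAlg : Type u := ℚ ⊗[ℤ] T.EndRing

/-- `H₁(T, ℚ) = Λ ⊗ ℚ`. -/
abbrev H1Q : Type u := ℚ ⊗[ℤ] T.Λ

/-- The natural action of `End⁰(T)` on `H₁(T, ℚ)`. -/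
def rationalRep : T.EndAlg →ₐ[ℚ] Module.End ℚ T.H1Q :=
  Algebra.TensorProduct.lift (Algebra.ofId ℚ _)
    ((Module.End.baseChangeHom ℤ ℚ T.Λ).comp T.latticeRep.toIntAlgHom)
    fun q _ => Algebra.commutes q _

/-! ### Hodge structures and the Hodge group -/

/-- `H₁(T, ℂ) = H₁(T, ℚ) ⊗ ℂ`. -/
abbrev H1C : Type u := ℂ ⊗[ℚ] T.H1Q

/-- The map `H₁(T, ℂ) → V ⊗_ℝ ℂ` with `z ⊗ (q ⊗ x) ↦ z q ⊗ x`. -/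
def toVC : T.H1C →ₗ[ℂ] ℂ ⊗[ℝ] T.V :=
  LinearMap.liftBaseChange ℂ (LinearMap.liftBaseChange ℚ
    ((((TensorProduct.mk ℝ ℂ T.V 1).restrictScalars ℤ).comp T.Λ.subtype)))

theorem toVC_tmul (z : ℂ) (q : ℚ) (x : T.Λ) :
    T.toVC (z ⊗ₜ[ℚ] (q ⊗ₜ[ℤ] x)) = (z * q) ⊗ₜ[ℝ] (x : T.V) := by
  simp [toVC, TensorProduct.smul_tmul', Rat.smul_def]

theorem toVC_bijective : Function.Bijective T.toVC := by
  have : Module.Free ℤ T.Λ := ZLattice.module_free ℝ T.Λ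
  let b := Module.Free.chooseBasis ℤ T.Λ
  let b₁ : Module.Basis _ ℂ T.H1C := (b.baseChange ℚ).baseChange ℂ
  let b₂ : Module.Basis _ ℂ (ℂ ⊗[ℝ] T.V) := (b.ofZLatticeBasis ℝ T.Λ).baseChange ℂ
  have h : T.toVC = (b₁.equiv b₂ (Equiv.refl _)).toLinearMap := by
    refine b₁.ext fun i => ?_
    have h1 : b₁ i = 1 ⊗ₜ[ℚ] (1 ⊗ₜ[ℤ] b i) := by simp [b₁]
    have h2 : b₂ i = 1 ⊗ₜ[ℝ] (b i : T.V) := by simp [b₂]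
    rw [LinearEquiv.coe_coe, Module.Basis.equiv_apply, Equiv.refl_apply, h1, h2, toVC_tmul]
    simp
  rw [h]
  exact (b₁.equiv b₂ (Equiv.refl _)).bijective

/-- The canonical isomorphism `H₁(T, ℂ) = V ⊗_ℝ ℂ`. -/
def equivVC : T.H1C ≃ₗ[ℂ] ℂ ⊗[ℝ] T.V := LinearEquiv.ofBijective T.toVC T.toVC_bijective

/-- Multiplication by `z` on `V`, extended `ℂ`-linearly to `V ⊗_ℝ ℂ = H₁(T, ℂ)`. -/
def mulC (z : ℂ) : T.H1C →ₗ[ℂ] T.H1C :=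
  T.equivVC.symm.toLinearMap ∘ₗ
    (((z • LinearMap.id : T.V →ₗ[ℂ] T.V).restrictScalars ℝ).baseChange ℂ) ∘ₗ
      T.equivVC.toLinearMap

/-- The Hodge group `Hdg(T)`: the smallest algebraic `ℚ`-subgroup of `GL(H₁(T, ℚ))` whose group of
real points contains multiplication by `z` for all complex `z` with `|z| = 1`. -/
def hodgeGroup : Subgroup (T.H1C ≃ₗ[ℂ] T.H1C) :=
  algebraicQClosure {g | ∃ z : ℂ, ‖z‖ = 1 ∧ g.toLinearMap = T.mulC z}

/-- `H_{-1,0}(T)`, the eigenspace of multiplication by `i` for the eigenvalue `i`. -/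
def hodgeM10 : Submodule ℂ T.H1C := Module.End.eigenspace (T.mulC Complex.I) Complex.I

/-- `H_{0,-1}(T)`, the eigenspace of multiplication by `i` for the eigenvalue `-i`. -/
def hodge0M1 : Submodule ℂ T.H1C := Module.End.eigenspace (T.mulC Complex.I) (-Complex.I)

/-- `H²(T, ℂ)`, the alternating `ℂ`-bilinear forms on `H₁(T, ℂ)`. -/
abbrev H2C : Type u := T.H1C [⋀^Fin 2]→ₗ[ℂ] ℂ

/-- `H²(T, ℚ)`, the alternating bilinear forms on `H₁(T, ℚ)`, viewed as the `ℚ`-subspace of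
`H²(T, ℂ)` that consists of the forms with rational values on `H₁(T, ℚ)`. -/
def H2Q : Submodule ℚ T.H2C where
  carrier := {ω | ∀ v : Fin 2 → T.H1Q, ∃ q : ℚ, ω (fun i => 1 ⊗ₜ[ℚ] v i) = q}
  zero_mem' := fun v => ⟨0, by simp⟩
  add_mem' := by
    intro ω η hω hη v
    obtain ⟨q, hq⟩ := hω v
    obtain ⟨r, hr⟩ := hη v
    exact ⟨q + r, by simp [hq, hr]⟩
  smul_mem' := by
    intro c ω hω v
    obtain ⟨q, hq⟩ := hω v
    exact ⟨c * q, by simp [hq, Rat.smul_def]⟩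

/-- The alternating forms `ω` with `ω(x, y) = 0` for all `x ∈ A` and `y ∈ B`. -/
def formsVanishing (A B : Submodule ℂ T.H1C) : Submodule ℂ T.H2C where
  carrier := {ω | ∀ x ∈ A, ∀ y ∈ B, ω ![x, y] = 0}
  zero_mem' := by intro x _ y _; simp
  add_mem' := by
    intro ω η hω hη x hx y hy
    simp [hω x hx y hy, hη x hx y hy]
  smul_mem' := by
    intro c ω hω x hx y hy
    simp [hω x hx y hy]

/-- `H^{2,0}(T)`: the alternating forms on `H_{-1,0}(T)`, extended by zero on `H_{0,-1}(T)`. -/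
def H20 : Submodule ℂ T.H2C :=
  T.formsVanishing T.hodgeM10 T.hodge0M1 ⊓ T.formsVanishing T.hodge0M1 T.hodge0M1

/-- `H^{1,1}(T)`. -/
def H11 : Submodule ℂ T.H2C :=
  T.formsVanishing T.hodgeM10 T.hodgeM10 ⊓ T.formsVanishing T.hodge0M1 T.hodge0M1

/-- `H^{0,2}(T)`. -/
def H02 : Submodule ℂ T.H2C :=
  T.formsVanishing T.hodgeM10 T.hodgeM10 ⊓ T.formsVanishing T.hodgeM10 T.hodge0M1

/-- The complexification `H_ℂ` of a rational subspace `H` of `H²(T, ℚ)`, inside `H²(T, ℂ)`. -/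
def complexify (H : Submodule ℚ T.H2C) : Submodule ℂ T.H2C := Submodule.span ℂ (H : Set T.H2C)

/-- `H` is a rational Hodge substructure of `H²(T, ℚ)`: a rational subspace whose complexification
is the sum of its intersections with the Hodge components. -/
def IsHodgeSubstructure (H : Submodule ℚ T.H2C) : Prop :=
  H ≤ T.H2Q ∧
    T.complexify H =
      (T.complexify H ⊓ T.H20) ⊔ (T.complexify H ⊓ T.H11) ⊔ (T.complexify H ⊓ T.H02)

/-- `T` is `2`-simple (irreducible in weight `2`): the complexification of a rational Hodge
substructure of `H²(T, ℚ)` that meets `H^{2,0}(T)` nontrivially contains `H^{2,0}(T)`.  (The notion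
is used for tori of dimension at least `2`.) -/
def IsTwoSimple : Prop :=
  ∀ H : Submodule ℚ T.H2C, T.IsHodgeSubstructure H →
    T.complexify H ⊓ T.H20 ≠ ⊥ → T.H20 ≤ T.complexify H

end ComplexTorus

end

/-! Since `ℂ ⊗ E` is the product of copies of `ℂ` indexed by the embeddings `σ : E → ℂ`, the complex
points of `Res_{E/ℚ} SL₂` are a product of groups `SL₂(ℂ)`, one for each `σ`, and `H₁(T, ℂ)` is a
sum of planes `W_σ`. `Aut(ℂ)` permutes the factors as it permutes the embeddings.

Existence. Let `J` be a matrix of determinant `1` and square `-1` over `ℝ ⊗ E`. It gives a complex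
structure on `ℝ ⊗ E²`, hence a torus. A number `a + bi` of modulus `1` acts as `a + bJ`, of
determinant `a² + b² = 1`, so the Hodge group lies in `Res SL₂`. Take `J` in the polynomial family
`jMat x r`, with the coordinates of `x` and the number `r` real and algebraically independent over
`ℚ`. A rational equation that holds at this point holds identically in the parameters, so the Hodge
group contains the whole family, and the family generates `SL₂(ℂ ⊗ E)` (`eq_top_of_jMat_mem`,
`resSL_le_of_generic`). Both `End⁰(T) = E` and simplicity then follow from the commutant and the
irreducibility of `Res SL₂` acting on `E²`.

Criterion. Multiplication by `i` lies in `Res SL₂` and has square `-1`, so on each `W_σ` it has the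
two eigenvalues `i` and `-i`. Thus `H_{-1,0}` has one line in each `W_σ`, and `H^{2,0}` has as basis
one wedge for each two-element set `{σ, τ}`. The complexification of a Hodge substructure is stable
under `Res SL₂` and under `Aut(ℂ)`. If it has a form nonzero on `W_σ × W_τ` with `σ ≠ τ`, Weyl
elements and weight projections extract the wedge of `{σ, τ}` (`wedge_mem_of_apply_ne_zero`), and
automorphisms of `ℂ` give the wedges of the whole orbit of this pair (`wedge_galois_mem`).
Transitivity on pairs therefore gives `2`-simplicity. Conversely, the forms supported on the pairs
in one orbit are defined over `ℚ` and form a Hodge substructure (`complexify_rationalPairForms`,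
`isHodgeSubstructure_rationalPairForms`), so `2`-simplicity leaves room for a single orbit.
Transitivity on embeddings follows from transitivity on pairs because `g > 2`. -/

noncomputable section

/-! ## The algebra `ℂ ⊗ E` of a number field `E` -/

section EmbeddingEval

variable {E : Type u} [Field E] [NumberField E]

/-- The homomorphism `ℂ ⊗ E → ℂ`, `z ⊗ e ↦ z σ(e)`, for an embedding `σ` of `E` in `ℂ`. -/
def embEval (σ : E →+* ℂ) : (ℂ ⊗[ℚ] E) →ₐ[ℂ] ℂ :=
  Algebra.TensorProduct.lift (AlgHom.id ℂ ℂ) σ.toRatAlgHom fun _ _ => mul_comm _ _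

@[simp]
theorem embEval_tmul (σ : E →+* ℂ) (z : ℂ) (e : E) : embEval σ (z ⊗ₜ[ℚ] e) = z * σ e :=
  Algebra.TensorProduct.lift_tmul _ _ _ _ _

/-- An integral basis of `E` is sent to the lattice basis of the canonical embedding, which is a
complex basis of the product. -/
theorem bijective_pi_embEval :
    Function.Bijective (AlgHom.pi fun σ : E →+* ℂ => embEval σ) := by
  let b₁ := (NumberField.integralBasis E).baseChange ℂ
  let b₂ := NumberField.canonicalEmbedding.latticeBasis E
  have h : (AlgHom.pi fun σ : E →+* ℂ => embEval σ).toLinearMap =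
      (b₁.equiv b₂ (Equiv.refl _)).toLinearMap := by
    refine b₁.ext fun i => ?_
    rw [LinearEquiv.coe_coe, Module.Basis.equiv_apply, Equiv.refl_apply,
      NumberField.canonicalEmbedding.latticeBasis_apply]
    ext σ
    simp [b₁, NumberField.canonicalEmbedding]
  have h' : ⇑(AlgHom.pi fun σ : E →+* ℂ => embEval σ) = b₁.equiv b₂ (Equiv.refl _) := by
    ext1 x; exact LinearMap.congr_fun h x
  rw [h']
  exact (b₁.equiv b₂ (Equiv.refl _)).bijective

/-- The isomorphism `ℂ ⊗ E ≃ ∏_σ ℂ`. -/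
def embEquiv (E : Type u) [Field E] [NumberField E] : (ℂ ⊗[ℚ] E) ≃ₐ[ℂ] ((E →+* ℂ) → ℂ) :=
  AlgEquiv.ofBijective _ bijective_pi_embEval

@[simp]
theorem embEquiv_apply (r : ℂ ⊗[ℚ] E) (σ : E →+* ℂ) : embEquiv E r σ = embEval σ r := rfl

@[simp]
theorem embEval_embEquiv_symm (f : (E →+* ℂ) → ℂ) (σ : E →+* ℂ) :
    embEval σ ((embEquiv E).symm f) = f σ := by
  rw [← embEquiv_apply, AlgEquiv.apply_symm_apply]

theorem embEval_ext {r s : ℂ ⊗[ℚ] E} (h : ∀ σ, embEval σ r = embEval σ s) : r = s :=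
  (embEquiv E).injective (funext h)

theorem isUnit_iff_embEval_ne_zero {r : ℂ ⊗[ℚ] E} : IsUnit r ↔ ∀ σ, embEval σ r ≠ 0 := by
  rw [← MulEquiv.isUnit_map (embEquiv E), Pi.isUnit_iff]
  simp

open Classical in
/-- The idempotent of `ℂ ⊗ E` that corresponds to the embedding `σ`. -/
def embIdem (σ : E →+* ℂ) : ℂ ⊗[ℚ] E := (embEquiv E).symm (Pi.single σ 1)

open Classical in
@[simp]
theorem embEval_embIdem (σ τ : E →+* ℂ) : embEval τ (embIdem σ) = if τ = σ then 1 else 0 := by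
  simp [embIdem, Pi.single_apply]

theorem embIdem_mul_of_ne {σ τ : E →+* ℂ} (h : σ ≠ τ) : embIdem σ * embIdem τ = 0 := by
  classical
  refine embEval_ext fun ρ => ?_
  by_cases h' : ρ = σ
  · subst h'; simp [h]
  · simp [h']

theorem sum_embIdem : ∑ σ : E →+* ℂ, embIdem σ = 1 := by
  classical
  refine embEval_ext fun ρ => ?_
  simp

theorem mul_embIdem (r : ℂ ⊗[ℚ] E) (σ : E →+* ℂ) :
    r * embIdem σ = embEval σ r • embIdem σ := by
  classical
  refine embEval_ext fun ρ => ?_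
  by_cases h' : ρ = σ
  · subst h'; simp
  · simp [h']

end EmbeddingEval

/-! ## Automorphisms of `ℂ` -/

section AutC

open Cardinal

/-- Over a countable subring all transcendence bases of `ℂ` have the cardinality of `ℂ`. A bijection
between two of them extends the identification of the images of `R` to the adjoined polynomial
rings, and then to their algebraic closures. -/
theorem exists_ringEquiv_complex_of_injective {R : Type} [CommRing R] [Nontrivial R] [Countable R]
    (i j : R →+* ℂ) (hi : Function.Injective i) (hj : Function.Injective j) :
    ∃ s : ℂ ≃+* ℂ, ∀ r, s (i r) = j r := by
  -- Two separate fields `K` and `L` are used because `ℂ` is to carry two different `R`-algebra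
  -- structures, through `i` and through `j`.
  have key : ∀ (K L : Type) [Field K] [Field L] [IsAlgClosed K] [IsAlgClosed L] [Algebra R K]
      [Algebra R L], Function.Injective (algebraMap R K) → Function.Injective (algebraMap R L) →
      ℵ₀ < #K → #K = #L → ∃ s : K ≃+* L, ∀ r, s (algebraMap R K r) = algebraMap R L r := by
    intro K L _ _ _ _ _ _ hK hL hc hKL
    have : FaithfulSMul R K := (faithfulSMul_iff_algebraMap_injective R K).2 hK
    have : FaithfulSMul R L := (faithfulSMul_iff_algebraMap_injective R L).2 hL
    obtain ⟨s, hs⟩ := exists_isTranscendenceBasis R K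
    obtain ⟨t, ht⟩ := exists_isTranscendenceBasis R L
    have hst : #s = #t := by
      rw [← IsAlgClosed.cardinal_eq_cardinal_transcendence_basis_of_aleph0_lt' _ hs
          (mk_le_aleph0) hc,
        ← IsAlgClosed.cardinal_eq_cardinal_transcendence_basis_of_aleph0_lt' _ ht
          (mk_le_aleph0) (hKL ▸ hc), hKL]
    obtain ⟨e⟩ := Cardinal.eq.1 hst
    let _ := IsAlgClosed.isAlgClosure_of_transcendence_basis _ hs
    let _ := IsAlgClosed.isAlgClosure_of_transcendence_basis _ ht
    let e' : Algebra.adjoin R (Set.range ((↑) : s → K)) ≃ₐ[R]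
        Algebra.adjoin R (Set.range ((↑) : t → L)) :=
      hs.1.aevalEquiv.symm.trans ((MvPolynomial.renameEquiv R e).trans ht.1.aevalEquiv)
    refine ⟨IsAlgClosure.equivOfEquiv K L e'.toRingEquiv, fun r => ?_⟩
    rw [IsScalarTower.algebraMap_apply R (Algebra.adjoin R (Set.range ((↑) : s → K))) K,
      IsAlgClosure.equivOfEquiv_algebraMap,
      IsScalarTower.algebraMap_apply R (Algebra.adjoin R (Set.range ((↑) : t → L))) L]
    congr 1
    exact e'.commutes r
  have hc : ℵ₀ < #ℂ := by rw [Cardinal.mk_complex]; exact Cardinal.aleph0_lt_continuum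
  exact @key ℂ ℂ _ _ _ _ i.toAlgebra j.toAlgebra hi hj hc rfl

/-- A complex number that is fixed by all automorphisms of `ℂ` is rational. -/
theorem exists_rat_of_forall_ringEquiv {x : ℂ} (hx : ∀ s : ℂ ≃+* ℂ, s x = x) :
    ∃ q : ℚ, x = q := by
  by_cases ha : IsAlgebraic ℚ x
  · have hint : IsIntegral ℚ x := ha.isIntegral
    have : Fact (Irreducible (minpoly ℚ x)) := ⟨minpoly.irreducible hint⟩
    -- Every conjugate `y` of `x` is the image of `x` under an automorphism of `ℂ`, hence equals
    -- `x`. By separability the minimal polynomial then has degree one.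
    have hroot : ∀ y ∈ (minpoly ℚ x).aroots ℂ, y = x := by
      intro y hy
      have hy' := Polynomial.mem_aroots.1 hy
      have : Countable (AdjoinRoot (minpoly ℚ x)) := by
        have : Countable (Polynomial ℚ) := by
          rw [← Cardinal.mk_le_aleph0_iff]
          exact (Polynomial.cardinalMk_le_max).trans (by simp)
        exact AdjoinRoot.mk_surjective.countable
      obtain ⟨s, hs⟩ := exists_ringEquiv_complex_of_injective
        (AdjoinRoot.lift (algebraMap ℚ ℂ) x (minpoly.aeval ℚ x))
        (AdjoinRoot.lift (algebraMap ℚ ℂ) y hy'.2) (RingHom.injective _) (RingHom.injective _)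
      have h1 : AdjoinRoot.lift (algebraMap ℚ ℂ) x (minpoly.aeval ℚ x) (AdjoinRoot.root _) = x :=
        AdjoinRoot.lift_root _
      have h2 : AdjoinRoot.lift (algebraMap ℚ ℂ) y hy'.2 (AdjoinRoot.root _) = y :=
        AdjoinRoot.lift_root _
      rw [← h2, ← hs]
      exact (congrArg s h1).trans (hx s)
    have hcard : ((minpoly ℚ x).aroots ℂ).card = (minpoly ℚ x).natDegree :=
      IsAlgClosed.card_aroots_eq_natDegree
    have hnd : ((minpoly ℚ x).aroots ℂ).Nodup :=
      Polynomial.nodup_aroots_iff_of_splits (minpoly.ne_zero hint) (IsAlgClosed.splits _) |>.2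
        (minpoly.irreducible hint).separable
    have h1 : (minpoly ℚ x).natDegree ≤ 1 := by
      rw [← hcard, ← Multiset.toFinset_card_of_nodup hnd, Finset.card_le_one]
      intro a ha b hb
      rw [hroot a (Multiset.mem_toFinset.1 ha), hroot b (Multiset.mem_toFinset.1 hb)]
    have h2 : (minpoly ℚ x).degree = 1 := by
      rw [Polynomial.degree_eq_natDegree (minpoly.ne_zero hint)]
      have := minpoly.natDegree_pos hint
      have : (minpoly ℚ x).natDegree = 1 := by omega
      rw [this]; rfl
    obtain ⟨q, hq⟩ := minpoly.mem_range_of_degree_eq_one ℚ x h2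
    exact ⟨q, by rw [← hq]; rfl⟩
  · have ht : Transcendental ℚ x := ha
    -- A transcendental `x` is moved to `x + 1` by some automorphism.
    have ht' : Transcendental ℚ (x + 1) := by
      intro h
      exact ha (by simpa using h.sub (isAlgebraic_one))
    have : Countable (Polynomial ℚ) := by
      rw [← Cardinal.mk_le_aleph0_iff]
      exact (Polynomial.cardinalMk_le_max).trans (by simp)
    obtain ⟨s, hs⟩ := exists_ringEquiv_complex_of_injective
      (Polynomial.aeval (R := ℚ) x : Polynomial ℚ →+* ℂ)
      (Polynomial.aeval (R := ℚ) (x + 1) : Polynomial ℚ →+* ℂ)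
      (transcendental_iff_injective.1 ht) (transcendental_iff_injective.1 ht')
    have := hs Polynomial.X
    simp [hx] at this

/-- A finite transcendence basis would make `ℝ` algebraic over a countable ring, hence countable. -/
theorem exists_algebraicIndependent_real (n : Type) [Finite n] :
    ∃ x : n → ℝ, AlgebraicIndependent ℚ x := by
  obtain ⟨s, hs⟩ := exists_isTranscendenceBasis ℚ ℝ
  have hinf : Infinite s := by
    by_contra hfin
    rw [not_infinite_iff_finite] at hfin
    have h1 : Algebra.IsAlgebraic (Algebra.adjoin ℚ (Set.range ((↑) : s → ℝ))) ℝ := hs.isAlgebraic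
    have h2 := Algebra.IsAlgebraic.cardinalMk_le_max (Algebra.adjoin ℚ (Set.range ((↑) : s → ℝ))) ℝ
    rw [← Cardinal.mk_congr hs.1.aevalEquiv.toEquiv] at h2
    have h3 : #(MvPolynomial s ℚ) ≤ ℵ₀ :=
      MvPolynomial.cardinalMk_le_max.trans (by simp)
    have h4 : #ℝ ≤ ℵ₀ := h2.trans (max_le h3 le_rfl)
    rw [Cardinal.mk_real] at h4
    exact absurd h4 (not_le.2 Cardinal.aleph0_lt_continuum)
  have : Fintype n := Fintype.ofFinite n
  let f : n ↪ s := (Fintype.equivFin n).toEmbedding.trans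
    (Fin.valEmbedding.trans (Infinite.natEmbedding s))
  exact ⟨_, hs.1.comp f f.injective⟩

end AutC

/-! ## Generation of `SL₂` -/

section SL2

open Matrix

variable {R : Type u} [CommRing R]

/-- The upper unipotent matrix with entry `x`. -/
def upperUnip (x : R) : Matrix.SpecialLinearGroup (Fin 2) R := ⟨!![1, x; 0, 1], by simp⟩

/-- The lower unipotent matrix with entry `x`. -/
def lowerUnip (x : R) : Matrix.SpecialLinearGroup (Fin 2) R := ⟨!![1, 0; x, 1], by simp⟩

/-- A two-parameter family of matrices of trace `0` and determinant `1`. -/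
def jMat (x r : R) : Matrix.SpecialLinearGroup (Fin 2) R :=
  ⟨!![r + x * (1 + r ^ 2), -(1 + 2 * x * r + x ^ 2 * (1 + r ^ 2)); 1 + r ^ 2,
    -(r + x * (1 + r ^ 2))], by rw [det_fin_two_of]; ring⟩

theorem sl_ext {A B : Matrix.SpecialLinearGroup (Fin 2) R}
    (h : (A : Matrix (Fin 2) (Fin 2) R) = (B : Matrix (Fin 2) (Fin 2) R)) : A = B :=
  Subtype.ext h

theorem coe_upperUnip (x : R) : (upperUnip x : Matrix (Fin 2) (Fin 2) R) = !![1, x; 0, 1] := rfl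

theorem coe_lowerUnip (x : R) : (lowerUnip x : Matrix (Fin 2) (Fin 2) R) = !![1, 0; x, 1] := rfl

theorem coe_jMat (x r : R) : (jMat x r : Matrix (Fin 2) (Fin 2) R) =
    !![r + x * (1 + r ^ 2), -(1 + 2 * x * r + x ^ 2 * (1 + r ^ 2)); 1 + r ^ 2,
      -(r + x * (1 + r ^ 2))] := rfl

/-- Row reduction in a ring of stable range one. The first column of `g` is unimodular, so adding a
multiple of its lower entry makes the upper entry a unit `a`. Three more row operations turn the
lower entry into `1`, the upper entry into `1` and the lower entry into `0`; by the determinant the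
result is upper unipotent. -/
theorem eq_top_of_unipotent_mem (hR : ∀ a b : R, IsCoprime a b → ∃ t, IsUnit (a + t * b))
    (G : Subgroup (Matrix.SpecialLinearGroup (Fin 2) R)) (hu : ∀ x, upperUnip x ∈ G)
    (hl : ∀ x, lowerUnip x ∈ G) : G = ⊤ := by
  refine eq_top_iff.2 fun g _ => ?_
  have hdet : g 0 0 * g 1 1 - g 0 1 * g 1 0 = 1 := by rw [← det_fin_two, g.2]
  obtain ⟨t, ht⟩ := hR (g 0 0) (g 1 0) ⟨g 1 1, -g 0 1, by linear_combination hdet⟩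
  obtain ⟨v, hv⟩ := ht.exists_right_inv
  set a := g 0 0 + t * g 1 0 with ha
  have key : lowerUnip (-1) * (upperUnip (1 - a) * (lowerUnip (v * (1 - g 1 0)) *
      (upperUnip t * g))) =
      upperUnip (g 0 1 + t * g 1 1 +
        (1 - a) * (v * (1 - g 1 0) * (g 0 1 + t * g 1 1) + g 1 1)) := by
    refine sl_ext ?_
    simp only [Matrix.SpecialLinearGroup.coe_mul, coe_upperUnip, coe_lowerUnip]
    rw [eta_fin_two (g : Matrix (Fin 2) (Fin 2) R)]
    simp only [mul_fin_two]
    ext i j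
    fin_cases i <;> fin_cases j <;> simp
    · linear_combination (1 - a) * (1 - g 1 0) * hv - (1 + (1 - a) * (v * (1 - g 1 0))) * ha
    · linear_combination (1 - g 1 0) * (g 0 0 + t * g 1 0) * hv + g 1 0 * ha
    · linear_combination (1 - g 1 0) * (g 0 1 + t * g 1 1) * hv + g 1 1 * ha + hdet
  have := hu (g 0 1 + t * g 1 1 + (1 - a) * (v * (1 - g 1 0) * (g 0 1 + t * g 1 1) + g 1 1))
  rw [← key] at this
  rwa [G.mul_mem_cancel_left (hl _), G.mul_mem_cancel_left (hu _), G.mul_mem_cancel_left (hl _),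
    G.mul_mem_cancel_left (hu _)] at this

/-- With `U` and `L` the upper and lower unipotents, `jMat x r` is the conjugate of `jMat 0 0` by
`U(x) L(r)`. Hence `jMat (x + y) r * (jMat y r)⁻¹` is `U(x)` times a conjugate of `U(-x)`. For two
choices of `(y, r)` the second factors are `L(x)` and `L(4x)`; comparing them isolates `L(3x)`. -/
theorem eq_top_of_jMat_mem [Algebra ℚ R]
    (hR : ∀ a b : R, IsCoprime a b → ∃ t, IsUnit (a + t * b))
    (G : Subgroup (Matrix.SpecialLinearGroup (Fin 2) R)) (h0 : ∀ x, jMat x 0 ∈ G)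
    (h1 : ∀ x, jMat x 1 ∈ G) : G = ⊤ := by
  obtain ⟨c, hc⟩ : ∃ c : R, 2 * c = 1 :=
    ⟨algebraMap ℚ R (1 / 2), by
      rw [← map_ofNat (algebraMap ℚ R) 2, ← map_mul]; norm_num⟩
  obtain ⟨d, hd⟩ : ∃ c : R, 3 * c = 1 :=
    ⟨algebraMap ℚ R (1 / 3), by
      rw [← map_ofNat (algebraMap ℚ R) 3, ← map_mul]; norm_num⟩
  have hA : ∀ x : R, upperUnip x * lowerUnip x ∈ G := by
    intro x
    have : upperUnip x * lowerUnip x = jMat x 0 * (jMat 0 0)⁻¹ := by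
      rw [eq_mul_inv_iff_mul_eq]
      refine sl_ext ?_
      simp only [Matrix.SpecialLinearGroup.coe_mul, coe_upperUnip, coe_lowerUnip, coe_jMat, mul_fin_two]
      ext i j
      fin_cases i <;> fin_cases j <;>
        simp; ring
    rw [this]
    exact G.mul_mem (h0 _) (G.inv_mem (h0 _))
  have hB : ∀ x : R, upperUnip x * lowerUnip (4 * x) ∈ G := by
    intro x
    -- The shift by `-1/2` makes `jMat (-1/2) 1` antidiagonal, with entries `-1/2` and `2`;
    -- conjugation by it sends `U(-x)` to `L(4x)`.
    have : upperUnip x * lowerUnip (4 * x) = jMat (x - c) 1 * (jMat (-c) 1)⁻¹ := by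
      rw [eq_mul_inv_iff_mul_eq]
      refine sl_ext ?_
      simp only [Matrix.SpecialLinearGroup.coe_mul, coe_upperUnip, coe_lowerUnip, coe_jMat, mul_fin_two]
      ext i j
      fin_cases i <;> fin_cases j <;> simp
      · linear_combination -4 * x ^ 2 * hc
      · linear_combination (-2 * x ^ 2 * (2 * c - 1) - x) * hc
      · linear_combination -4 * x * hc
      · linear_combination -2 * x * (2 * c - 1) * hc
    rw [this]
    exact G.mul_mem (h1 _) (G.inv_mem (h1 _))
  have hl : ∀ x : R, lowerUnip x ∈ G := by
    intro x
    have : lowerUnip x = (upperUnip (d * x) * lowerUnip (d * x))⁻¹ *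
        (upperUnip (d * x) * lowerUnip (4 * (d * x))) := by
      rw [eq_inv_mul_iff_mul_eq]
      refine sl_ext ?_
      simp only [Matrix.SpecialLinearGroup.coe_mul, coe_upperUnip, coe_lowerUnip, mul_fin_two]
      ext i j
      fin_cases i <;> fin_cases j <;> simp
      · linear_combination (-d * x) * x * hd
      · linear_combination -x * hd
    rw [this]
    exact G.mul_mem (G.inv_mem (hA _)) (hB _)
  refine eq_top_of_unipotent_mem hR G (fun x => ?_) hl
  have := hA x
  rwa [G.mul_mem_cancel_right (hl x)] at this

end SL2

/-- In a product of fields, take `t = 1` on the factors where `a` vanishes, and `0` elsewhere; on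
the former `b` cannot vanish. -/
theorem exists_isUnit_add_mul {E : Type u} [Field E] [NumberField E] (a b : ℂ ⊗[ℚ] E)
    (h : IsCoprime a b) : ∃ t, IsUnit (a + t * b) := by
  classical
  refine ⟨(embEquiv E).symm fun σ => if embEval σ a = 0 then 1 else 0, ?_⟩
  rw [isUnit_iff_embEval_ne_zero]
  intro σ
  obtain ⟨u, v, huv⟩ := h
  have := congrArg (embEval σ) huv
  by_cases h0 : embEval σ a = 0
  · simp only [map_add, map_mul, map_one, h0, mul_zero, zero_add] at this
    simpa [h0] using right_ne_zero_of_mul_eq_one this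
  · simp [h0]

/-! ## Frames and `Res_{E/ℚ} SL₂` -/

section Frames

variable {W : Type u} [AddCommGroup W] [Module ℚ W] {E : Type v} [Field E] [Algebra ℚ E]

@[simp]
theorem complexAction_tmul (ρ : E →ₐ[ℚ] Module.End ℚ W) (z z' : ℂ) (e : E) (w : W) :
    complexAction ρ (z ⊗ₜ[ℚ] e) (z' ⊗ₜ[ℚ] w) = (z * z') ⊗ₜ[ℚ] ρ e w := by
  have : complexAction ρ (z ⊗ₜ[ℚ] e) =
      algebraMap ℂ (Module.End ℂ (ℂ ⊗[ℚ] W)) z * (ρ e).baseChange ℂ :=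
    Algebra.TensorProduct.lift_tmul _ _ _ _ _
  rw [this]
  simp [Module.algebraMap_end_apply, TensorProduct.smul_tmul']

/-- A trivialization `W_ℂ ≃ (ℂ ⊗ E)²` of the `ℂ ⊗ E`-module `W_ℂ`. -/
structure ComplexFrame (ρ : E →ₐ[ℚ] Module.End ℚ W) where
  toEquiv : (Fin 2 → ℂ ⊗[ℚ] E) ≃ₗ[ℂ] (ℂ ⊗[ℚ] W)
  map_act : ∀ (r : ℂ ⊗[ℚ] E) p, toEquiv (r • p) = complexAction ρ r (toEquiv p)

namespace ComplexFrame

variable {ρ : E →ₐ[ℚ] Module.End ℚ W} (θ : ComplexFrame ρ)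

theorem symm_complexAction (r : ℂ ⊗[ℚ] E) (x : ℂ ⊗[ℚ] W) :
    θ.toEquiv.symm (complexAction ρ r x) = r • θ.toEquiv.symm x := by
  rw [LinearEquiv.symm_apply_eq, θ.map_act, LinearEquiv.apply_symm_apply]

/-- The operator on `W_ℂ` with a given matrix in the frame. -/
def ofMatrix (A : Matrix (Fin 2) (Fin 2) (ℂ ⊗[ℚ] E)) : Module.End ℂ (ℂ ⊗[ℚ] W) :=
  θ.toEquiv.toLinearMap ∘ₗ (Matrix.toLin' A).restrictScalars ℂ ∘ₗ θ.toEquiv.symm.toLinearMap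

theorem ofMatrix_apply (A : Matrix (Fin 2) (Fin 2) (ℂ ⊗[ℚ] E)) (x : ℂ ⊗[ℚ] W) :
    θ.ofMatrix A x = θ.toEquiv (A.mulVec (θ.toEquiv.symm x)) := rfl

theorem ofMatrix_toEquiv (A : Matrix (Fin 2) (Fin 2) (ℂ ⊗[ℚ] E)) (p : Fin 2 → ℂ ⊗[ℚ] E) :
    θ.ofMatrix A (θ.toEquiv p) = θ.toEquiv (A.mulVec p) := by
  rw [ofMatrix_apply, LinearEquiv.symm_apply_apply]

theorem ofMatrix_mul (A B : Matrix (Fin 2) (Fin 2) (ℂ ⊗[ℚ] E)) :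
    θ.ofMatrix (A * B) = θ.ofMatrix A * θ.ofMatrix B := by
  refine LinearMap.ext fun x => ?_
  rw [Module.End.mul_apply, ofMatrix_apply, ofMatrix_apply, ofMatrix_apply,
    LinearEquiv.symm_apply_apply, Matrix.mulVec_mulVec]

theorem ofMatrix_add (A B : Matrix (Fin 2) (Fin 2) (ℂ ⊗[ℚ] E)) :
    θ.ofMatrix (A + B) = θ.ofMatrix A + θ.ofMatrix B := by
  refine LinearMap.ext fun x => ?_
  rw [LinearMap.add_apply, ofMatrix_apply, ofMatrix_apply, ofMatrix_apply, Matrix.add_mulVec,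
    map_add]

theorem ofMatrix_one : θ.ofMatrix 1 = 1 := by
  refine LinearMap.ext fun x => ?_
  simp [ofMatrix_apply]

theorem ofMatrix_smul (z : ℂ) (A : Matrix (Fin 2) (Fin 2) (ℂ ⊗[ℚ] E)) :
    θ.ofMatrix (z • A) = z • θ.ofMatrix A := by
  refine LinearMap.ext fun x => ?_
  rw [LinearMap.smul_apply, ofMatrix_apply, ofMatrix_apply, Matrix.smul_mulVec, map_smul]

theorem ofMatrix_injective : Function.Injective θ.ofMatrix := by
  intro A B h
  refine (Matrix.toLin' (R := ℂ ⊗[ℚ] E)).injective (LinearMap.ext fun p => ?_)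
  have := LinearMap.congr_fun h (θ.toEquiv p)
  rw [ofMatrix_toEquiv, ofMatrix_toEquiv] at this
  exact θ.toEquiv.injective this

theorem ofMatrix_complexAction (A : Matrix (Fin 2) (Fin 2) (ℂ ⊗[ℚ] E)) (r : ℂ ⊗[ℚ] E)
    (x : ℂ ⊗[ℚ] W) :
    θ.ofMatrix A (complexAction ρ r x) = complexAction ρ r (θ.ofMatrix A x) := by
  rw [ofMatrix_apply, ofMatrix_apply, ← θ.map_act, ← Matrix.mulVec_smul, θ.symm_complexAction]

/-- The homomorphism `SL₂(ℂ ⊗ E) → GL(W_ℂ)` given by a frame. -/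
def slHom : Matrix.SpecialLinearGroup (Fin 2) (ℂ ⊗[ℚ] E) →*
    ((ℂ ⊗[ℚ] W) ≃ₗ[ℂ] (ℂ ⊗[ℚ] W)) where
  toFun A := θ.toEquiv.symm ≪≫ₗ (Matrix.SpecialLinearGroup.toLin' A).restrictScalars ℂ ≪≫ₗ θ.toEquiv
  map_one' := by ext1 x; simp
  map_mul' A B := by ext1 x; simp

theorem slHom_apply (A : Matrix.SpecialLinearGroup (Fin 2) (ℂ ⊗[ℚ] E)) (x : ℂ ⊗[ℚ] W) :
    θ.slHom A x = θ.ofMatrix A x := rfl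

theorem slHom_toLinearMap (A : Matrix.SpecialLinearGroup (Fin 2) (ℂ ⊗[ℚ] E)) :
    (θ.slHom A).toLinearMap = θ.ofMatrix A := rfl

/-- A frame is `ℂ ⊗ E`-linear, and the determinant is invariant under conjugation by a linear
isomorphism. -/
theorem range_slHom : θ.slHom.range = resSL ρ := by
  let _ : Module (ℂ ⊗[ℚ] E) (ℂ ⊗[ℚ] W) := complexModule ρ
  let θR : (Fin 2 → ℂ ⊗[ℚ] E) ≃ₗ[ℂ ⊗[ℚ] E] (ℂ ⊗[ℚ] W) :=
    { θ.toEquiv with map_smul' := θ.map_act }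
  ext g
  constructor
  · rintro ⟨A, rfl⟩
    refine ⟨θR.symm ≪≫ₗ Matrix.SpecialLinearGroup.toLin' A ≪≫ₗ θR, ?_, fun x => rfl⟩
    rw [LinearEquiv.det_conj]
    ext
    rw [LinearEquiv.coe_det, Matrix.SpecialLinearGroup.toLin'_to_linearMap, LinearMap.det_toLin',
      A.2, Units.val_one]
  · rintro ⟨a, ha, hag⟩
    let a' := θR ≪≫ₗ a ≪≫ₗ θR.symm
    have ha' : LinearMap.det a'.toLinearMap = 1 := by
      rw [← LinearEquiv.coe_det]
      have : LinearEquiv.det a' = LinearEquiv.det a := LinearEquiv.det_conj a θR.symm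
      rw [this, ha, Units.val_one]
    refine ⟨⟨LinearMap.toMatrix' a'.toLinearMap, by rw [LinearMap.det_toMatrix', ha']⟩, ?_⟩
    ext1 x
    change θ.ofMatrix (LinearMap.toMatrix' a'.toLinearMap) x = g x
    rw [ofMatrix_apply, ← hag, ← Matrix.toLin'_apply, Matrix.toLin'_toMatrix']
    change θR (θR.symm (a (θR (θR.symm x)))) = a x
    simp

theorem mem_resSL_iff {g : (ℂ ⊗[ℚ] W) ≃ₗ[ℂ] (ℂ ⊗[ℚ] W)} :
    g ∈ resSL ρ ↔ ∃ A : Matrix (Fin 2) (Fin 2) (ℂ ⊗[ℚ] E), A.det = 1 ∧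
      θ.ofMatrix A = g.toLinearMap := by
  rw [← θ.range_slHom]
  constructor
  · rintro ⟨A, rfl⟩
    exact ⟨A, A.2, rfl⟩
  · rintro ⟨A, hA, hAg⟩
    exact ⟨⟨A, hA⟩, LinearEquiv.toLinearMap_injective hAg⟩

end ComplexFrame

/-! ### Frames from rational bases -/

section OfBasis

variable (ρ : E →ₐ[ℚ] Module.End ℚ W) {ι : Type*} (ε : Module.Basis ι ℚ E)
  (b : Fin 2 → W) (β : Module.Basis (Σ _ : Fin 2, ι) ℚ W)

theorem basis_equiv_eq_sum_complexAction (hβ : ∀ j i, β ⟨j, i⟩ = ρ (ε i) (b j))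
    (q : Fin 2 → ℂ ⊗[ℚ] E) :
    (Pi.basis fun _ : Fin 2 => ε.baseChange ℂ).equiv (β.baseChange ℂ) (Equiv.refl _) q =
      ∑ j, complexAction ρ (q j) (1 ⊗ₜ b j) := by
  let F : (Fin 2 → ℂ ⊗[ℚ] E) →ₗ[ℂ] (ℂ ⊗[ℚ] W) :=
    ∑ j, LinearMap.applyₗ (1 ⊗ₜ b j) ∘ₗ (complexAction ρ).toLinearMap ∘ₗ LinearMap.proj j
  have hF : ((Pi.basis fun _ : Fin 2 => ε.baseChange ℂ).equiv (β.baseChange ℂ)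
      (Equiv.refl _)).toLinearMap = F := by
    refine (Pi.basis fun _ : Fin 2 => ε.baseChange ℂ).ext fun ⟨j, i⟩ => ?_
    rw [LinearEquiv.coe_coe, Module.Basis.equiv_apply]
    have h1 : F (Pi.single j (1 ⊗ₜ ε i)) =
        ∑ k, complexAction ρ (Pi.single (M := fun _ => ℂ ⊗[ℚ] E) j (1 ⊗ₜ ε i) k)
          (1 ⊗ₜ b k) := by simp [F]
    rw [Equiv.refl_apply, Pi.basis_apply, Module.Basis.baseChange_apply,
      Module.Basis.baseChange_apply, h1, Finset.sum_eq_single j]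
    · simp [hβ]
    · intro k _ hk
      simp [hk]
    · simp
  have := LinearMap.congr_fun hF q
  simpa [F] using this

/-- The frame given by a basis of `W` over `E`. -/
def ComplexFrame.ofBasis (hβ : ∀ j i, β ⟨j, i⟩ = ρ (ε i) (b j)) : ComplexFrame ρ where
  toEquiv := (Pi.basis fun _ : Fin 2 => ε.baseChange ℂ).equiv (β.baseChange ℂ) (Equiv.refl _)
  map_act r p := by
    rw [basis_equiv_eq_sum_complexAction ρ ε b β hβ, basis_equiv_eq_sum_complexAction ρ ε b β hβ,
      map_sum]
    simp

theorem ComplexFrame.ofBasis_apply (hβ : ∀ j i, β ⟨j, i⟩ = ρ (ε i) (b j))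
    (q : Fin 2 → ℂ ⊗[ℚ] E) : (ofBasis ρ ε b β hβ).toEquiv q =
      ∑ j, complexAction ρ (q j) (1 ⊗ₜ b j) :=
  basis_equiv_eq_sum_complexAction ρ ε b β hβ q

end OfBasis

end Frames

/-! ## Rational functionals -/

section RationalFunctionals

variable {W : Type u} [AddCommGroup W] [Module ℚ W]

/-- An element of `W_ℂ` that is killed by all rational functionals vanishing on `U` lies in
`U_ℂ`. -/
theorem mem_baseChange_of_forall_dual (U : Submodule ℚ W) {x : ℂ ⊗[ℚ] W}
    (hx : ∀ φ : Module.Dual ℚ W, (∀ u ∈ U, φ u = 0) → Module.Dual.baseChange ℂ φ x = 0) :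
    x ∈ U.baseChange ℂ := by
  -- The coordinates of `W/U`, pulled back to `W`, vanish on `U`, so the hypothesis kills the image
  -- of `x` in `(W/U)_ℂ`; exactness of the tensor product then places `x` in `U_ℂ`.
  have h0 : U.mkQ.baseChange ℂ x = 0 := by
    let q := Module.Free.chooseBasis ℚ (W ⧸ U)
    refine (q.baseChange ℂ).repr.injective (Finsupp.ext fun i => ?_)
    have key : ∀ y : ℂ ⊗[ℚ] W, (q.baseChange ℂ).repr (U.mkQ.baseChange ℂ y) i =
        Module.Dual.baseChange ℂ (q.coord i ∘ₗ U.mkQ) y := by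
      intro y
      induction y with
      | zero => simp
      | add a b ha hb => simp [ha, hb]
      | tmul z w => simp [Rat.smul_def, mul_comm]
    rw [key, hx, map_zero, Finsupp.zero_apply]
    intro u hu
    rw [LinearMap.comp_apply, Submodule.mkQ_apply, (Submodule.Quotient.mk_eq_zero U).2 hu, map_zero]
  have hex : Function.Exact (U.subtype.lTensor ℂ) (U.mkQ.lTensor ℂ) :=
    lTensor_exact ℂ (LinearMap.exact_subtype_mkQ U) (Submodule.mkQ_surjective U)
  obtain ⟨y, hy⟩ := (hex x).1 h0
  rw [← hy]
  clear hy
  induction y with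
  | zero => simp
  | add a b ha hb => rw [map_add]; exact Submodule.add_mem _ ha hb
  | tmul z w => exact Submodule.tmul_mem_baseChange_of_mem z w.2

theorem dual_baseChange_eq_zero {U : Submodule ℚ W} {φ : Module.Dual ℚ W}
    (hφ : ∀ u ∈ U, φ u = 0) {x : ℂ ⊗[ℚ] W} (hx : x ∈ U.baseChange ℂ) :
    Module.Dual.baseChange ℂ φ x = 0 := by
  rw [Submodule.baseChange_eq_span] at hx
  induction hx using Submodule.span_induction with
  | mem x h =>
    obtain ⟨u, hu, rfl⟩ := h
    simp [hφ u hu]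
  | zero => simp
  | add x y _ _ hx hy => simp [hx, hy]
  | smul a x _ hx => simp [hx]

theorem eq_of_forall_dual {x y : ℂ ⊗[ℚ] W}
    (h : ∀ φ : Module.Dual ℚ W, Module.Dual.baseChange ℂ φ x = Module.Dual.baseChange ℂ φ y) :
    x = y := by
  have := mem_baseChange_of_forall_dual (⊥ : Submodule ℚ W) (x := x - y) fun φ _ => by
    rw [map_sub, h, sub_self]
  rw [Submodule.baseChange_bot, Submodule.mem_bot] at this
  exact sub_eq_zero.1 this

/-- The version of `mem_baseChange_of_forall_dual` for complex vectors. -/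
theorem mem_span_of_forall_rat {κ : Type*} [Fintype κ] (U : Submodule ℚ (κ → ℚ)) {x : κ → ℂ}
    (hx : ∀ c : κ → ℚ, (∀ u ∈ U, ∑ k, c k * u k = 0) → ∑ k, (c k : ℂ) * x k = 0) :
    x ∈ Submodule.span ℂ ((fun (u : κ → ℚ) k => (u k : ℂ)) '' (U : Set (κ → ℚ))) := by
  classical
  let F : (ℂ ⊗[ℚ] (κ → ℚ)) →ₗ[ℂ] (κ → ℂ) :=
    LinearMap.pi fun k => Module.Dual.baseChange ℂ (LinearMap.proj k)
  let y : ℂ ⊗[ℚ] (κ → ℚ) := ∑ k, x k ⊗ₜ Pi.single k 1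
  have hy : F y = x := by
    ext k
    simp [F, y, Pi.single_apply]
  have hyU : y ∈ U.baseChange ℂ := by
    refine mem_baseChange_of_forall_dual U fun φ hφ => ?_
    have h1 : ∀ u : κ → ℚ, φ u = ∑ k, φ (Pi.single k 1) * u k := by
      intro u
      conv_lhs => rw [pi_eq_sum_univ' u]
      simp [mul_comm]
    have := hx (fun k => φ (Pi.single k 1)) fun u hu => by rw [← h1, hφ u hu]
    simpa [y, Rat.smul_def] using this
  rw [← hy]
  rw [Submodule.baseChange_eq_span] at hyU
  refine Submodule.span_mono ?_ (Submodule.apply_mem_span_image_of_mem_span F hyU)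
  rintro _ ⟨_, ⟨u, hu, rfl⟩, rfl⟩
  refine ⟨u, hu, ?_⟩
  ext k
  simp [F, Rat.smul_def]

end RationalFunctionals

/-! ## Bilinear and alternating forms -/

section Forms

variable {R : Type v} [CommRing R] {M : Type u} [AddCommGroup M] [Module R M]

/-- The alternating map given by an alternating bilinear map. -/
def altOfBilin (B : M →ₗ[R] M →ₗ[R] R) (hB : ∀ x, B x x = 0) : M [⋀^Fin 2]→ₗ[R] R where
  toFun v := B (v 0) (v 1)
  map_update_add' := by
    intro inst v i x y
    rw [Subsingleton.elim inst (instDecidableEqFin 2)]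
    fin_cases i <;> simp
  map_update_smul' := by
    intro inst v i c x
    rw [Subsingleton.elim inst (instDecidableEqFin 2)]
    fin_cases i <;> simp
  map_eq_zero_of_eq' v i j h hij := by
    fin_cases i <;> fin_cases j <;> simp_all

@[simp]
theorem altOfBilin_apply (B : M →ₗ[R] M →ₗ[R] R) (hB : ∀ x, B x x = 0) (v : Fin 2 → M) :
    altOfBilin B hB v = B (v 0) (v 1) := rfl

theorem update_vecCons_one {α : Type*} (x y z : α) : Function.update ![x, y] 1 z = ![x, z] := by
  ext i; fin_cases i <;> rfl

/-- The bilinear map underlying an alternating map. -/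
def bilinOfAlt (ω : M [⋀^Fin 2]→ₗ[R] R) : M →ₗ[R] M →ₗ[R] R :=
  LinearMap.mk₂ R (fun x y => ω ![x, y]) (fun x x' y => by simp [ω.map_vecCons_add])
    (fun c x y => by simp [ω.map_vecCons_smul])
    (fun x y y' => by
      have := ω.map_update_add ![x, 0] 1 y y'
      rwa [update_vecCons_one, update_vecCons_one, update_vecCons_one] at this)
    (fun c x y => by
      have := ω.map_update_smul ![x, 0] 1 c y
      rwa [update_vecCons_one, update_vecCons_one] at this)

@[simp]
theorem bilinOfAlt_apply (ω : M [⋀^Fin 2]→ₗ[R] R) (x y : M) : bilinOfAlt ω x y = ω ![x, y] := rfl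

theorem alt_ext {ω η : M [⋀^Fin 2]→ₗ[R] R} (h : ∀ x y, ω ![x, y] = η ![x, y]) : ω = η := by
  ext v
  have : v = ![v 0, v 1] := by ext i; fin_cases i <;> rfl
  rw [this, h]

theorem alt_self (ω : M [⋀^Fin 2]→ₗ[R] R) (x : M) : ω ![x, x] = 0 :=
  ω.map_eq_zero_of_eq _ (i := 0) (j := 1) rfl (by simp)

theorem alt_swap (ω : M [⋀^Fin 2]→ₗ[R] R) (x y : M) : ω ![x, y] = -ω ![y, x] := by
  have h := alt_self ω (x + y)
  rw [← bilinOfAlt_apply] at h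
  simp only [map_add, LinearMap.add_apply, bilinOfAlt_apply, alt_self] at h
  linear_combination h

@[simp]
theorem alt_compLinearMap (ω : M [⋀^Fin 2]→ₗ[R] R) (f : M →ₗ[R] M) (x y : M) :
    ω.compLinearMap f ![x, y] = ω ![f x, f y] := by
  rw [AlternatingMap.compLinearMap_apply]
  congr 1
  ext i; fin_cases i <;> rfl

theorem alt_ext_basis {κ : Type*} (b : Module.Basis κ R M) {ω η : M [⋀^Fin 2]→ₗ[R] R}
    (h : ∀ i j, ω ![b i, b j] = η ![b i, b j]) : ω = η := by
  have : bilinOfAlt ω = bilinOfAlt η := b.ext fun i => b.ext fun j => by simpa using h i j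
  exact alt_ext fun x y => LinearMap.congr_fun (LinearMap.congr_fun this x) y

theorem alt_expand {κ : Type*} [Fintype κ] (b : Module.Basis κ R M) (ω : M [⋀^Fin 2]→ₗ[R] R)
    (x y : M) : ω ![x, y] = ∑ i, ∑ j, b.repr x i * b.repr y j * ω ![b i, b j] := by
  conv_lhs => rw [← bilinOfAlt_apply, ← b.sum_repr x, ← b.sum_repr y]
  simp only [map_sum, LinearMap.sum_apply, map_smul, LinearMap.smul_apply, bilinOfAlt_apply,
    smul_eq_mul, mul_assoc]
  simp only [Finset.mul_sum]
  rw [Finset.sum_comm]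
  exact Finset.sum_congr rfl fun i _ => Finset.sum_congr rfl fun j _ => by ring

theorem finite_alternatingMap_two (K : Type v) [Field K] (M : Type u) [AddCommGroup M] [Module K M]
    [FiniteDimensional K M] : FiniteDimensional K (M [⋀^Fin 2]→ₗ[K] K) := by
  let f : (M [⋀^Fin 2]→ₗ[K] K) →ₗ[K] (M →ₗ[K] M →ₗ[K] K) :=
    { toFun := bilinOfAlt
      map_add' := fun _ _ => by ext; simp
      map_smul' := fun _ _ => by ext; simp }
  refine Module.Finite.of_injective f fun ω η h => alt_ext fun x y => ?_
  exact LinearMap.congr_fun (LinearMap.congr_fun h x) y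

end Forms

/-! ## Examples of algebraic `ℚ`-subgroups -/

section AlgebraicExamples

variable {W : Type u} [AddCommGroup W] [Module ℚ W]

/-- An injective endomorphism of a finite-dimensional space is onto. This makes the stabilizers
below closed under inverses. -/
theorem exists_subgroup_of_stabilizer {M : Type*} [AddCommGroup M] [Module ℂ M] (N : Submodule ℂ M)
    [FiniteDimensional ℂ N] (f : M ≃ₗ[ℂ] M) (h : ∀ x ∈ N, f x ∈ N) : ∀ x ∈ N, f.symm x ∈ N := by
  intro x hx
  have hinj : Function.Injective (f.toLinearMap.restrict h) := fun a b hab =>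
    Subtype.ext (f.injective (congrArg Subtype.val hab))
  obtain ⟨y, hy⟩ := LinearMap.injective_iff_surjective.1 hinj ⟨x, hx⟩
  have : f y = x := congrArg Subtype.val hy
  rw [← this, LinearEquiv.symm_apply_apply]
  exact y.2

theorem matrixCoeff_eq (g : (ℂ ⊗[ℚ] W) ≃ₗ[ℂ] (ℂ ⊗[ℚ] W)) (φ : Module.Dual ℚ W) (w : W) :
    matrixCoeff g (φ, w) = Module.Dual.baseChange ℂ φ (g (1 ⊗ₜ[ℚ] w)) := rfl

/-- The centralizer of a rational operator. -/
def centralizerSubgroup (A : Module.End ℚ W) : Subgroup ((ℂ ⊗[ℚ] W) ≃ₗ[ℂ] (ℂ ⊗[ℚ] W)) where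
  carrier := {g | ∀ x, g (A.baseChange ℂ x) = A.baseChange ℂ (g x)}
  one_mem' := fun _ => rfl
  mul_mem' := by
    intro g h hg hh x
    rw [LinearEquiv.mul_apply, LinearEquiv.mul_apply, hh, hg]
  inv_mem' := by
    intro g hg x
    apply g.injective
    rw [hg]
    change g (g.symm _) = A.baseChange ℂ (g (g.symm x))
    rw [LinearEquiv.apply_symm_apply, LinearEquiv.apply_symm_apply]

theorem commutes_of_mem_centralizerSubgroup {A : Module.End ℚ W}
    {g : (ℂ ⊗[ℚ] W) ≃ₗ[ℂ] (ℂ ⊗[ℚ] W)} (hg : g ∈ centralizerSubgroup A) (x : ℂ ⊗[ℚ] W) :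
    g (A.baseChange ℂ x) = A.baseChange ℂ (g x) := hg x

theorem mem_centralizerSubgroup_iff {A : Module.End ℚ W}
    {g : (ℂ ⊗[ℚ] W) ≃ₗ[ℂ] (ℂ ⊗[ℚ] W)} :
    g ∈ centralizerSubgroup A ↔ ∀ φ w, matrixCoeff g (φ, A w) = matrixCoeff g (φ ∘ₗ A, w) := by
  have key : ∀ (φ : Module.Dual ℚ W) (x : ℂ ⊗[ℚ] W), Module.Dual.baseChange ℂ (φ ∘ₗ A) x =
      Module.Dual.baseChange ℂ φ (A.baseChange ℂ x) := by
    intro φ x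
    induction x with
    | zero => simp
    | add a b ha hb => rw [map_add, map_add, map_add, ha, hb]
    | tmul z w => simp
  constructor
  · intro h φ w
    rw [matrixCoeff_eq, matrixCoeff_eq, key, ← h, LinearMap.baseChange_tmul]
  · intro h x
    induction x with
    | zero => simp
    | add a b ha hb => rw [map_add, map_add, map_add, map_add, ha, hb]
    | tmul z w =>
      have : z ⊗ₜ[ℚ] w = z • (1 ⊗ₜ[ℚ] w) := by simp [TensorProduct.smul_tmul']
      rw [this, map_smul, map_smul, map_smul, map_smul]
      congr 1
      refine eq_of_forall_dual fun φ => ?_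
      rw [LinearMap.baseChange_tmul, ← matrixCoeff_eq, h, matrixCoeff_eq, key]

theorem isAlgebraicQSubgroup_centralizer (A : Module.End ℚ W) :
    IsAlgebraicQSubgroup (centralizerSubgroup A) := by
  refine ⟨Set.range fun x : Module.Dual ℚ W × W =>
    MvPolynomial.X (x.1, A x.2) - MvPolynomial.X (x.1 ∘ₗ A, x.2), fun g => ?_⟩
  rw [mem_centralizerSubgroup_iff]
  simp only [Set.forall_mem_range, Prod.forall, map_sub, MvPolynomial.aeval_X, sub_eq_zero]

variable [FiniteDimensional ℚ W]

/-- The stabilizer of a rational subspace. -/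
def stabilizerSubgroup (U : Submodule ℚ W) : Subgroup ((ℂ ⊗[ℚ] W) ≃ₗ[ℂ] (ℂ ⊗[ℚ] W)) where
  carrier := {g | ∀ x ∈ U.baseChange ℂ, g x ∈ U.baseChange ℂ}
  one_mem' := fun _ hx => hx
  mul_mem' := fun hg hh _ hx => hg _ (hh _ hx)
  inv_mem' := fun {g} hg x hx => exists_subgroup_of_stabilizer _ g hg x hx

theorem apply_mem_of_mem_stabilizerSubgroup {U : Submodule ℚ W}
    {g : (ℂ ⊗[ℚ] W) ≃ₗ[ℂ] (ℂ ⊗[ℚ] W)} (hg : g ∈ stabilizerSubgroup U) {x : ℂ ⊗[ℚ] W}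
    (hx : x ∈ U.baseChange ℂ) : g x ∈ U.baseChange ℂ := hg x hx

theorem isAlgebraicQSubgroup_stabilizer (U : Submodule ℚ W) :
    IsAlgebraicQSubgroup (stabilizerSubgroup U) := by
  refine ⟨{p | ∃ φ : Module.Dual ℚ W, (∀ u ∈ U, φ u = 0) ∧ ∃ u ∈ U, p = MvPolynomial.X (φ, u)},
    fun g => ?_⟩
  constructor
  · rintro hg _ ⟨φ, hφ, u, hu, rfl⟩
    rw [MvPolynomial.aeval_X, matrixCoeff_eq]
    exact dual_baseChange_eq_zero hφ (hg _ (Submodule.tmul_mem_baseChange_of_mem 1 hu))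
  · intro h x hx
    rw [Submodule.baseChange_eq_span] at hx
    induction hx using Submodule.span_induction with
    | mem x hx =>
      obtain ⟨u, hu, rfl⟩ := hx
      refine mem_baseChange_of_forall_dual U fun φ hφ => ?_
      have := h _ ⟨φ, hφ, u, hu, rfl⟩
      rwa [MvPolynomial.aeval_X, matrixCoeff_eq] at this
    | zero => simp
    | add x y _ _ hx hy => rw [map_add]; exact Submodule.add_mem _ hx hy
    | smul a x _ hx => rw [map_smul]; exact Submodule.smul_mem _ a hx

/-- The stabilizer of a complex subspace of the space of alternating forms. -/
def formStabilizer (N : Submodule ℂ ((ℂ ⊗[ℚ] W) [⋀^Fin 2]→ₗ[ℂ] ℂ)) :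
    Subgroup ((ℂ ⊗[ℚ] W) ≃ₗ[ℂ] (ℂ ⊗[ℚ] W)) where
  carrier := {g | ∀ ω ∈ N, ω.compLinearMap g.toLinearMap ∈ N}
  one_mem' := fun ω hω => by
    have : ω.compLinearMap (1 : (ℂ ⊗[ℚ] W) ≃ₗ[ℂ] (ℂ ⊗[ℚ] W)).toLinearMap = ω := by
      ext; rfl
    rwa [this]
  mul_mem' := fun {g h} hg hh ω hω => hh _ (hg _ hω)
  inv_mem' := fun {g} hg ω hω => by
    have := finite_alternatingMap_two ℂ (ℂ ⊗[ℚ] W)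
    let f : ((ℂ ⊗[ℚ] W) [⋀^Fin 2]→ₗ[ℂ] ℂ) ≃ₗ[ℂ] ((ℂ ⊗[ℚ] W) [⋀^Fin 2]→ₗ[ℂ] ℂ) :=
      { toFun := fun ω => ω.compLinearMap g.toLinearMap
        invFun := fun ω => ω.compLinearMap g.symm.toLinearMap
        left_inv := fun ω => alt_ext fun x y => by simp
        right_inv := fun ω => alt_ext fun x y => by simp
        map_add' := fun _ _ => rfl
        map_smul' := fun _ _ => rfl }
    exact exists_subgroup_of_stabilizer N f hg ω hω

theorem compLinearMap_mem_of_mem_formStabilizer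
    {N : Submodule ℂ ((ℂ ⊗[ℚ] W) [⋀^Fin 2]→ₗ[ℂ] ℂ)} {g : (ℂ ⊗[ℚ] W) ≃ₗ[ℂ] (ℂ ⊗[ℚ] W)}
    (hg : g ∈ formStabilizer N) {ω : (ℂ ⊗[ℚ] W) [⋀^Fin 2]→ₗ[ℂ] ℂ} (hω : ω ∈ N) :
    ω.compLinearMap g.toLinearMap ∈ N :=
  hg ω hω

theorem mem_formStabilizer_iff
    {N : Submodule ℂ ((ℂ ⊗[ℚ] W) [⋀^Fin 2]→ₗ[ℂ] ℂ)} {g : (ℂ ⊗[ℚ] W) ≃ₗ[ℂ] (ℂ ⊗[ℚ] W)} :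
    g ∈ formStabilizer N ↔ ∀ ω ∈ N, ω.compLinearMap g.toLinearMap ∈ N :=
  Iff.rfl

/-- In coordinates, the span of a space of rational forms is cut out by linear equations with
rational coefficients. The coordinates of the pullback of a rational form by `g` are rational
quadratic polynomials in the matrix coefficients of `g`, so the stability condition is polynomial
over `ℚ`. -/
theorem isAlgebraicQSubgroup_formStabilizer
    (H : Submodule ℚ ((ℂ ⊗[ℚ] W) [⋀^Fin 2]→ₗ[ℂ] ℂ))
    (hH : ∀ ω ∈ H, ∀ v w : W, ∃ q : ℚ, ω ![1 ⊗ₜ v, 1 ⊗ₜ w] = q) :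
    IsAlgebraicQSubgroup (formStabilizer (Submodule.span ℂ
      (H : Set ((ℂ ⊗[ℚ] W) [⋀^Fin 2]→ₗ[ℂ] ℂ)))) := by
  let κ := Fin (Module.finrank ℚ W)
  let b : Module.Basis κ ℚ W := Module.finBasis ℚ W
  let bC := b.baseChange ℂ
  have hbC : ∀ i, bC i = 1 ⊗ₜ b i := fun i => by simp [bC]
  let ev : ((ℂ ⊗[ℚ] W) [⋀^Fin 2]→ₗ[ℂ] ℂ) →ₗ[ℂ] (κ × κ → ℂ) :=
    { toFun := fun ω k => ω ![1 ⊗ₜ b k.1, 1 ⊗ₜ b k.2]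
      map_add' := fun _ _ => rfl
      map_smul' := fun _ _ => rfl }
  have hev : Function.Injective ev := fun ω η h => alt_ext_basis bC fun i j => by
    rw [hbC, hbC]; exact congrFun h (i, j)
  let U : Submodule ℚ (κ × κ → ℚ) :=
    { carrier := {u | ∃ ω ∈ H, ∀ k, ev ω k = u k}
      zero_mem' := ⟨0, H.zero_mem, by simp⟩
      add_mem' := by
        rintro u u' ⟨ω, hω, h⟩ ⟨η, hη, h'⟩
        exact ⟨ω + η, H.add_mem hω hη, fun k => by simp [h, h']⟩
      smul_mem' := by
        rintro c u ⟨ω, hω, h⟩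
        refine ⟨c • ω, H.smul_mem c hω, fun k => ?_⟩
        have : ev (c • ω) k = c • ev ω k := rfl
        rw [this, h]
        simp [Rat.smul_def] }
  -- The complex span of `H` is the common kernel of the rational functionals that annihilate the
  -- coordinate space `U` of `H`.
  have hU : ∀ ω, ω ∈ Submodule.span ℂ (H : Set ((ℂ ⊗[ℚ] W) [⋀^Fin 2]→ₗ[ℂ] ℂ)) ↔
      ∀ c : κ × κ → ℚ, (∀ u ∈ U, ∑ k, c k * u k = 0) → ∑ k, (c k : ℂ) * ev ω k = 0 := by
    intro ω
    constructor
    · intro hω c hc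
      induction hω using Submodule.span_induction with
      | mem ω hω =>
        choose q hq using fun k : κ × κ => hH ω hω (b k.1) (b k.2)
        have := hc q ⟨ω, hω, hq⟩
        have h2 : ∀ k, ev ω k = q k := hq
        simp only [h2]
        exact_mod_cast this
      | zero => simp
      | add x y _ _ hx hy => simp [mul_add, Finset.sum_add_distrib, hx, hy]
      | smul a x _ hx =>
        simp only [map_smul, Pi.smul_apply, smul_eq_mul, mul_left_comm _ a, ← Finset.mul_sum, hx,
          mul_zero]
    · intro h
      have h1 := mem_span_of_forall_rat U h
      have h2 : ev ω ∈ (Submodule.span ℂ (H : Set ((ℂ ⊗[ℚ] W) [⋀^Fin 2]→ₗ[ℂ] ℂ))).map ev := by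
        rw [Submodule.map_span]
        refine Submodule.span_mono ?_ h1
        rintro _ ⟨u, ⟨η, hη, hu⟩, rfl⟩
        exact ⟨η, hη, funext hu⟩
      obtain ⟨η, hη, h3⟩ := h2
      rwa [← hev h3]
  -- The value of the functional `c` on the pullback of the form with Gram matrix `q`, as a
  -- polynomial in the matrix coefficients.
  let P : (κ → κ → ℚ) → (κ × κ → ℚ) → MvPolynomial (Module.Dual ℚ W × W) ℚ := fun q c =>
    ∑ k, MvPolynomial.C (c k) * ∑ i, ∑ j, MvPolynomial.X (b.coord i, b k.1) *
      MvPolynomial.X (b.coord j, b k.2) * MvPolynomial.C (q i j)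
  have hP : ∀ (ω : (ℂ ⊗[ℚ] W) [⋀^Fin 2]→ₗ[ℂ] ℂ) (q : κ → κ → ℚ) (c : κ × κ → ℚ)
      (g : (ℂ ⊗[ℚ] W) ≃ₗ[ℂ] (ℂ ⊗[ℚ] W)), (∀ i j, ω ![1 ⊗ₜ b i, 1 ⊗ₜ b j] = q i j) →
      MvPolynomial.aeval (matrixCoeff g) (P q c) =
        ∑ k, (c k : ℂ) * ev (ω.compLinearMap g.toLinearMap) k := by
    intro ω q c g hq
    have hcoord : ∀ x i, bC.repr x i = Module.Dual.baseChange ℂ (b.coord i) x := by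
      intro x i
      induction x with
      | zero => simp
      | add a b ha hb => rw [map_add, map_add, Finsupp.add_apply, ha, hb]
      | tmul z w => simp [bC, Rat.smul_def, mul_comm]
    simp only [P, map_sum, map_mul, MvPolynomial.aeval_C, MvPolynomial.aeval_X]
    refine Finset.sum_congr rfl fun k _ => ?_
    congr 1
    change _ = ω.compLinearMap g.toLinearMap ![_, _]
    rw [alt_compLinearMap, alt_expand bC]
    simp only [hcoord, hbC, hq, matrixCoeff_eq]
    rfl
  refine ⟨{p | ∃ ω ∈ H, ∃ q : κ → κ → ℚ, (∀ i j, ω ![1 ⊗ₜ b i, 1 ⊗ₜ b j] = q i j) ∧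
    ∃ c : κ × κ → ℚ, (∀ u ∈ U, ∑ k, c k * u k = 0) ∧ p = P q c}, fun g => ?_⟩
  constructor
  · rintro hg _ ⟨ω, hω, q, hq, c, hc, rfl⟩
    rw [hP ω q c g hq]
    exact (hU _).1 (hg ω (Submodule.subset_span hω)) c hc
  · intro h ω hω
    induction hω using Submodule.span_induction with
    | mem ω hω =>
      choose q hq using fun i j => hH ω hω (b i) (b j)
      refine (hU _).2 fun c hc => ?_
      rw [← hP ω q c g hq]
      exact h _ ⟨ω, hω, q, hq, c, hc, rfl⟩
    | zero => exact Submodule.zero_mem _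
    | add x y _ _ hx hy => exact Submodule.add_mem _ hx hy
    | smul a x _ hx => exact Submodule.smul_mem _ a hx

end AlgebraicExamples

/-! ## `Res_{E/ℚ} SL₂` is algebraic -/

section ResSLAlgebraic

variable {W : Type u} [AddCommGroup W] [Module ℚ W] {E : Type v} [Field E] [Algebra ℚ E]

theorem complexAction_one_tmul (ρ : E →ₐ[ℚ] Module.End ℚ W) (e : E) :
    complexAction ρ (1 ⊗ₜ e) = (ρ e).baseChange ℂ := by
  refine LinearMap.ext fun x => ?_
  induction x with
  | zero => simp
  | add a b ha hb => rw [map_add, map_add, ha, hb]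
  | tmul z w => simp

theorem commutes_complexAction_iff (ρ : E →ₐ[ℚ] Module.End ℚ W)
    (g : (ℂ ⊗[ℚ] W) →ₗ[ℂ] (ℂ ⊗[ℚ] W)) :
    (∀ r x, g (complexAction ρ r x) = complexAction ρ r (g x)) ↔
      ∀ e x, g ((ρ e).baseChange ℂ x) = (ρ e).baseChange ℂ (g x) := by
  constructor
  · intro h e x
    rw [← complexAction_one_tmul, h]
  · intro h r x
    induction r with
    | zero => simp
    | add a b ha hb => rw [map_add, LinearMap.add_apply, LinearMap.add_apply, map_add, ha, hb]
    | tmul z e =>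
      have : z ⊗ₜ[ℚ] e = z • (1 ⊗ₜ[ℚ] e) := by simp [TensorProduct.smul_tmul']
      rw [this, map_smul, LinearMap.smul_apply, LinearMap.smul_apply, map_smul,
        complexAction_one_tmul, h]

variable (ρ : E →ₐ[ℚ] Module.End ℚ W) {ι : Type*} [Fintype ι] (ε : Module.Basis ι ℚ E)
  (b : Fin 2 → W) (β : Module.Basis (Σ _ : Fin 2, ι) ℚ W)

omit [Fintype ι] in
theorem baseChange_repr_eq {κ : Type*} (γ : Module.Basis κ ℚ W) (x : ℂ ⊗[ℚ] W) (i : κ) :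
    (γ.baseChange ℂ).repr x i = Module.Dual.baseChange ℂ (γ.coord i) x := by
  induction x with
  | zero => simp
  | add a b ha hb => rw [map_add, map_add, Finsupp.add_apply, ha, hb]
  | tmul z w => simp [Rat.smul_def, mul_comm]

/-- The matrix over `ℂ ⊗ E` of an operator on `W_ℂ`. -/
def frameMatrix (g : (ℂ ⊗[ℚ] W) ≃ₗ[ℂ] (ℂ ⊗[ℚ] W)) : Matrix (Fin 2) (Fin 2) (ℂ ⊗[ℚ] E) :=
  Matrix.of fun j k => ∑ i, matrixCoeff g (β.coord ⟨j, i⟩, b k) • (1 ⊗ₜ[ℚ] ε i)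

variable (hβ : ∀ j i, β ⟨j, i⟩ = ρ (ε i) (b j))

include hβ

/-- `frameMatrix` only records the images of the two frame vectors. These determine `g` exactly when
`g` is `ℂ ⊗ E`-linear. -/
theorem ofMatrix_frameMatrix_iff (g : (ℂ ⊗[ℚ] W) ≃ₗ[ℂ] (ℂ ⊗[ℚ] W)) :
    (∀ r x, g (complexAction ρ r x) = complexAction ρ r (g x)) ↔
      (ComplexFrame.ofBasis ρ ε b β hβ).ofMatrix (frameMatrix ε b β g) = g.toLinearMap := by
  set θ := ComplexFrame.ofBasis ρ ε b β hβ with hθ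
  constructor
  · intro h
    have hk : ∀ k, θ.ofMatrix (frameMatrix ε b β g) (1 ⊗ₜ b k) = g (1 ⊗ₜ b k) := by
      intro k
      have h1 : (1 : ℂ) ⊗ₜ[ℚ] b k = θ.toEquiv (Pi.single k 1) := by
        rw [hθ, ComplexFrame.ofBasis_apply, Finset.sum_eq_single k]
        · simp
        · intro j _ hj
          simp [hj]
        · simp
      rw [h1, ComplexFrame.ofMatrix_toEquiv, ← h1, Matrix.mulVec_single_one, hθ,
        ComplexFrame.ofBasis_apply, ← (β.baseChange ℂ).sum_repr (g (1 ⊗ₜ b k)),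
        Fintype.sum_sigma]
      refine Finset.sum_congr rfl fun j _ => ?_
      simp [frameMatrix, baseChange_repr_eq, hβ, matrixCoeff_eq]
    refine LinearMap.ext fun x => ?_
    obtain ⟨p, rfl⟩ := θ.toEquiv.surjective x
    rw [LinearEquiv.coe_coe, hθ, ComplexFrame.ofBasis_apply, ← hθ, map_sum, map_sum]
    refine Finset.sum_congr rfl fun k _ => ?_
    rw [h, ComplexFrame.ofMatrix_complexAction, hk]
  · intro h r x
    have h' : ∀ y, g y = θ.ofMatrix (frameMatrix ε b β g) y := fun y => by rw [h]; rfl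
    rw [h', h', ComplexFrame.ofMatrix_complexAction]

/-- The equations are of two kinds: linear ones for commutation with `E`, and, for each basis
element of `E`, a coordinate of the equation `det = 1` over `ℂ ⊗ E`. The structure constants of `E`
in the latter are rational. -/
theorem isAlgebraicQSubgroup_resSL : IsAlgebraicQSubgroup (resSL ρ) := by
  classical
  set θ := ComplexFrame.ofBasis ρ ε b β hβ with hθ
  let D : ι → MvPolynomial (Module.Dual ℚ W × W) ℚ := fun l =>
    (∑ i, ∑ i', MvPolynomial.C (ε.coord l (ε i * ε i')) *
      (MvPolynomial.X (β.coord ⟨0, i⟩, b 0) * MvPolynomial.X (β.coord ⟨1, i'⟩, b 1) -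
        MvPolynomial.X (β.coord ⟨0, i⟩, b 1) * MvPolynomial.X (β.coord ⟨1, i'⟩, b 0))) -
    MvPolynomial.C (ε.coord l 1)
  have hD : ∀ g, (frameMatrix ε b β g).det = 1 ↔
      ∀ l, MvPolynomial.aeval (matrixCoeff g) (D l) = 0 := by
    intro g
    have h1 : ∀ l, MvPolynomial.aeval (matrixCoeff g) (D l) =
        Module.Dual.baseChange ℂ (ε.coord l) ((frameMatrix ε b β g).det - 1) := by
      intro l
      simp only [D, map_sub, map_sum, map_mul, MvPolynomial.aeval_C, MvPolynomial.aeval_X,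
        Matrix.det_fin_two, frameMatrix, Matrix.of_apply, Finset.sum_mul_sum, smul_mul_smul_comm,
        Algebra.TensorProduct.tmul_mul_tmul, map_smul, Algebra.TensorProduct.one_def,
        Module.Dual.baseChange_apply_tmul, mul_one, ← Finset.sum_sub_distrib]
      congr 1
      · refine Finset.sum_congr rfl fun i _ => Finset.sum_congr rfl fun i' _ => ?_
        simp [Rat.smul_def]
        ring
      · simp [Rat.smul_def]
    constructor
    · intro h l
      rw [h1, h, sub_self, map_zero]
    · intro h
      rw [← sub_eq_zero]
      refine (ε.baseChange ℂ).repr.injective (Finsupp.ext fun l => ?_)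
      rw [baseChange_repr_eq, ← h1, h, map_zero, Finsupp.zero_apply]
  refine ⟨(Set.range fun x : E × Module.Dual ℚ W × W => MvPolynomial.X (x.2.1, ρ x.1 x.2.2) -
    MvPolynomial.X (x.2.1 ∘ₗ ρ x.1, x.2.2)) ∪ Set.range D, fun g => ?_⟩
  have hc : (∀ r x, g (complexAction ρ r x) = complexAction ρ r (g x)) ↔
      ∀ p ∈ Set.range fun x : E × Module.Dual ℚ W × W => (MvPolynomial.X (x.2.1, ρ x.1 x.2.2) -
        MvPolynomial.X (x.2.1 ∘ₗ ρ x.1, x.2.2) : MvPolynomial (Module.Dual ℚ W × W) ℚ),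
        MvPolynomial.aeval (matrixCoeff g) p = 0 := by
    rw [Set.forall_mem_range]
    simp only [Prod.forall, map_sub, MvPolynomial.aeval_X, sub_eq_zero]
    refine (commutes_complexAction_iff ρ g.toLinearMap).trans (forall_congr' fun e => ?_)
    exact mem_centralizerSubgroup_iff (A := ρ e) (g := g)
  rw [θ.mem_resSL_iff]
  simp only [Set.mem_union, or_imp, forall_and]
  rw [← hc, Set.forall_mem_range, ← hD]
  constructor
  · rintro ⟨A, hA, hAg⟩
    have h1 : ∀ r x, g (complexAction ρ r x) = complexAction ρ r (g x) := by
      intro r x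
      have h' : ∀ y, g y = θ.ofMatrix A y := fun y => by rw [hAg]; rfl
      rw [h', h', ComplexFrame.ofMatrix_complexAction]
    refine ⟨h1, ?_⟩
    rw [ofMatrix_frameMatrix_iff ρ ε b β hβ, ← hAg] at h1
    rw [θ.ofMatrix_injective h1, hA]
  · rintro ⟨h1, h2⟩
    exact ⟨_, h2, (ofMatrix_frameMatrix_iff ρ ε b β hβ g).1 h1⟩

end ResSLAlgebraic

/-! ## Specialization of generic elements -/

section Generic

variable {E : Type v} [Field E] [Algebra ℚ E] {ι : Type*} [Fintype ι] (ε : Module.Basis ι ℚ E)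

theorem map_jMat {R S : Type*} [CommRing R] [CommRing S] (f : R →+* S) (x r : R) (i j : Fin 2) :
    f (jMat x r i j) = jMat (f x) (f r) i j := by
  have h2 : f 2 = 2 := map_ofNat f 2
  rw [coe_jMat, coe_jMat]
  fin_cases i <;> fin_cases j <;> simp [h2]

theorem jMat_mul_self {R : Type*} [CommRing R] (x r : R) :
    (jMat x r : Matrix (Fin 2) (Fin 2) R) * jMat x r = -1 := by
  rw [coe_jMat, Matrix.mul_fin_two]
  ext i j
  fin_cases i <;> fin_cases j <;> simp <;> ring

/-- The element `∑ tᵢ ⊗ εᵢ` of `A ⊗ E`. -/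
def paramElt {A : Type*} [CommRing A] [Algebra ℚ A] (t : Option ι → A) : A ⊗[ℚ] E :=
  ∑ i, t (some i) ⊗ₜ[ℚ] ε i

/-- The matrix `jMat` over `A ⊗ E` with parameters in `A`. -/
def paramMat {A : Type*} [CommRing A] [Algebra ℚ A] (t : Option ι → A) :
    Matrix.SpecialLinearGroup (Fin 2) (A ⊗[ℚ] E) :=
  jMat (paramElt ε t) (t none ⊗ₜ 1)

/-- The family is compatible with change of the parameter ring. It can thus be computed once over
the polynomial ring and then specialized; the index `none` carries `r`, and the indices `some i`
carry the coordinates of `x`. -/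
theorem map_paramMat {A B : Type*} [CommRing A] [Algebra ℚ A] [CommRing B] [Algebra ℚ B]
    (h : A →ₐ[ℚ] B) (t : Option ι → A) (i j : Fin 2) :
    Algebra.TensorProduct.map h (AlgHom.id ℚ E) (paramMat ε t i j) = paramMat ε (h ∘ t) i j := by
  have := map_jMat (Algebra.TensorProduct.map h (AlgHom.id ℚ E) : A ⊗[ℚ] E →+* B ⊗[ℚ] E)
    (paramElt ε t) (t none ⊗ₜ 1) i j
  refine this.trans ?_
  simp [paramMat, paramElt]

omit [Fintype ι] in
theorem baseChange_repr_map {A B : Type*} [CommRing A] [Algebra ℚ A] [CommRing B] [Algebra ℚ B]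
    (h : A →ₐ[ℚ] B) (y : A ⊗[ℚ] E) (i : ι) :
    (ε.baseChange B).repr (Algebra.TensorProduct.map h (AlgHom.id ℚ E) y) i =
      h ((ε.baseChange A).repr y i) := by
  induction y with
  | zero => simp
  | add a b ha hb => simp only [map_add, Finsupp.add_apply, ha, hb]
  | tmul z w => simp

/-- The complex matrix of the operator on `(ℂ ⊗ E)²` with a given matrix over `ℂ ⊗ E`. -/
def complexMatrix [DecidableEq ι] (A : Matrix (Fin 2) (Fin 2) (ℂ ⊗[ℚ] E)) :
    Matrix (Σ _ : Fin 2, ι) (Σ _ : Fin 2, ι) ℂ :=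
  LinearMap.toMatrix (Pi.basis fun _ : Fin 2 => ε.baseChange ℂ)
    (Pi.basis fun _ : Fin 2 => ε.baseChange ℂ) ((Matrix.toLin' A).restrictScalars ℂ)

theorem complexMatrix_mul [DecidableEq ι] (A B : Matrix (Fin 2) (Fin 2) (ℂ ⊗[ℚ] E)) :
    complexMatrix ε (A * B) = complexMatrix ε A * complexMatrix ε B := by
  rw [complexMatrix, complexMatrix, complexMatrix, ← LinearMap.toMatrix_comp, Matrix.toLin'_mul]
  rfl

theorem complexMatrix_neg_one [DecidableEq ι] : complexMatrix ε (-1) = -1 := by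
  rw [complexMatrix, map_neg, Matrix.toLin'_one, ← LinearMap.toMatrix_one
    (Pi.basis fun _ : Fin 2 => ε.baseChange ℂ), ← map_neg]
  rfl

theorem complexMatrix_apply [DecidableEq ι] (A : Matrix (Fin 2) (Fin 2) (ℂ ⊗[ℚ] E))
    (l k : Σ _ : Fin 2, ι) :
    complexMatrix ε A l k = (ε.baseChange ℂ).repr (A l.1 k.1 * (1 ⊗ₜ ε k.2)) l.2 := by
  obtain ⟨j, i⟩ := k
  rw [complexMatrix, LinearMap.toMatrix_apply, Pi.basis_apply, Pi.basis_repr]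
  simp [Matrix.mulVec_single]

/-- The polynomials that are the entries of the complex matrix of `paramMat`. -/
def paramPoly (l k : Σ _ : Fin 2, ι) : MvPolynomial (Option ι) ℚ :=
  (ε.baseChange (MvPolynomial (Option ι) ℚ)).repr
    (paramMat ε (MvPolynomial.X : Option ι → MvPolynomial (Option ι) ℚ) l.1 k.1 * (1 ⊗ₜ ε k.2)) l.2

theorem complexMatrix_paramMat [DecidableEq ι] (t : Option ι → ℂ) (l k : Σ _ : Fin 2, ι) :
    complexMatrix ε (paramMat ε t) l k = MvPolynomial.aeval t (paramPoly ε l k) := by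
  have h1 : (MvPolynomial.aeval t : MvPolynomial (Option ι) ℚ →ₐ[ℚ] ℂ) ∘ MvPolynomial.X = t := by
    ext i
    simp
  rw [complexMatrix_apply, paramPoly, ← baseChange_repr_map,
    map_mul (Algebra.TensorProduct.map _ _), map_paramMat, h1, Algebra.TensorProduct.map_tmul,
    map_one, AlgHom.id_apply]

theorem exists_paramElt_eq (x : ℂ ⊗[ℚ] E) (r : ℂ) :
    ∃ t : Option ι → ℂ, paramMat ε t = jMat x (r ⊗ₜ 1) := by
  refine ⟨fun o => o.elim r fun i => (ε.baseChange ℂ).repr x i, ?_⟩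
  rw [paramMat]
  congr 1
  conv_rhs => rw [← (ε.baseChange ℂ).sum_repr x]
  simp [paramElt, TensorProduct.smul_tmul']

variable {W : Type u} [AddCommGroup W] [Module ℚ W] (ρ : E →ₐ[ℚ] Module.End ℚ W)
  (b : Fin 2 → W) (β : Module.Basis (Σ _ : Fin 2, ι) ℚ W)
  (hβ : ∀ j i, β ⟨j, i⟩ = ρ (ε i) (b j))

theorem ofMatrix_basis [DecidableEq ι] (A : Matrix (Fin 2) (Fin 2) (ℂ ⊗[ℚ] E))
    (k : Σ _ : Fin 2, ι) :
    (ComplexFrame.ofBasis ρ ε b β hβ).ofMatrix A (1 ⊗ₜ β k) =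
      ∑ l, complexMatrix ε A l k • (1 ⊗ₜ[ℚ] β l) := by
  have h1 : ∀ k, (1 : ℂ) ⊗ₜ[ℚ] β k = (ComplexFrame.ofBasis ρ ε b β hβ).toEquiv
      (Pi.basis (fun _ : Fin 2 => ε.baseChange ℂ) k) := by
    intro k
    change _ = (Pi.basis fun _ : Fin 2 => ε.baseChange ℂ).equiv (β.baseChange ℂ) (Equiv.refl _) _
    rw [Module.Basis.equiv_apply]
    simp
  simp only [h1]
  rw [ComplexFrame.ofMatrix_toEquiv, ← Matrix.toLin'_apply]
  simp only [← map_smul, ← map_sum]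
  congr 1
  rw [← (Pi.basis fun _ : Fin 2 => ε.baseChange ℂ).sum_repr (Matrix.toLin' A _)]
  refine Finset.sum_congr rfl fun l _ => ?_
  rw [complexMatrix, LinearMap.toMatrix_apply]
  rfl

/-- An algebraic `ℚ`-subgroup that contains a generic member of a polynomial family contains the
whole family. -/
theorem slHom_paramMat_mem {G : Subgroup ((ℂ ⊗[ℚ] W) ≃ₗ[ℂ] (ℂ ⊗[ℚ] W))}
    (hG : IsAlgebraicQSubgroup G) {t₀ : Option ι → ℂ} (ht₀ : AlgebraicIndependent ℚ t₀)
    (h₀ : (ComplexFrame.ofBasis ρ ε b β hβ).slHom (paramMat ε t₀) ∈ G) (t : Option ι → ℂ) :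
    (ComplexFrame.ofBasis ρ ε b β hβ).slHom (paramMat ε t) ∈ G := by
  classical
  set θ := ComplexFrame.ofBasis ρ ε b β hβ
  let q : Module.Dual ℚ W × W → MvPolynomial (Option ι) ℚ := fun x =>
    ∑ k, ∑ l, MvPolynomial.C (x.1 (β l) * β.repr x.2 k) * paramPoly ε l k
  have hq : ∀ t x, matrixCoeff (θ.slHom (paramMat ε t)) x = MvPolynomial.aeval t (q x) := by
    rintro t ⟨φ, w⟩
    rw [matrixCoeff_eq, θ.slHom_apply]
    conv_lhs => rw [← β.sum_repr w]
    have h2 : (1 : ℂ) ⊗ₜ[ℚ] (∑ k, β.repr w k • β k) =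
        ∑ k, (β.repr w k : ℂ) • ((1 : ℂ) ⊗ₜ[ℚ] β k) := by
      rw [TensorProduct.tmul_sum]
      refine Finset.sum_congr rfl fun k _ => ?_
      rw [TensorProduct.tmul_smul, ← algebraMap_smul ℂ, eq_ratCast]
    rw [h2, map_sum, map_sum]
    simp only [q, map_sum, map_smul, map_mul, MvPolynomial.aeval_C]
    refine Finset.sum_congr rfl fun k _ => ?_
    rw [ofMatrix_basis, map_sum, Finset.smul_sum]
    refine Finset.sum_congr rfl fun l _ => ?_
    rw [map_smul, complexMatrix_paramMat]
    simp [Rat.smul_def]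
    ring
  obtain ⟨S, hS⟩ := hG
  rw [hS] at h₀ ⊢
  intro p hp
  have h1 : ∀ t, MvPolynomial.aeval (matrixCoeff (θ.slHom (paramMat ε t))) p =
      MvPolynomial.aeval t (MvPolynomial.bind₁ q p) := by
    intro t
    rw [MvPolynomial.aeval_bind₁]
    congr 2
    ext x
    exact hq t x
  have h2 := h₀ p hp
  rw [h1] at h2 ⊢
  -- An equation of `G`, pulled back to the parameters, is a rational polynomial. It vanishes at an
  -- algebraically independent point, so it is zero.
  have h3 : MvPolynomial.bind₁ q p = 0 := ht₀ (h2.trans (map_zero _).symm)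
  rw [h3, map_zero]

end Generic

/-! ### A generic element generates the special linear group -/

section GenericNumberField

variable {E : Type v} [Field E] [NumberField E] {ι : Type*} [Fintype ι] (ε : Module.Basis ι ℚ E)
  {W : Type u} [AddCommGroup W] [Module ℚ W] (ρ : E →ₐ[ℚ] Module.End ℚ W)
  (b : Fin 2 → W) (β : Module.Basis (Σ _ : Fin 2, ι) ℚ W)
  (hβ : ∀ j i, β ⟨j, i⟩ = ρ (ε i) (b j))

theorem resSL_le_of_generic {G : Subgroup ((ℂ ⊗[ℚ] W) ≃ₗ[ℂ] (ℂ ⊗[ℚ] W))}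
    (hG : IsAlgebraicQSubgroup G) {t₀ : Option ι → ℂ} (ht₀ : AlgebraicIndependent ℚ t₀)
    (h₀ : (ComplexFrame.ofBasis ρ ε b β hβ).slHom (paramMat ε t₀) ∈ G) : resSL ρ ≤ G := by
  set θ := ComplexFrame.ofBasis ρ ε b β hβ
  have h1 : ∀ (x : ℂ ⊗[ℚ] E) (r : ℂ), jMat x (r ⊗ₜ 1) ∈ G.comap θ.slHom := by
    intro x r
    obtain ⟨t, ht⟩ := exists_paramElt_eq ε x r
    rw [← ht]
    exact slHom_paramMat_mem ε ρ b β hβ hG ht₀ h₀ t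
  -- The generation lemma needs the parameter `r` only at the values `0` and `1`.
  have h2 := eq_top_of_jMat_mem exists_isUnit_add_mul (G.comap θ.slHom)
    (fun x => by simpa using h1 x 0) fun x => h1 x 1
  rw [← θ.range_slHom]
  rintro _ ⟨A, rfl⟩
  have : A ∈ G.comap θ.slHom := h2 ▸ Subgroup.mem_top A
  exact this

end GenericNumberField

/-! ## Construction of complex tori -/

section TorusConstruction

/-- Letting `i` act by `J` makes `ℝ^κ` a complex vector space; `v` is the standard real basis
transported to complex coordinates. -/
theorem exists_complex_basis {κ : Type*} [Fintype κ] [DecidableEq κ] (J : Matrix κ κ ℝ)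
    (hJ : J * J = -1) :
    ∃ (n : ℕ) (v : Module.Basis κ ℝ (Fin n → ℂ)), ∀ k, Complex.I • v k = ∑ l, J l k • v l := by
  have hf : Matrix.toLin' J * Matrix.toLin' J = -1 := by
    rw [Module.End.mul_eq_comp, ← Matrix.toLin'_mul, hJ, map_neg, Matrix.toLin'_one]; rfl
  let F : ℂ →ₐ[ℝ] Module.End ℝ (κ → ℝ) := Complex.lift ⟨Matrix.toLin' J, hf⟩
  let _ : Module ℂ (κ → ℝ) := Module.compHom _ F.toRingHom
  have hsmul : ∀ (z : ℂ) (x : κ → ℝ), z • x = F z x := fun _ _ => rfl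
  have : IsScalarTower ℝ ℂ (κ → ℝ) := ⟨fun r z x => by
    rw [hsmul, hsmul, map_smul, LinearMap.smul_apply]⟩
  have : FiniteDimensional ℂ (κ → ℝ) := Module.Finite.of_restrictScalars_finite ℝ ℂ _
  let e : (κ → ℝ) ≃ₗ[ℂ] (Fin (Module.finrank ℂ (κ → ℝ)) → ℂ) :=
    (Module.finBasis ℂ (κ → ℝ)).equivFun
  refine ⟨_, (Pi.basisFun ℝ κ).map (e.restrictScalars ℝ), fun k => ?_⟩
  have h1 : Complex.I • (Pi.single k 1 : κ → ℝ) = ∑ l, J l k • (Pi.single l 1 : κ → ℝ) := by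
    rw [hsmul]
    have : F Complex.I = Matrix.toLin' J := Complex.liftAux_apply_I _ hf
    rw [this, Matrix.toLin'_apply, Matrix.mulVec_single_one]
    conv_lhs => rw [pi_eq_sum_univ' (J.col k)]
    rfl
  have h2 := congrArg e h1
  rw [map_smul, map_sum] at h2
  simp only [Module.Basis.map_apply, Pi.basisFun_apply, LinearEquiv.restrictScalars_apply]
  rw [h2]
  exact Finset.sum_congr rfl fun l _ => (e.restrictScalars ℝ).map_smul _ _

theorem ComplexTorus.toVC_mulC (T : ComplexTorus.{u}) (z : ℂ) (x : T.H1C) :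
    T.toVC (T.mulC z x) =
      ((z • LinearMap.id : T.V →ₗ[ℂ] T.V).restrictScalars ℝ).baseChange ℂ (T.toVC x) :=
  T.equivVC.apply_symm_apply _

theorem exists_complexTorus {κ : Type*} [Fintype κ] [DecidableEq κ] (J : Matrix κ κ ℝ)
    (hJ : J * J = -1) :
    ∃ (T : ComplexTorus.{0}) (β : Module.Basis κ ℚ T.H1Q),
      ∀ k, T.mulC Complex.I (1 ⊗ₜ β k) = ∑ l, (J l k : ℂ) • (1 ⊗ₜ[ℚ] β l) := by
  obtain ⟨n, v, hv⟩ := exists_complex_basis J hJ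
  let T : ComplexTorus.{0} := { V := Fin n → ℂ, Λ := Submodule.span ℤ (Set.range v) }
  let b : Module.Basis κ ℤ T.Λ := v.restrictScalars ℤ
  have hb : ∀ k, (b k : T.V) = v k := fun k => v.restrictScalars_apply ℤ k
  refine ⟨T, b.baseChange ℚ, fun k => T.toVC_bijective.1 ?_⟩
  rw [T.toVC_mulC, map_sum]
  simp only [map_smul, Module.Basis.baseChange_apply, T.toVC_tmul, LinearMap.baseChange_tmul, hb]
  have h1 : (((Complex.I • LinearMap.id : T.V →ₗ[ℂ] T.V).restrictScalars ℝ) (v k) : T.V) =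
      ∑ l, J l k • v l := hv k
  rw [h1, TensorProduct.tmul_sum]
  refine Finset.sum_congr rfl fun l _ => ?_
  rw [TensorProduct.tmul_smul, ← algebraMap_smul ℂ]
  rfl

end TorusConstruction

/-! ## General facts on complex tori -/

namespace ComplexTorus

variable (T : ComplexTorus.{u})

instance : Module.Finite ℤ T.Λ := ZLattice.module_finite ℝ T.Λ

instance : Module.Free ℤ T.Λ := ZLattice.module_free ℝ T.Λ

theorem finrank_H1Q : Module.finrank ℚ T.H1Q = 2 * T.dim := by
  rw [Module.finrank_baseChange, ZLattice.rank ℝ T.Λ, dim, ← Complex.finrank_real_complex,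
    Module.finrank_mul_finrank]

/-- The action of `z` is real-linear in `z`. Thus everything stable under, or commuting with,
multiplication by `i` has the same property for every `z`. -/
theorem mulC_eq (z : ℂ) : T.mulC z = (z.re : ℂ) • 1 + (z.im : ℂ) • T.mulC Complex.I := by
  refine LinearMap.ext fun x => T.toVC_bijective.1 ?_
  have h : ∀ y : ℂ ⊗[ℝ] T.V, ((z • LinearMap.id : T.V →ₗ[ℂ] T.V).restrictScalars ℝ).baseChange ℂ y =
      (z.re : ℂ) • y + (z.im : ℂ) •
        ((Complex.I • LinearMap.id : T.V →ₗ[ℂ] T.V).restrictScalars ℝ).baseChange ℂ y := by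
    intro y
    induction y with
    | zero => simp
    | add a b ha hb => rw [map_add, ha, hb, map_add, smul_add, smul_add]; abel
    | tmul c v =>
      have hz : z • v = z.re • v + z.im • Complex.I • v := by
        conv_lhs => rw [← Complex.re_add_im z]
        rw [add_smul, mul_smul]; rfl
      simp only [LinearMap.baseChange_tmul, LinearMap.coe_restrictScalars, LinearMap.smul_apply,
        LinearMap.id_apply, hz, TensorProduct.tmul_add, TensorProduct.tmul_smul]
      rfl
  have h2 : T.toVC (((z.re : ℂ) • 1 + (z.im : ℂ) • T.mulC Complex.I : T.H1C →ₗ[ℂ] T.H1C) x) =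
      (z.re : ℂ) • T.toVC x + (z.im : ℂ) • T.toVC (T.mulC Complex.I x) := by
    rw [← map_smul, ← map_smul, ← map_add]
    rfl
  rw [h2, T.toVC_mulC, T.toVC_mulC, h]

theorem mulC_mul (z w : ℂ) : T.mulC (z * w) = T.mulC z * T.mulC w := by
  refine LinearMap.ext fun x => T.toVC_bijective.1 ?_
  rw [Module.End.mul_apply, T.toVC_mulC, T.toVC_mulC, T.toVC_mulC, ← LinearMap.comp_apply
    (LinearMap.baseChange ℂ _) (LinearMap.baseChange ℂ _), ← LinearMap.baseChange_comp]
  congr 2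
  ext v
  simp [mul_smul]

theorem mulC_one : T.mulC 1 = 1 := by
  rw [T.mulC_eq]; simp

theorem mulC_I_mul_self : T.mulC Complex.I * T.mulC Complex.I = -1 := by
  rw [← T.mulC_mul, Complex.I_mul_I, T.mulC_eq]
  simp only [Complex.neg_re, Complex.one_re, Complex.neg_im, Complex.one_im, neg_zero,
    Complex.ofReal_neg, Complex.ofReal_one, Complex.ofReal_zero, zero_smul, add_zero]
  exact LinearMap.ext fun x => neg_one_smul ℂ x

/-- Multiplication by a nonzero complex number as an automorphism of `H₁(T, ℂ)`. -/
def mulCEquiv {z : ℂ} (hz : z ≠ 0) : T.H1C ≃ₗ[ℂ] T.H1C :=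
  LinearEquiv.ofLinearMap (T.mulC z) (T.mulC z⁻¹)
    (by rw [← Module.End.mul_eq_comp, ← T.mulC_mul, mul_inv_cancel₀ hz, T.mulC_one]; rfl)
    (by rw [← Module.End.mul_eq_comp, ← T.mulC_mul, inv_mul_cancel₀ hz, T.mulC_one]; rfl)

theorem mulCEquiv_toLinearMap {z : ℂ} (hz : z ≠ 0) : (T.mulCEquiv hz).toLinearMap = T.mulC z := rfl

theorem isAlgebraic_hodgeGroup : IsAlgebraicQSubgroup T.hodgeGroup :=
  (isLeast_algebraicQClosure _).1.1

theorem mem_hodgeGroup {z : ℂ} (hz : ‖z‖ = 1) {g : T.H1C ≃ₗ[ℂ] T.H1C}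
    (hg : g.toLinearMap = T.mulC z) : g ∈ T.hodgeGroup :=
  (isLeast_algebraicQClosure _).1.2 ⟨z, hz, hg⟩

theorem hodgeGroup_le {G : Subgroup (T.H1C ≃ₗ[ℂ] T.H1C)} (hG : IsAlgebraicQSubgroup G)
    (h : ∀ (z : ℂ) (g : T.H1C ≃ₗ[ℂ] T.H1C), ‖z‖ = 1 → g.toLinearMap = T.mulC z → g ∈ G) :
    T.hodgeGroup ≤ G :=
  (isLeast_algebraicQClosure _).2 ⟨hG, fun g ⟨z, hz, hg⟩ => h z g hz hg⟩

end ComplexTorus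

/-! ## The endomorphism algebra -/

namespace ComplexTorus

variable (T : ComplexTorus.{u})

theorem rationalRep_tmul (q : ℚ) (f : T.EndRing) :
    T.rationalRep (q ⊗ₜ f) = q • (T.latticeRep f).baseChange ℚ := by
  have : T.rationalRep (q ⊗ₜ f) =
      algebraMap ℚ (Module.End ℚ T.H1Q) q * (T.latticeRep f).baseChange ℚ :=
    Algebra.TensorProduct.lift_tmul _ _ _ _ _
  rw [this, ← Algebra.smul_def]

theorem exists_nsmul_eq_one_tmul {M : Type*} [AddCommGroup M] (x : ℚ ⊗[ℤ] M) :
    ∃ n : ℕ, n ≠ 0 ∧ ∃ m : M, n • x = 1 ⊗ₜ[ℤ] m := by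
  induction x with
  | zero => exact ⟨1, one_ne_zero, 0, by simp⟩
  | tmul q m =>
    refine ⟨q.den, q.den_ne_zero, q.num • m, ?_⟩
    rw [← TensorProduct.smul_tmul, TensorProduct.smul_tmul']
    congr 1
    simp [nsmul_eq_mul, mul_comm, Rat.mul_den_eq_num]
  | add x y hx hy =>
    obtain ⟨n, hn, m, h⟩ := hx
    obtain ⟨n', hn', m', h'⟩ := hy
    refine ⟨n * n', mul_ne_zero hn hn', n' • m + n • m', ?_⟩
    rw [smul_add, mul_comm, mul_smul, h, mul_comm, mul_smul, h', TensorProduct.tmul_add,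
      TensorProduct.tmul_smul, TensorProduct.tmul_smul]

theorem one_tmul_injective : Function.Injective fun x : T.Λ => (1 : ℚ) ⊗ₜ[ℤ] x := by
  intro x y h
  let b := Module.Free.chooseBasis ℤ T.Λ
  refine b.repr.injective (Finsupp.ext fun i => ?_)
  have := congrArg (fun z => (b.baseChange ℚ).repr z i) h
  simpa using this

theorem latticeRep_apply (f : T.EndRing) (x : T.Λ) : (T.latticeRep f x : T.V) = T.lift f x := rfl

theorem linearMap_ext_lattice {M : Type*} [AddCommGroup M] [Module ℝ M] {f g : T.V →ₗ[ℝ] M}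
    (h : ∀ x : T.Λ, f x = g x) : f = g := by
  refine LinearMap.ext_on (s := (T.Λ : Set T.V)) ?_ fun x hx => h ⟨x, hx⟩
  exact IsZLattice.span_top

theorem latticeRep_injective : Function.Injective T.latticeRep := by
  intro f g h
  have h1 : (T.lift f).restrictScalars ℝ = (T.lift g).restrictScalars ℝ :=
    T.linearMap_ext_lattice fun x => by
      change T.lift f x = T.lift g x
      rw [← latticeRep_apply, h, latticeRep_apply]
  refine Subtype.ext (AddMonoidHom.ext fun x => ?_)
  obtain ⟨v, rfl⟩ := Submodule.Quotient.mk_surjective T.Λ x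
  have h2 : T.lift f v = T.lift g v := LinearMap.congr_fun h1 v
  exact (T.mk_lift f v).symm.trans (h2 ▸ T.mk_lift g v)

/-- After denominators are cleared, this is the faithfulness of `End(T)` on `Λ`, which holds because
`Λ` spans `V` over `ℝ`. -/
theorem rationalRep_injective : Function.Injective T.rationalRep := by
  rw [injective_iff_map_eq_zero]
  intro x hx
  obtain ⟨n, hn, f, hf⟩ := exists_nsmul_eq_one_tmul x
  have h1 : T.rationalRep (1 ⊗ₜ f) = 0 := by rw [← hf, map_nsmul, hx, smul_zero]
  have h2 : T.latticeRep f = T.latticeRep 0 := by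
    refine LinearMap.ext fun y => T.one_tmul_injective ?_
    rw [rationalRep_tmul, one_smul] at h1
    have := LinearMap.congr_fun h1 (1 ⊗ₜ y)
    simpa using this
  rw [T.latticeRep_injective h2, TensorProduct.tmul_zero, ← Nat.cast_smul_eq_nsmul ℚ] at hf
  rw [← inv_smul_smul₀ (Nat.cast_ne_zero.2 hn : (n : ℚ) ≠ 0) x, hf, smul_zero]

/-- The `ℂ`-linear extension of an endomorphism of the lattice corresponds to the extension of the
`ℝ`-linear extension. -/
theorem toVC_baseChange {A : Module.End ℤ T.Λ} {B : T.V →ₗ[ℝ] T.V}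
    (h : ∀ x : T.Λ, B x = A x) (x : T.H1C) :
    T.toVC ((A.baseChange ℚ).baseChange ℂ x) = B.baseChange ℂ (T.toVC x) := by
  induction x using TensorProduct.induction_on with
  | zero => simp
  | add a b ha hb => simp only [map_add, ha, hb]
  | tmul z y =>
    induction y using TensorProduct.induction_on with
    | zero => simp
    | add a b ha hb => simp only [TensorProduct.tmul_add, map_add, ha, hb]
    | tmul q y =>
      rw [LinearMap.baseChange_tmul, LinearMap.baseChange_tmul, toVC_tmul, toVC_tmul,
        LinearMap.baseChange_tmul, h]

theorem rationalRep_commutes (x : T.EndAlg) (z : ℂ) (y : T.H1C) :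
    (T.rationalRep x).baseChange ℂ (T.mulC z y) = T.mulC z ((T.rationalRep x).baseChange ℂ y) := by
  induction x using TensorProduct.induction_on with
  | zero => simp
  | add a b ha hb => simp only [map_add, LinearMap.baseChange_add, LinearMap.add_apply, ha, hb]
  | tmul q f =>
    rw [rationalRep_tmul, LinearMap.baseChange_smul, LinearMap.smul_apply, LinearMap.smul_apply]
    have hq : ∀ w : T.H1C, q • w = (q : ℂ) • w := fun w => by
      rw [← algebraMap_smul ℂ, eq_ratCast]
    rw [hq, hq, map_smul]
    congr 1
    refine T.toVC_bijective.1 ?_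
    rw [T.toVC_mulC, T.toVC_baseChange (B := (T.lift f).restrictScalars ℝ) fun x => rfl,
      T.toVC_baseChange (B := (T.lift f).restrictScalars ℝ) fun x => rfl, T.toVC_mulC,
      ← LinearMap.comp_apply (LinearMap.baseChange ℂ _) (LinearMap.baseChange ℂ _),
      ← LinearMap.comp_apply (LinearMap.baseChange ℂ _) (LinearMap.baseChange ℂ _),
      ← LinearMap.baseChange_comp, ← LinearMap.baseChange_comp]
    congr 2
    ext v
    simp

theorem exists_nsmul_eq_baseChange (A : Module.End ℚ T.H1Q) :
    ∃ n : ℕ, n ≠ 0 ∧ ∃ A₀ : Module.End ℤ T.Λ, n • A = A₀.baseChange ℚ := by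
  classical
  let b := Module.Free.chooseBasis ℤ T.Λ
  choose n hn m hm using fun i => exists_nsmul_eq_one_tmul (A (1 ⊗ₜ b i))
  refine ⟨∏ i, n i, Finset.prod_ne_zero_iff.2 fun i _ => hn i,
    b.constr ℤ fun i => (∏ j ∈ Finset.univ.erase i, n j) • m i, ?_⟩
  refine (b.baseChange ℚ).ext fun i => ?_
  rw [Module.Basis.baseChange_apply, LinearMap.baseChange_tmul, Module.Basis.constr_basis,
    TensorProduct.tmul_smul, ← hm, ← mul_smul, Finset.prod_erase_mul _ _ (Finset.mem_univ i)]
  rfl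

/-- A multiple `n • A` preserves `Λ` and extends to a real-linear map `B` of `V`. The hypothesis
makes `B` complex-linear, so `B` induces an endomorphism of the torus, which is then divided by `n`.
-/
theorem exists_rationalRep_eq (A : Module.End ℚ T.H1Q)
    (hA : ∀ y, A.baseChange ℂ (T.mulC Complex.I y) = T.mulC Complex.I (A.baseChange ℂ y)) :
    ∃ x, T.rationalRep x = A := by
  obtain ⟨n, hn, A₀, hA₀⟩ := T.exists_nsmul_eq_baseChange A
  let b := Module.Free.chooseBasis ℤ T.Λ
  let bV := b.ofZLatticeBasis ℝ T.Λ
  let B : T.V →ₗ[ℝ] T.V := bV.constr ℝ fun i => (A₀ (b i) : T.V)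
  have hB : ∀ x : T.Λ, B x = A₀ x := by
    have : (B.restrictScalars ℤ) ∘ₗ T.Λ.subtype = T.Λ.subtype ∘ₗ A₀ := by
      refine b.ext fun i => ?_
      have h1 : (b i : T.V) = bV i := (b.ofZLatticeBasis_apply ℝ T.Λ i).symm
      simp only [LinearMap.comp_apply, Submodule.subtype_apply, LinearMap.coe_restrictScalars]
      rw [h1, Module.Basis.constr_basis]
    intro x
    exact LinearMap.congr_fun this x
  have hcomm : ∀ y, (A₀.baseChange ℚ).baseChange ℂ (T.mulC Complex.I y) =
      T.mulC Complex.I ((A₀.baseChange ℚ).baseChange ℂ y) := by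
    intro y
    have h1 : (A₀.baseChange ℚ).baseChange ℂ = n • A.baseChange ℂ := by
      rw [← hA₀]
      exact map_nsmul (Module.End.baseChangeHom ℚ ℂ T.H1Q) n A
    rw [h1, LinearMap.smul_apply, LinearMap.smul_apply, hA, map_nsmul]
  have hBI : ∀ v : T.V, B (Complex.I • v) = Complex.I • B v := by
    intro v
    obtain ⟨y, hy⟩ := T.toVC_bijective.2 (1 ⊗ₜ v)
    have h1 := congrArg T.toVC (hcomm y)
    rw [T.toVC_mulC, T.toVC_baseChange hB, T.toVC_baseChange hB, T.toVC_mulC, hy] at h1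
    have h2 : (1 : ℂ) ⊗ₜ[ℝ] (B (Complex.I • v)) = 1 ⊗ₜ (Complex.I • B v) := by simpa using h1
    -- The commutation is known only in `V ⊗_ℝ ℂ`; it descends to `V` because `V` embeds there.
    have h3 : Function.Injective fun v : T.V => (1 : ℂ) ⊗ₜ[ℝ] v := by
      intro x y h
      refine bV.repr.injective (Finsupp.ext fun i => ?_)
      have := congrArg (fun z => (bV.baseChange ℂ).repr z i) h
      simpa using this
    exact h3 h2
  let BC : T.V →ₗ[ℂ] T.V :=
    { B with
      map_smul' := fun z v => by
        have hz : ∀ w : T.V, z • w = z.re • w + z.im • Complex.I • w := by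
          intro w
          conv_lhs => rw [← Complex.re_add_im z]
          rw [add_smul, mul_smul]; rfl
        change B (z • v) = z • B v
        rw [hz, hz, map_add, map_smul, map_smul, hBI] }
  have hBΛ : T.Λ ≤ T.Λ.comap (B.restrictScalars ℤ) := fun x hx => by
    have : B x = A₀ ⟨x, hx⟩ := hB ⟨x, hx⟩
    rw [Submodule.mem_comap, LinearMap.coe_restrictScalars, this]
    exact (A₀ ⟨x, hx⟩).2
  let f₀ : T.Points →+ T.Points := (T.Λ.mapQ T.Λ (B.restrictScalars ℤ) hBΛ).toAddMonoidHom
  let f : T.EndRing := ⟨f₀, T.isHolomorphic_of_lift (f := f₀) BC fun x => rfl⟩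
  have hf : T.lift f = BC := T.lift_unique fun x => T.mk_lift f x
  have hfA : T.latticeRep f = A₀ := by
    refine LinearMap.ext fun x => Subtype.ext ?_
    rw [latticeRep_apply, hf]
    exact hB x
  refine ⟨(n : ℚ)⁻¹ ⊗ₜ f, ?_⟩
  rw [rationalRep_tmul, hfA, ← hA₀, ← Nat.cast_smul_eq_nsmul ℚ, inv_smul_smul₀]
  exact_mod_cast hn

/-- If the operators that commute with the complex structure are those of a field `E`, then `E` is
the endomorphism algebra. -/
theorem exists_algEquiv_endAlg {E : Type v} [Field E] [Algebra ℚ E]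
    (ρ : E →ₐ[ℚ] Module.End ℚ T.H1Q) (hinj : Function.Injective ρ)
    (hρ : ∀ A : Module.End ℚ T.H1Q, A ∈ ρ.range ↔
      ∀ y, A.baseChange ℂ (T.mulC Complex.I y) = T.mulC Complex.I (A.baseChange ℂ y)) :
    ∃ ι : E ≃ₐ[ℚ] T.EndAlg, T.rationalRep.comp (ι : E →ₐ[ℚ] T.EndAlg) = ρ := by
  have hr : ρ.range = T.rationalRep.range := by
    ext A
    rw [hρ]
    constructor
    · intro h
      exact T.exists_rationalRep_eq A h
    · rintro ⟨x, rfl⟩ y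
      exact T.rationalRep_commutes x _ y
  let e₁ := AlgEquiv.ofInjective ρ hinj
  let e₂ := AlgEquiv.ofInjective T.rationalRep T.rationalRep_injective
  let ι : E ≃ₐ[ℚ] T.EndAlg := e₁.trans ((Subalgebra.equivOfEq _ _ hr).trans e₂.symm)
  refine ⟨ι, AlgHom.ext fun e => ?_⟩
  have h1 : e₂ (ι e) = Subalgebra.equivOfEq _ _ hr (e₁ e) := e₂.apply_symm_apply _
  exact congrArg Subtype.val h1

end ComplexTorus

/-! ## Commutant and irreducibility for `Res_{E/ℚ} SL₂` -/

section Irreducibility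

theorem complex_one_tmul_injective (W : Type u) [AddCommGroup W] [Module ℚ W] :
    Function.Injective fun w : W => (1 : ℂ) ⊗ₜ[ℚ] w := by
  intro x y h
  let b := Module.Free.chooseBasis ℚ W
  refine b.repr.injective (Finsupp.ext fun i => ?_)
  have := congrArg (fun z => (b.baseChange ℂ).repr z i) h
  simpa [Rat.smul_def] using this

variable {E : Type v} [Field E] [Algebra ℚ E] {ι : Type*} [Fintype ι] (ε : Module.Basis ι ℚ E)
  {W : Type u} [AddCommGroup W] [Module ℚ W] (ρ : E →ₐ[ℚ] Module.End ℚ W)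
  (b : Fin 2 → W) (β : Module.Basis (Σ _ : Fin 2, ι) ℚ W)
  (hβ : ∀ j i, β ⟨j, i⟩ = ρ (ε i) (b j))

theorem ComplexFrame.slHom_toEquiv {ρ : E →ₐ[ℚ] Module.End ℚ W} (θ : ComplexFrame ρ)
    (A : Matrix.SpecialLinearGroup (Fin 2) (ℂ ⊗[ℚ] E)) (p : Fin 2 → ℂ ⊗[ℚ] E) :
    θ.slHom A (θ.toEquiv p) =
      θ.toEquiv ![A 0 0 * p 0 + A 0 1 * p 1, A 1 0 * p 0 + A 1 1 * p 1] := by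
  rw [slHom_apply, ofMatrix_toEquiv]
  congr 1
  ext i
  fin_cases i <;> simp [Matrix.mulVec, dotProduct, Fin.sum_univ_two]

theorem ComplexFrame.slHom_upperUnip {ρ : E →ₐ[ℚ] Module.End ℚ W} (θ : ComplexFrame ρ)
    (x p q : ℂ ⊗[ℚ] E) :
    θ.slHom (upperUnip x) (θ.toEquiv ![p, q]) = θ.toEquiv ![p + x * q, q] := by
  rw [slHom_toEquiv, coe_upperUnip]
  simp

theorem ComplexFrame.slHom_lowerUnip {ρ : E →ₐ[ℚ] Module.End ℚ W} (θ : ComplexFrame ρ)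
    (x p q : ℂ ⊗[ℚ] E) :
    θ.slHom (lowerUnip x) (θ.toEquiv ![p, q]) = θ.toEquiv ![p, x * p + q] := by
  rw [slHom_toEquiv, coe_lowerUnip]
  simp

theorem ComplexFrame.slHom_mem {ρ : E →ₐ[ℚ] Module.End ℚ W} (θ : ComplexFrame ρ)
    (A : Matrix.SpecialLinearGroup (Fin 2) (ℂ ⊗[ℚ] E)) : θ.slHom A ∈ resSL ρ := by
  rw [← θ.range_slHom]
  exact ⟨A, rfl⟩

theorem exists_ofBasis_toEquiv_eq (w : W) : ∃ e : Fin 2 → E, w = ρ (e 0) (b 0) + ρ (e 1) (b 1) ∧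
    (1 : ℂ) ⊗ₜ[ℚ] w =
      (ComplexFrame.ofBasis ρ ε b β hβ).toEquiv ![1 ⊗ₜ e 0, 1 ⊗ₜ e 1] := by
  have key : ∃ e : Fin 2 → E, w = ρ (e 0) (b 0) + ρ (e 1) (b 1) := by
    refine ⟨fun j => ∑ i, β.repr w ⟨j, i⟩ • ε i, ?_⟩
    conv_lhs => rw [← β.sum_repr w, Fintype.sum_sigma, Fin.sum_univ_two]
    simp [hβ]
  obtain ⟨e, he⟩ := key
  refine ⟨e, he, ?_⟩
  rw [ComplexFrame.ofBasis_apply, he, Fin.sum_univ_two, TensorProduct.tmul_add]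
  simp

-- Commutation with the upper unipotents determines the operator on the first summand from its value
-- at `(0, 1)`, and the lower unipotents carry this to the second summand; the outcome is
-- multiplication by one scalar. The scalar is a coordinate of the rational vector `A (b 1)`, so it
-- lies in `E` and not merely in `ℂ ⊗ E`.
include hβ in
theorem mem_range_of_resSL_le_centralizer {A : Module.End ℚ W}
    (hA : resSL ρ ≤ centralizerSubgroup A) : A ∈ ρ.range := by
  set θ := ComplexFrame.ofBasis ρ ε b β hβ with hθ
  let f : (Fin 2 → ℂ ⊗[ℚ] E) →ₗ[ℂ] (ℂ ⊗[ℚ] W) := A.baseChange ℂ ∘ₗ θ.toEquiv.toLinearMap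
  have hf : ∀ p, f p = A.baseChange ℂ (θ.toEquiv p) := fun _ => rfl
  have hcomm : ∀ (g : Matrix.SpecialLinearGroup (Fin 2) (ℂ ⊗[ℚ] E)) x,
      A.baseChange ℂ (θ.slHom g x) = θ.slHom g (A.baseChange ℂ x) := fun g x =>
    (commutes_of_mem_centralizerSubgroup (hA (θ.slHom_mem g)) x).symm
  obtain ⟨e, he, he'⟩ := exists_ofBasis_toEquiv_eq ε ρ b β hβ (A (b 1))
  rw [← hθ] at he'
  have hb1 : (1 : ℂ) ⊗ₜ[ℚ] b 1 = θ.toEquiv ![0, 1] := by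
    rw [hθ, ComplexFrame.ofBasis_apply, Fin.sum_univ_two]
    simp
  have h01 : f ![0, 1] = θ.toEquiv ![1 ⊗ₜ e 0, 1 ⊗ₜ e 1] := by
    rw [hf, ← hb1, LinearMap.baseChange_tmul, he']
  have hx0 : ∀ x, f ![x, 0] = θ.toEquiv ![x * 1 ⊗ₜ e 1, 0] := by
    intro x
    have h1 := hcomm (upperUnip x) (θ.toEquiv ![0, 1])
    rw [← hf ![0, 1], h01, θ.slHom_upperUnip, θ.slHom_upperUnip, ← hf] at h1
    have h2 : (![x, 0] : Fin 2 → ℂ ⊗[ℚ] E) = ![0 + x * 1, 1] - ![0, 1] := by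
      ext i; fin_cases i <;> simp
    rw [h2, map_sub, h1, h01, ← map_sub]
    congr 1
    ext i; fin_cases i <;> simp
  have h0x : ∀ x, f ![0, x] = θ.toEquiv ![0, x * 1 ⊗ₜ e 1] := by
    intro x
    have h1 := hcomm (lowerUnip x) (θ.toEquiv ![1, 0])
    rw [← hf ![1, 0], hx0, θ.slHom_lowerUnip, θ.slHom_lowerUnip, ← hf] at h1
    have h2 : (![0, x] : Fin 2 → ℂ ⊗[ℚ] E) = ![1, x * 1 + 0] - ![1, 0] := by
      ext i; fin_cases i <;> simp
    rw [h2, map_sub, h1, hx0, ← map_sub]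
    congr 1
    ext i; fin_cases i <;> simp
  have hall : ∀ p, f p = complexAction ρ (1 ⊗ₜ e 1) (θ.toEquiv p) := by
    intro p
    have h2 : p = ![p 0, 0] + ![0, p 1] := by
      ext i; fin_cases i <;> simp
    rw [← θ.map_act]
    conv_lhs => rw [h2, map_add, hx0, h0x, ← map_add]
    congr 1
    ext i; fin_cases i <;> simp [mul_comm]
  refine ⟨e 1, LinearMap.ext fun w => complex_one_tmul_injective W ?_⟩
  have := hall (θ.toEquiv.symm (1 ⊗ₜ w))
  rw [hf, LinearEquiv.apply_symm_apply] at this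
  simpa using this.symm

-- A nonzero coordinate of a rational vector lies in the field `E`, so it is invertible in `ℂ ⊗ E`.
-- Subtracting the vector from its images under unipotents then yields both summands of `(ℂ ⊗ E)²`.
-- A general complex vector could have zero divisors as coordinates.
include hβ in
theorem baseChange_eq_top_of_resSL_le_stabilizer [FiniteDimensional ℚ W] {U : Submodule ℚ W}
    (hU : resSL ρ ≤ stabilizerSubgroup U) (h0 : U ≠ ⊥) : U.baseChange ℂ = ⊤ := by
  set θ := ComplexFrame.ofBasis ρ ε b β hβ with hθ
  obtain ⟨w, hwU, hw0⟩ := Submodule.exists_mem_ne_zero_of_ne_bot h0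
  obtain ⟨e, he, he'⟩ := exists_ofBasis_toEquiv_eq ε ρ b β hβ w
  rw [← hθ] at he'
  obtain ⟨N, hN⟩ : ∃ N : Submodule ℂ (Fin 2 → ℂ ⊗[ℚ] E), ∀ p, p ∈ N ↔
      θ.toEquiv p ∈ U.baseChange ℂ :=
    ⟨(U.baseChange ℂ).comap θ.toEquiv.toLinearMap, fun _ => Iff.rfl⟩
  have hu : ∀ x p q, ![p, q] ∈ N → ![x * q, 0] ∈ N := by
    intro x p q h
    have h0 : θ.slHom (upperUnip x) (θ.toEquiv ![p, q]) ∈ U.baseChange ℂ :=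
      apply_mem_of_mem_stabilizerSubgroup (hU (θ.slHom_mem (upperUnip x))) ((hN _).1 h)
    have h1 : θ.toEquiv ![p + x * q, q] ∈ U.baseChange ℂ := θ.slHom_upperUnip x p q ▸ h0
    have h2 : (![x * q, 0] : Fin 2 → ℂ ⊗[ℚ] E) = ![p + x * q, q] - ![p, q] := by
      ext i; fin_cases i <;> simp
    have h3 := N.sub_mem ((hN _).2 h1) h
    exact (congrArg (fun y => y ∈ N) h2).mpr h3
  have hl : ∀ x p q, ![p, q] ∈ N → ![0, x * p] ∈ N := by
    intro x p q h
    have h0 : θ.slHom (lowerUnip x) (θ.toEquiv ![p, q]) ∈ U.baseChange ℂ :=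
      apply_mem_of_mem_stabilizerSubgroup (hU (θ.slHom_mem (lowerUnip x))) ((hN _).1 h)
    have h1 : θ.toEquiv ![p, x * p + q] ∈ U.baseChange ℂ := θ.slHom_lowerUnip x p q ▸ h0
    have h2 : (![0, x * p] : Fin 2 → ℂ ⊗[ℚ] E) = ![p, x * p + q] - ![p, q] := by
      ext i; fin_cases i <;> simp
    have h3 := N.sub_mem ((hN _).2 h1) h
    exact (congrArg (fun y => y ∈ N) h2).mpr h3
  have hmem : ![(1 : ℂ) ⊗ₜ[ℚ] e 0, 1 ⊗ₜ e 1] ∈ N := by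
    rw [hN, ← he']
    exact Submodule.tmul_mem_baseChange_of_mem 1 hwU
  have hinv : ∀ (y : ℂ ⊗[ℚ] E) (a : E), a ≠ 0 → y = (y * 1 ⊗ₜ a⁻¹) * 1 ⊗ₜ a := by
    intro y a ha
    rw [mul_assoc, Algebra.TensorProduct.tmul_mul_tmul, inv_mul_cancel₀ ha, one_mul,
      ← Algebra.TensorProduct.one_def, mul_one]
  have hboth : (∀ y, ![y, 0] ∈ N) ∧ ∀ y, ![0, y] ∈ N := by
    by_cases h1 : e 1 = 0
    · have h2 : e 0 ≠ 0 := by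
        intro h2
        apply hw0
        rw [he, h1, h2]
        simp
      have h3 : ∀ y, ![0, y] ∈ N := fun y => by
        rw [hinv y _ h2]
        exact hl _ _ _ hmem
      exact ⟨fun y => by simpa using hu 1 _ _ (h3 y), h3⟩
    · have h3 : ∀ y, ![y, 0] ∈ N := fun y => by
        rw [hinv y _ h1]
        exact hu _ _ _ hmem
      exact ⟨h3, fun y => by simpa using hl 1 _ _ (h3 y)⟩
  refine eq_top_iff.2 fun x _ => ?_
  rw [← θ.toEquiv.apply_symm_apply x, ← hN]
  have h2 : θ.toEquiv.symm x = ![θ.toEquiv.symm x 0, 0] + ![0, θ.toEquiv.symm x 1] := by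
    ext i; fin_cases i <;> simp
  rw [h2]
  exact N.add_mem (hboth.1 _) (hboth.2 _)

end Irreducibility

/-! ## Existence of tori with large Hodge group -/

namespace ComplexTorus

variable (T : ComplexTorus.{u})

theorem mulC_mem_of_mulC_I_mem (U : Submodule ℂ T.H1C)
    (h : ∀ x ∈ U, T.mulC Complex.I x ∈ U) (z : ℂ) {x : T.H1C} (hx : x ∈ U) : T.mulC z x ∈ U := by
  rw [T.mulC_eq]
  exact U.add_mem (U.smul_mem _ hx) (U.smul_mem _ (h x hx))

/-- A torus is simple if its Hodge group acts irreducibly on `H₁(T, ℚ)`. -/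
theorem isSimple_of_hodgeGroup (h0 : 0 < T.dim) (h : ∀ U : Submodule ℚ T.H1Q,
    T.hodgeGroup ≤ stabilizerSubgroup U → U ≠ ⊥ → U.baseChange ℂ = ⊤) : T.IsSimple := by
  refine ⟨h0, fun W hW => ?_⟩
  let s : Set T.H1Q := (fun x : T.Λ => (1 : ℚ) ⊗ₜ[ℤ] x) '' {x | (x : T.V) ∈ W}
  -- The rational homology of the subtorus. Its complexification is stable under multiplication by
  -- `i` because `W` is a complex subspace, and hence under the Hodge group.
  let U : Submodule ℚ T.H1Q := Submodule.span ℚ s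
  have hUC : U.baseChange ℂ = Submodule.span ℂ (TensorProduct.mk ℚ ℂ T.H1Q 1 '' s) :=
    Submodule.baseChange_span ℂ s
  have hWU : ∀ v ∈ W, T.equivVC.symm (1 ⊗ₜ v) ∈ U.baseChange ℂ := by
    intro v hv
    have hv' : v ∈ Submodule.span ℝ ((W : Set T.V) ∩ (T.Λ : Set T.V)) := by rw [hW]; exact hv
    induction hv' using Submodule.span_induction with
    | mem v hv' =>
      have : T.equivVC.symm (1 ⊗ₜ v) = 1 ⊗ₜ (1 ⊗ₜ ⟨v, hv'.2⟩) := by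
        rw [LinearEquiv.symm_apply_eq]
        change _ = T.toVC _
        rw [T.toVC_tmul]
        simp
      rw [this, hUC]
      exact Submodule.subset_span ⟨_, ⟨⟨v, hv'.2⟩, hv'.1, rfl⟩, rfl⟩
    | zero => simp
    | add x y hx' hy' hx hy =>
      rw [TensorProduct.tmul_add, map_add]
      refine Submodule.add_mem _ (hx ?_) (hy ?_)
      · rw [hW] at hx'; exact hx'
      · rw [hW] at hy'; exact hy'
    | smul a x hx' hx =>
      rw [TensorProduct.tmul_smul, ← algebraMap_smul ℂ, map_smul]
      refine Submodule.smul_mem _ _ (hx ?_)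
      rw [hW] at hx'; exact hx'
  have hstab : T.hodgeGroup ≤ stabilizerSubgroup U := by
    refine T.hodgeGroup_le (isAlgebraicQSubgroup_stabilizer U) fun z g _ hg x hx => ?_
    have hg' : ∀ y, g y = T.mulC z y := fun y => LinearMap.congr_fun hg y
    rw [hg']
    refine T.mulC_mem_of_mulC_I_mem _ (fun x hx => ?_) z hx
    rw [hUC] at hx
    induction hx using Submodule.span_induction with
    | mem x hx =>
      obtain ⟨_, ⟨l, hl, rfl⟩, rfl⟩ := hx
      have : T.mulC Complex.I (1 ⊗ₜ (1 ⊗ₜ l)) =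
          T.equivVC.symm (1 ⊗ₜ (Complex.I • (l : T.V))) := by
        rw [LinearEquiv.eq_symm_apply]
        change T.toVC _ = _
        rw [T.toVC_mulC, T.toVC_tmul]
        simp
      change T.mulC Complex.I (1 ⊗ₜ (1 ⊗ₜ l)) ∈ _
      rw [this]
      exact hWU _ (W.smul_mem _ hl)
    | zero => simp
    | add x y _ _ hx hy => rw [map_add]; exact Submodule.add_mem _ hx hy
    | smul a x _ hx => rw [map_smul]; exact Submodule.smul_mem _ a hx
  by_cases hU : U = ⊥
  · left
    rw [← Submodule.restrictScalars_eq_bot_iff ℝ, ← hW, Submodule.span_eq_bot]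
    rintro v ⟨hvW, hvΛ⟩
    have h1 : (1 : ℚ) ⊗ₜ[ℤ] (⟨v, hvΛ⟩ : T.Λ) ∈ U := Submodule.subset_span ⟨_, hvW, rfl⟩
    rw [hU, Submodule.mem_bot] at h1
    have h2 : (⟨v, hvΛ⟩ : T.Λ) = 0 := T.one_tmul_injective (by simpa using h1)
    exact congrArg Subtype.val h2
  · right
    have htop := h U hstab hU
    have hΛ : ∀ l : T.Λ, (l : T.V) ∈ W := by
      intro l
      by_contra hl
      -- A real functional that vanishes on `W` but not at `l` would vanish on `U_ℂ`, which is
      -- everything.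
      obtain ⟨f, hf, hfW⟩ := Submodule.exists_le_ker_of_notMem (p := W.restrictScalars ℝ) hl
      have h1 : ∀ x ∈ U.baseChange ℂ, Module.Dual.baseChange ℂ f (T.toVC x) = 0 := by
        intro x hx
        rw [hUC] at hx
        induction hx using Submodule.span_induction with
        | mem x hx =>
          obtain ⟨_, ⟨m, hm, rfl⟩, rfl⟩ := hx
          change Module.Dual.baseChange ℂ f (T.toVC (1 ⊗ₜ (1 ⊗ₜ m))) = 0
          have : f m = 0 := hfW hm
          rw [T.toVC_tmul, Module.Dual.baseChange_apply_tmul, this, zero_smul]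
        | zero => simp
        | add x y _ _ hx hy => rw [map_add, map_add, hx, hy, add_zero]
        | smul a x _ hx => rw [map_smul, map_smul, hx, smul_zero]
      have h2 := h1 (1 ⊗ₜ (1 ⊗ₜ l)) (htop ▸ Submodule.mem_top)
      rw [T.toVC_tmul, Module.Dual.baseChange_apply_tmul] at h2
      apply hf
      simpa using h2
    rw [← Submodule.restrictScalars_eq_top_iff ℝ, eq_top_iff]
    have h3 : Submodule.span ℝ (T.Λ : Set T.V) = ⊤ := IsZLattice.span_top
    rw [← h3, Submodule.span_le]
    exact fun x hx => hΛ ⟨x, hx⟩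

end ComplexTorus

/-! ### The torus with generic complex structure -/

section GenericTorus

variable {E : Type v} [Field E] [NumberField E] {ι : Type} [Fintype ι] (ε : Module.Basis ι ℚ E)

omit [Fintype ι] in
-- The action of `E` is put on the homology after the torus is built. It commutes with the complex
-- structure because the latter is given by a matrix over `ℂ ⊗ E`.
theorem exists_module_structure {W : Type u} [AddCommGroup W] [Module ℚ W]
    (β : Module.Basis (Σ _ : Fin 2, ι) ℚ W) :
    ∃ (ρ : E →ₐ[ℚ] Module.End ℚ W) (b : Fin 2 → W), ∀ j i, β ⟨j, i⟩ = ρ (ε i) (b j) := by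
  obtain ⟨Φ, hΦ⟩ : ∃ Φ : W ≃ₗ[ℚ] (Fin 2 → E), ∀ j i, Φ (β ⟨j, i⟩) = Pi.single j (ε i) :=
    ⟨β.equiv (Pi.basis fun _ => ε) (Equiv.refl _), fun j i => by simp⟩
  refine ⟨(Φ.symm.conjAlgEquiv ℚ : _ →ₐ[ℚ] _).comp (Algebra.lsmul ℚ ℚ (Fin 2 → E)),
    fun j => Φ.symm (Pi.single j 1), fun j i => ?_⟩
  apply Φ.injective
  simp [hΦ, LinearEquiv.conjAlgEquiv_apply, ← Pi.single_smul]

/-- The entries are polynomials with rational coefficients in the parameters, so real parameters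
give a real matrix; its square is computed over `ℂ ⊗ E`. -/
theorem exists_real_matrix [DecidableEq ι] (t : Option ι → ℝ) :
    ∃ J : Matrix (Σ _ : Fin 2, ι) (Σ _ : Fin 2, ι) ℝ, J * J = -1 ∧
      ∀ l k, (J l k : ℂ) = complexMatrix ε (paramMat ε fun o => (t o : ℂ)) l k := by
  let J : Matrix (Σ _ : Fin 2, ι) (Σ _ : Fin 2, ι) ℝ :=
    Matrix.of fun l k => MvPolynomial.aeval t (paramPoly ε l k)
  have hJ : ∀ l k, (J l k : ℂ) = complexMatrix ε (paramMat ε fun o => (t o : ℂ)) l k := by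
    intro l k
    rw [complexMatrix_paramMat]
    have h := MvPolynomial.map_aeval (S₁ := ℝ) (B := ℂ) (σ := Option ι) (R := ℚ) t Complex.ofRealHom
      (paramPoly ε l k)
    rw [MvPolynomial.aeval_def, ← MvPolynomial.coe_eval₂Hom]
    refine h.trans ?_
    congr 2
  refine ⟨J, ?_, hJ⟩
  have h1 : J.map (Complex.ofRealHom) = complexMatrix ε (paramMat ε fun o => (t o : ℂ)) := by
    ext l k
    exact hJ l k
  refine (Matrix.map_injective Complex.ofReal_injective : Function.Injective
    fun M : Matrix (Σ _ : Fin 2, ι) (Σ _ : Fin 2, ι) ℝ => M.map Complex.ofRealHom) ?_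
  change (J * J).map Complex.ofRealHom = (-1 : Matrix _ _ ℝ).map Complex.ofRealHom
  rw [Matrix.map_mul, h1, ← complexMatrix_mul, paramMat, jMat_mul_self, complexMatrix_neg_one]
  ext l k
  by_cases h : l = k <;> simp [h]

variable (T : ComplexTorus.{u}) (ρ : E →ₐ[ℚ] Module.End ℚ T.H1Q)
  (b : Fin 2 → T.H1Q) (β : Module.Basis (Σ _ : Fin 2, ι) ℚ T.H1Q)
  (hβ : ∀ j i, β ⟨j, i⟩ = ρ (ε i) (b j))

/-- For the upper bound, `a + bJ` has determinant `a² + b²`, as `J` has trace `0` and determinant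
`1`. For the lower bound, `J` is itself a generic member of the family and lies in the Hodge group
as the action of `i`. -/
theorem hodgeGroup_eq_resSL {t : Option ι → ℂ} (ht : AlgebraicIndependent ℚ t)
    (hJ : (ComplexFrame.ofBasis ρ ε b β hβ).ofMatrix (paramMat ε t) = T.mulC Complex.I) :
    T.hodgeGroup = resSL ρ := by
  refine le_antisymm (T.hodgeGroup_le (isAlgebraicQSubgroup_resSL ρ ε b β hβ)
    fun z g hz hg => ?_) (resSL_le_of_generic ε ρ b β hβ T.isAlgebraic_hodgeGroup ht ?_)
  · rw [(ComplexFrame.ofBasis ρ ε b β hβ).mem_resSL_iff]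
    refine ⟨(z.re : ℂ) • 1 + (z.im : ℂ) • (paramMat ε t).1, ?_, ?_⟩
    · have h1 : (z.re : ℂ) ^ 2 + (z.im : ℂ) ^ 2 = 1 := by
        have := Complex.sq_norm z
        rw [hz, Complex.normSq_apply] at this
        have h2 : z.re ^ 2 + z.im ^ 2 = 1 := by linarith
        exact_mod_cast h2
      have h2 : algebraMap ℂ (ℂ ⊗[ℚ] E) z.re ^ 2 + algebraMap ℂ (ℂ ⊗[ℚ] E) z.im ^ 2 = 1 := by
        rw [← map_pow, ← map_pow, ← map_add, h1, map_one]
      rw [← algebraMap_smul (ℂ ⊗[ℚ] E), ← algebraMap_smul (ℂ ⊗[ℚ] E) (z.im : ℂ)]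
      have h3 : (paramMat ε t).1 = (jMat (paramElt ε t) (t none ⊗ₜ 1)).1 := rfl
      rw [h3, coe_jMat, Matrix.det_fin_two]
      generalize algebraMap ℂ (ℂ ⊗[ℚ] E) z.re = p at h2 ⊢
      generalize algebraMap ℂ (ℂ ⊗[ℚ] E) z.im = q at h2 ⊢
      generalize paramElt ε t = x
      generalize t none ⊗ₜ[ℚ] (1 : E) = r
      simp
      linear_combination h2
    · rw [ComplexFrame.ofMatrix_add, ComplexFrame.ofMatrix_smul, ComplexFrame.ofMatrix_smul,
        ComplexFrame.ofMatrix_one, hJ, hg, ← T.mulC_eq]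
  · refine T.mem_hodgeGroup Complex.norm_I ?_
    rw [ComplexFrame.slHom_toLinearMap, hJ]

theorem exists_torus (E : Type u) [Field E] [NumberField E] :
    ∃ T : ComplexTorus.{0}, T.IsSimple ∧ T.dim = Module.finrank ℚ E ∧
      ∃ ι : E ≃ₐ[ℚ] T.EndAlg,
        T.hodgeGroup = resSL (T.rationalRep.comp (ι : E →ₐ[ℚ] T.EndAlg)) := by
  let ε := Module.finBasis ℚ E
  obtain ⟨t, ht⟩ := exists_algebraicIndependent_real (Option (Fin (Module.finrank ℚ E)))
  obtain ⟨J, hJ, hJC⟩ := exists_real_matrix ε t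
  obtain ⟨T, β, hT⟩ := exists_complexTorus J hJ
  obtain ⟨ρ, b, hβ⟩ := exists_module_structure ε β
  have htC : AlgebraicIndependent ℚ fun o => (t o : ℂ) :=
    ht.map' (f := Complex.ofRealAm.restrictScalars ℚ) Complex.ofReal_injective
  have hmul : (ComplexFrame.ofBasis ρ ε b β hβ).ofMatrix (paramMat ε fun o => (t o : ℂ)) =
      T.mulC Complex.I := by
    refine (β.baseChange ℂ).ext fun k => ?_
    rw [Module.Basis.baseChange_apply, ofMatrix_basis, hT]
    simp only [hJC]
  have hG := hodgeGroup_eq_resSL ε T ρ b β hβ htC hmul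
  have hdim : T.dim = Module.finrank ℚ E := by
    have h1 := T.finrank_H1Q
    rw [Module.finrank_eq_card_basis β] at h1
    simp at h1
    omega
  have hinj : Function.Injective ρ := by
    have : Nontrivial T.H1Q := ⟨β ⟨0, ⟨0, Module.finrank_pos⟩⟩, 0, β.ne_zero _⟩
    exact ρ.toRingHom.injective
  obtain ⟨ι, hι⟩ := T.exists_algEquiv_endAlg ρ hinj fun A => by
    constructor
    · rintro ⟨e, rfl⟩ y
      have h := (commutes_complexAction_iff ρ (T.mulC Complex.I)).1 (fun r x => by
        rw [← hmul, ComplexFrame.ofMatrix_complexAction]) e y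
      exact h.symm
    · intro hA
      -- An operator commuting with `i` is centralized by the whole Hodge group, because
      -- centralizers are algebraic; this group is `Res SL₂`.
      refine mem_range_of_resSL_le_centralizer ε ρ b β hβ ?_
      rw [← hG]
      refine T.hodgeGroup_le (isAlgebraicQSubgroup_centralizer A) fun z g _ hg y => ?_
      have hg' : ∀ y, g y = T.mulC z y := fun y => LinearMap.congr_fun hg y
      rw [hg', hg', T.mulC_eq]
      simp only [LinearMap.add_apply, LinearMap.smul_apply, Module.End.one_apply, map_add, map_smul,
        hA]
  refine ⟨T, T.isSimple_of_hodgeGroup (hdim ▸ Module.finrank_pos) fun U hU h0 =>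
    baseChange_eq_top_of_resSL_le_stabilizer ε ρ b β hβ (hG ▸ hU) h0, hdim, ι, ?_⟩
  rw [hι, hG]

end GenericTorus

/-! ## Decomposable alternating forms -/

section Wedge

variable {R : Type v} [CommRing R] {M : Type u} [AddCommGroup M] [Module R M] {κ : Type*}
  (b : Module.Basis κ R M)

/-- The alternating form `b i* ∧ b j*`. -/
def wedge (i j : κ) : M [⋀^Fin 2]→ₗ[R] R :=
  altOfBilin ((b.coord i).smulRight (b.coord j) - (b.coord j).smulRight (b.coord i))
    fun x => by simp [mul_comm]

theorem wedge_apply (i j : κ) (x y : M) :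
    wedge b i j ![x, y] = b.repr x i * b.repr y j - b.repr x j * b.repr y i := by
  simp [wedge]

theorem wedge_apply_self {i j : κ} (h : i ≠ j) : wedge b i j ![b i, b j] = 1 := by
  simp [wedge_apply, h]

theorem wedge_swap (i j : κ) : wedge b i j = -wedge b j i := by
  refine alt_ext fun x y => ?_
  rw [AlternatingMap.neg_apply, wedge_apply, wedge_apply]
  ring

theorem alt_sum_apply {α : Type*} (s : Finset α) (f : α → M [⋀^Fin 2]→ₗ[R] R) (v : Fin 2 → M) :
    (∑ i ∈ s, f i) v = ∑ i ∈ s, f i v :=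
  map_sum (⟨⟨fun ω => ω v, rfl⟩, fun _ _ => rfl⟩ : (M [⋀^Fin 2]→ₗ[R] R) →+ R) f s

/-- Summing over ordered pairs counts every wedge twice, which avoids choosing an order on the
basis. -/
theorem two_smul_eq_sum_wedge [Fintype κ] (ω : M [⋀^Fin 2]→ₗ[R] R) :
    (2 : R) • ω = ∑ i, ∑ j, ω ![b i, b j] • wedge b i j := by
  classical
  refine alt_ext_basis b fun k l => ?_
  simp only [alt_sum_apply, AlternatingMap.smul_apply, wedge_apply, smul_eq_mul,
    Module.Basis.repr_self, mul_sub, Finset.sum_sub_distrib, Finsupp.single_apply]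
  simp [two_mul, alt_swap ω (b l) (b k)]

end Wedge

/-! ## Eigenbases of a frame -/

section EigenBasis

variable {E : Type v} [Field E] [NumberField E] {W : Type u} [AddCommGroup W] [Module ℚ W]
  {ρ : E →ₐ[ℚ] Module.End ℚ W}

/-- The idempotents of `ℂ ⊗ E` as a basis. -/
def embBasis (E : Type v) [Field E] [NumberField E] : Module.Basis (E →+* ℂ) ℂ (ℂ ⊗[ℚ] E) :=
  (Pi.basisFun ℂ (E →+* ℂ)).map (embEquiv E).symm.toLinearEquiv

theorem embBasis_apply (σ : E →+* ℂ) : embBasis E σ = embIdem σ := by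
  classical
  simp only [embBasis, embIdem, Module.Basis.map_apply, Pi.basisFun_apply]
  change (embEquiv E).symm _ = _
  congr

/-- The basis of `W_ℂ` that consists of the components of the two vectors of a frame. -/
def ComplexFrame.eigenBasis (θ : ComplexFrame ρ) :
    Module.Basis (Σ _ : Fin 2, E →+* ℂ) ℂ (ℂ ⊗[ℚ] W) :=
  (Pi.basis fun _ : Fin 2 => embBasis E).map θ.toEquiv

variable (θ : ComplexFrame ρ)

theorem ComplexFrame.eigenBasis_apply (j : Fin 2) (σ : E →+* ℂ) :
    θ.eigenBasis ⟨j, σ⟩ = θ.toEquiv (Pi.single j (embIdem σ)) := by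
  simp [eigenBasis, embBasis_apply]

theorem ComplexFrame.complexAction_eigenBasis (r : ℂ ⊗[ℚ] E) (j : Fin 2) (σ : E →+* ℂ) :
    complexAction ρ r (θ.eigenBasis ⟨j, σ⟩) = embEval σ r • θ.eigenBasis ⟨j, σ⟩ := by
  rw [θ.eigenBasis_apply, ← θ.map_act, ← map_smul, ← Pi.single_smul, ← Pi.single_smul, smul_eq_mul,
    mul_embIdem]

theorem ComplexFrame.ofMatrix_eigenBasis (A : Matrix (Fin 2) (Fin 2) (ℂ ⊗[ℚ] E)) (j : Fin 2)
    (σ : E →+* ℂ) :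
    θ.ofMatrix A (θ.eigenBasis ⟨j, σ⟩) =
      embEval σ (A 0 j) • θ.eigenBasis ⟨0, σ⟩ + embEval σ (A 1 j) • θ.eigenBasis ⟨1, σ⟩ := by
  simp only [θ.eigenBasis_apply]
  rw [θ.ofMatrix_toEquiv, ← map_smul, ← map_smul, ← map_add]
  congr 1
  ext1 i
  rw [Matrix.mulVec_single]
  fin_cases i <;> simp [mul_embIdem]

theorem exists_matrix_embEval (M : (E →+* ℂ) → Matrix (Fin 2) (Fin 2) ℂ) :
    ∃ A : Matrix (Fin 2) (Fin 2) (ℂ ⊗[ℚ] E), ∀ σ, (embEval σ).mapMatrix A = M σ := by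
  refine ⟨Matrix.of fun i j => (embEquiv E).symm fun σ => M σ i j, fun σ => ?_⟩
  ext i j
  simp

theorem matrix_embEval_ext {m n : Type*} {A B : Matrix m n (ℂ ⊗[ℚ] E)}
    (h : ∀ σ : E →+* ℂ, A.map (embEval σ) = B.map (embEval σ)) : A = B := by
  ext i j
  exact embEval_ext fun σ => congrFun (congrFun (h σ) i) j

/-- A complex `2 × 2` matrix of determinant one and square `-1` is diagonalizable. -/
theorem exists_diagonalization {A : Matrix (Fin 2) (Fin 2) ℂ} (hA : A * A = -1) (hdet : A.det = 1) :
    ∃ P : Matrix (Fin 2) (Fin 2) ℂ, IsUnit P.det ∧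
      A * P = P * !![Complex.I, 0; 0, -Complex.I] := by
  have h00 := congrFun (congrFun hA 0) 0
  have h01 := congrFun (congrFun hA 0) 1
  have h10 := congrFun (congrFun hA 1) 0
  have h11 := congrFun (congrFun hA 1) 1
  rw [Matrix.det_fin_two] at hdet
  simp only [Matrix.mul_apply, Fin.sum_univ_two, Matrix.neg_apply, Matrix.one_apply_eq, ne_eq,
    one_ne_zero, zero_ne_one, not_false_eq_true, Matrix.one_apply_ne, neg_zero] at h00 h01 h10 h11
  obtain ⟨a, b, c, d, rfl⟩ : ∃ a b c d, A = !![a, b; c, d] := ⟨_, _, _, _, Matrix.eta_fin_two A⟩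
  simp only [Matrix.of_apply, Matrix.cons_val', Matrix.cons_val_zero, Matrix.cons_val_one,
    Matrix.cons_val_fin_one] at h00 h01 h10 h11 hdet
  have hI := Complex.I_mul_I
  -- Determinant `1` excludes the scalars `i` and `-i`, whose determinant is `-1`; hence the trace
  -- is `0` and both eigenvalues occur. The columns of each `P` below are eigenvectors for `i` and
  -- `-i`.
  have htr : d = -a := by
    linear_combination d * (h00 + hdet) - c * h01 - (a + d) * hdet
  subst htr
  by_cases hb : b = 0
  · subst hb
    have ha : (a - Complex.I) * (a + Complex.I) = 0 := by linear_combination h00 - hI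
    rcases mul_eq_zero.1 ha with ha | ha
    · obtain rfl : a = Complex.I := sub_eq_zero.1 ha
      refine ⟨!![2 * Complex.I, 0; c, 1], ?_, ?_⟩
      · simp [Matrix.det_fin_two]
      · rw [Matrix.mul_fin_two, Matrix.mul_fin_two]
        ext i j
        fin_cases i <;> fin_cases j <;> simp <;> ring
    · obtain rfl : a = -Complex.I := eq_neg_of_add_eq_zero_left ha
      refine ⟨!![0, 2 * Complex.I; 1, -c], ?_, ?_⟩
      · simp [Matrix.det_fin_two]
      · rw [Matrix.mul_fin_two, Matrix.mul_fin_two]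
        ext i j
        fin_cases i <;> fin_cases j <;> simp <;> ring
  · refine ⟨!![b, b; Complex.I - a, -Complex.I - a], ?_, ?_⟩
    · rw [Matrix.det_fin_two, isUnit_iff_ne_zero]
      simp only [Matrix.of_apply, Matrix.cons_val', Matrix.cons_val_zero, Matrix.cons_val_one,
        Matrix.cons_val_fin_one]
      have : b * (-Complex.I - a) - b * (Complex.I - a) = -(2 * (b * Complex.I)) := by ring
      rw [this]
      simp [hb]
    · rw [Matrix.mul_fin_two, Matrix.mul_fin_two]
      ext i j
      fin_cases i <;> fin_cases j <;> simp <;>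
        first | ring1 | linear_combination h00 - hI

/-- A frame in which an operator of square `-1` in `Res_{E/ℚ} SL₂` is diagonal. -/
theorem ComplexFrame.exists_diagonal {A : Matrix (Fin 2) (Fin 2) (ℂ ⊗[ℚ] E)} (hA : A * A = -1)
    (hdet : A.det = 1) : ∃ θ' : ComplexFrame ρ,
      ∀ p q, θ.ofMatrix A (θ'.toEquiv ![p, q]) =
        θ'.toEquiv ![Complex.I • p, -(Complex.I • q)] := by
  have h1 : ∀ σ : E →+* ℂ, ∃ P : Matrix (Fin 2) (Fin 2) ℂ, IsUnit P.det ∧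
      (embEval σ).mapMatrix A * P = P * !![Complex.I, 0; 0, -Complex.I] := fun σ =>
    exists_diagonalization (by rw [← map_mul, hA, map_neg, map_one])
      (by rw [← AlgHom.map_det, hdet, map_one])
  choose P hP hAP using h1
  -- The diagonalizations at the separate embeddings are glued into one matrix over `ℂ ⊗ E`,
  -- invertible because it is so at each embedding.
  obtain ⟨Q, hQ⟩ := exists_matrix_embEval P
  have hdetQ : IsUnit Q.det := isUnit_iff_embEval_ne_zero.2 fun σ => by
    rw [AlgHom.map_det, hQ]
    exact (hP σ).ne_zero
  have hAQ : A * Q = Q * !![algebraMap ℂ _ Complex.I, 0; 0, -algebraMap ℂ _ Complex.I] := by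
    refine matrix_embEval_ext fun σ => ?_
    change (embEval σ).mapMatrix _ = (embEval σ).mapMatrix _
    rw [map_mul, map_mul, hQ, hAP]
    congr 1
    ext i j
    fin_cases i <;> fin_cases j <;> simp
  let e := Matrix.toLin'OfInv (Matrix.nonsing_inv_mul Q hdetQ) (Matrix.mul_nonsing_inv Q hdetQ)
  refine ⟨⟨e.restrictScalars ℂ ≪≫ₗ θ.toEquiv, fun r p => ?_⟩, fun p q => ?_⟩
  · change θ.toEquiv (e (r • p)) = complexAction ρ r (θ.toEquiv (e p))
    rw [map_smul, θ.map_act]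
  · change θ.ofMatrix A (θ.toEquiv (Q.mulVec ![p, q])) =
      θ.toEquiv (Q.mulVec ![Complex.I • p, -(Complex.I • q)])
    rw [θ.ofMatrix_toEquiv, Matrix.mulVec_mulVec, hAQ, ← Matrix.mulVec_mulVec]
    congr 2
    ext i
    fin_cases i <;> simp [Matrix.mulVec, dotProduct, Fin.sum_univ_two, Algebra.smul_def]

end EigenBasis

/-! ## Bases of `E`-vector spaces of dimension two -/

theorem exists_basis_of_finrank {E : Type v} [Field E] [NumberField E] {W : Type u} [AddCommGroup W]
    [Module ℚ W] [FiniteDimensional ℚ W] (ρ : E →ₐ[ℚ] Module.End ℚ W)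
    (h : Module.finrank ℚ W = 2 * Module.finrank ℚ E) {ι : Type*} (ε : Module.Basis ι ℚ E) :
    ∃ (b : Fin 2 → W) (β : Module.Basis (Σ _ : Fin 2, ι) ℚ W), ∀ j i, β ⟨j, i⟩ = ρ (ε i) (b j) := by
  let _ : Module E W := Module.compHom W ρ.toRingHom
  have hact : ∀ (e : E) (w : W), e • w = ρ e w := fun _ _ => rfl
  have : IsScalarTower ℚ E W := ⟨fun q e w => by rw [hact, hact, map_smul]; rfl⟩
  have : Module.Finite E W := Module.Finite.of_restrictScalars_finite ℚ E W
  have h2 : Module.finrank E W = 2 := by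
    have h3 := Module.finrank_mul_finrank ℚ E W
    rw [h, mul_comm] at h3
    exact Nat.eq_of_mul_eq_mul_right Module.finrank_pos h3
  let b := Module.finBasisOfFinrankEq E W h2
  refine ⟨b, (ε.smulTower b).reindex ((Equiv.prodComm _ _).trans (Equiv.sigmaEquivProd _ _).symm),
    fun j i => ?_⟩
  rw [Module.Basis.reindex_apply, ← hact]
  simp [Module.Basis.smulTower_apply]

/-! ## Weights of `Res_{E/ℚ} SL₂` on alternating forms -/

section Weights

variable {E : Type v} [Field E] [NumberField E] {W : Type u} [AddCommGroup W] [Module ℚ W]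
  {ρ : E →ₐ[ℚ] Module.End ℚ W} (θ : ComplexFrame ρ)

theorem ComplexFrame.exists_ofMatrix_eigenBasis (M : (E →+* ℂ) → Matrix (Fin 2) (Fin 2) ℂ)
    (hM : ∀ σ, (M σ).det = 1) :
    ∃ A : Matrix (Fin 2) (Fin 2) (ℂ ⊗[ℚ] E), A.det = 1 ∧ ∀ j σ,
      θ.ofMatrix A (θ.eigenBasis ⟨j, σ⟩) =
        M σ 0 j • θ.eigenBasis ⟨0, σ⟩ + M σ 1 j • θ.eigenBasis ⟨1, σ⟩ := by
  obtain ⟨A, hA⟩ := exists_matrix_embEval M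
  refine ⟨A, embEval_ext fun σ => by rw [AlgHom.map_det, hA, hM, map_one], fun j σ => ?_⟩
  rw [θ.ofMatrix_eigenBasis, ← hA]
  rfl

variable [FiniteDimensional ℚ W] {N : Submodule ℂ ((ℂ ⊗[ℚ] W) [⋀^Fin 2]→ₗ[ℂ] ℂ)}
  (hN : resSL ρ ≤ formStabilizer N)
include hN

theorem ComplexFrame.compLinearMap_ofMatrix_mem {A : Matrix (Fin 2) (Fin 2) (ℂ ⊗[ℚ] E)}
    (hA : A.det = 1) {ω : (ℂ ⊗[ℚ] W) [⋀^Fin 2]→ₗ[ℂ] ℂ} (hω : ω ∈ N) :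
    ω.compLinearMap (θ.ofMatrix A) ∈ N :=
  compLinearMap_mem_of_mem_formStabilizer (hN (θ.slHom_mem ⟨A, hA⟩)) hω

/-- As `σ ≠ τ`, Weyl elements can be chosen independently in the two factors of the group, to carry
the index `0` to `j` at `σ` and to `k` at `τ`. -/
theorem exists_apply_zero_zero_ne_zero {ω : (ℂ ⊗[ℚ] W) [⋀^Fin 2]→ₗ[ℂ] ℂ} (hω : ω ∈ N)
    {j k : Fin 2} {σ τ : E →+* ℂ} (hστ : σ ≠ τ)
    (h : ω ![θ.eigenBasis ⟨j, σ⟩, θ.eigenBasis ⟨k, τ⟩] ≠ 0) :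
    ∃ ω' ∈ N, ω' ![θ.eigenBasis ⟨0, σ⟩, θ.eigenBasis ⟨0, τ⟩] ≠ 0 := by
  classical
  let S : Fin 2 → Matrix (Fin 2) (Fin 2) ℂ := fun j => if j = 0 then 1 else !![0, -1; 1, 0]
  have hS : ∀ j, (S j).det = 1 := by
    intro j
    fin_cases j <;> simp [S, Matrix.det_fin_two]
  have hv : ∀ j α, S j 0 0 • θ.eigenBasis ⟨0, α⟩ + S j 1 0 • θ.eigenBasis ⟨1, α⟩ =
      θ.eigenBasis ⟨j, α⟩ := by
    intro j α
    fin_cases j <;> simp [S]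
  obtain ⟨A, hA, hAv⟩ := θ.exists_ofMatrix_eigenBasis
    (fun α => if α = σ then S j else S k) fun α => by split_ifs <;> exact hS _
  refine ⟨_, θ.compLinearMap_ofMatrix_mem hN hA hω, ?_⟩
  rw [alt_compLinearMap, hAv, hAv, if_pos rfl, if_neg hστ.symm, hv, hv]
  exact h

-- The torus element `diag(i, -i)` at `σ`, trivial at the other embeddings, multiplies the value at
-- `(x, y)` by `t = d x * d y`. The factor `(t - 1)(t + i)` kills `t = 1` and `t = -i`. The case `t
-- = -1` requires `x = y`, where the form vanishes. What survives is `t = i`: one vector is the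
-- `0`-vector at `σ`, and the other lies outside `W_σ`.
open Classical in
theorem exists_weight_projection {ω : (ℂ ⊗[ℚ] W) [⋀^Fin 2]→ₗ[ℂ] ℂ} (hω : ω ∈ N) (σ : E →+* ℂ)
    (d : (Σ _ : Fin 2, E →+* ℂ) → ℂ) (hd : d = fun x =>
      if x.2 = σ then (if x.1 = 0 then Complex.I else -Complex.I) else 1) :
    ∃ ω' ∈ N, ∀ x y, ω' ![θ.eigenBasis x, θ.eigenBasis y] =
      (d x * d y - 1) * (d x * d y + Complex.I) * ω ![θ.eigenBasis x, θ.eigenBasis y] := by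
  obtain ⟨A, hA, hAv⟩ := θ.exists_ofMatrix_eigenBasis
    (fun α => if α = σ then !![Complex.I, 0; 0, -Complex.I] else !![1, 0; 0, 1]) fun α => by
      split_ifs <;> simp [Matrix.det_fin_two]
  have hdv : ∀ x, θ.ofMatrix A (θ.eigenBasis x) = d x • θ.eigenBasis x := by
    rintro ⟨j, α⟩
    rw [hAv, hd]
    by_cases h : α = σ <;> fin_cases j <;> simp [h]
  have hmem : ∀ {ω}, ω ∈ N → ω.compLinearMap (θ.ofMatrix A) ∈ N :=
    fun h => θ.compLinearMap_ofMatrix_mem hN hA h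
  have hval : ∀ (ω : (ℂ ⊗[ℚ] W) [⋀^Fin 2]→ₗ[ℂ] ℂ) x y,
      ω.compLinearMap (θ.ofMatrix A) ![θ.eigenBasis x, θ.eigenBasis y] =
        d x * d y * ω ![θ.eigenBasis x, θ.eigenBasis y] := by
    intro ω x y
    rw [alt_compLinearMap, hdv, hdv, ← bilinOfAlt_apply, map_smul, map_smul, LinearMap.smul_apply,
      bilinOfAlt_apply, smul_eq_mul, smul_eq_mul]
    ring
  refine ⟨_, N.sub_mem (N.add_mem (hmem (hmem hω)) (N.smul_mem (Complex.I - 1) (hmem hω)))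
    (N.smul_mem Complex.I hω), fun x y => ?_⟩
  simp only [AlternatingMap.sub_apply, AlternatingMap.add_apply, AlternatingMap.smul_apply,
    smul_eq_mul, hval]
  ring

/-- After the reduction to indices `0`, the weight projections at `σ` and at `τ` leave only the
coefficient at the two `0`-vectors. -/
theorem wedge_mem_of_apply_ne_zero {ω : (ℂ ⊗[ℚ] W) [⋀^Fin 2]→ₗ[ℂ] ℂ} (hω : ω ∈ N)
    {j k : Fin 2} {σ τ : E →+* ℂ} (hστ : σ ≠ τ)
    (h : ω ![θ.eigenBasis ⟨j, σ⟩, θ.eigenBasis ⟨k, τ⟩] ≠ 0) :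
    wedge θ.eigenBasis ⟨0, σ⟩ ⟨0, τ⟩ ∈ N := by
  classical
  obtain ⟨ω₁, hω₁, h₁⟩ := exists_apply_zero_zero_ne_zero θ hN hω hστ h
  obtain ⟨ω₂, hω₂, h₂⟩ := exists_weight_projection θ hN hω₁ σ _ rfl
  obtain ⟨ω₃, hω₃, h₃⟩ := exists_weight_projection θ hN hω₂ τ _ rfl
  -- Each projection multiplies the surviving coefficient by `(t - 1)(t + i)` at `t = i`, that is,
  -- by `(i - 1)(2i)`.
  have hne : ((Complex.I - 1) * (2 * Complex.I)) ^ 2 *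
      ω₁ ![θ.eigenBasis ⟨0, σ⟩, θ.eigenBasis ⟨0, τ⟩] ≠ 0 := by
    refine mul_ne_zero (pow_ne_zero _ (mul_ne_zero (fun h => ?_) (by simp))) h₁
    have := congrArg Complex.im h
    simp at this
  have hswap := alt_swap ω₁ (θ.eigenBasis ⟨0, τ⟩) (θ.eigenBasis ⟨0, σ⟩)
  have hI := Complex.I_mul_I
  have heq : ω₃ = (((Complex.I - 1) * (2 * Complex.I)) ^ 2 *
      ω₁ ![θ.eigenBasis ⟨0, σ⟩, θ.eigenBasis ⟨0, τ⟩]) • wedge θ.eigenBasis ⟨0, σ⟩ ⟨0, τ⟩ := by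
    refine alt_ext_basis θ.eigenBasis ?_
    rintro ⟨i, α⟩ ⟨l, β⟩
    rw [h₃, h₂, AlternatingMap.smul_apply, wedge_apply, Module.Basis.repr_self,
      Module.Basis.repr_self]
    dsimp only
    have hτσ := hστ.symm
    by_cases h1 : α = σ
    · subst h1
      by_cases h2 : β = τ
      · subst h2
        fin_cases i <;> fin_cases l <;> simp [hστ, hτσ]
        ring
      · simp [h2, hστ, hτσ, Ne.symm h2]
    · by_cases h2 : α = τ
      · subst h2
        by_cases h3 : β = σ
        · subst h3
          fin_cases i <;> fin_cases l <;> simp [hστ, hτσ, hswap]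
          ring
        · simp [h3, hστ, hτσ, Ne.symm h3]
      · by_cases h3 : β = σ
        · subst h3
          simp [h1, h2, hστ, Ne.symm h1, Ne.symm h2]
        · simp [h1, h2, h3, Ne.symm h1, Ne.symm h2, Ne.symm h3]
  rw [heq] at hω₃
  exact (N.smul_mem_iff hne).1 hω₃

end Weights

/-! ## The semilinear action of `Aut(ℂ)` -/

section Galois

section Basic

variable {W : Type u} [AddCommGroup W] [Module ℚ W]

/-- The semilinear automorphism `s ⊗ 1` of `ℂ ⊗ W`. -/
def galoisMap (W : Type u) [AddCommGroup W] [Module ℚ W] (s : ℂ ≃+* ℂ) :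
    (ℂ ⊗[ℚ] W) →ₗ[ℚ] (ℂ ⊗[ℚ] W) :=
  (s.toRingHom.toRatAlgHom : ℂ →ₐ[ℚ] ℂ).toLinearMap.rTensor W

@[simp]
theorem galoisMap_tmul (s : ℂ ≃+* ℂ) (z : ℂ) (w : W) :
    galoisMap W s (z ⊗ₜ w) = s z ⊗ₜ w := rfl

/-- The alternating forms with rational values on rational vectors. -/
def IsRationalForm (ω : (ℂ ⊗[ℚ] W) [⋀^Fin 2]→ₗ[ℂ] ℂ) : Prop :=
  ∀ v w : W, ∃ q : ℚ, ω ![1 ⊗ₜ v, 1 ⊗ₜ w] = q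

theorem IsRationalForm.apply_galoisMap {ω : (ℂ ⊗[ℚ] W) [⋀^Fin 2]→ₗ[ℂ] ℂ} (hω : IsRationalForm ω)
    (s : ℂ ≃+* ℂ) (x y : ℂ ⊗[ℚ] W) :
    ω ![galoisMap W s x, galoisMap W s y] = s (ω ![x, y]) := by
  simp only [← bilinOfAlt_apply]
  induction x with
  | zero => simp
  | add a b ha hb => simp only [map_add, LinearMap.add_apply, ha, hb]
  | tmul z v =>
    induction y with
    | zero => simp only [map_zero]
    | add a b ha hb => simp only [map_add, ha, hb]
    | tmul z' w =>
      have h : ∀ (z : ℂ) (w : W), z ⊗ₜ[ℚ] w = z • (1 ⊗ₜ[ℚ] w) := fun z w => by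
        rw [TensorProduct.smul_tmul', smul_eq_mul, mul_one]
      obtain ⟨q, hq⟩ := hω v w
      have hB : ∀ a b : ℂ, bilinOfAlt ω (a ⊗ₜ v) (b ⊗ₜ w) = a * b * q := fun a b => by
        rw [h, h b, map_smul, map_smul, LinearMap.smul_apply, bilinOfAlt_apply, hq, smul_eq_mul,
          smul_eq_mul]
        ring
      rw [galoisMap_tmul, galoisMap_tmul, hB, hB, map_mul, map_mul, map_ratCast]

/-- Rational forms are equivariant under `s ⊗ 1`, so their complex span is stable under the
semilinear action. -/
theorem exists_galois_conjugate {H : Submodule ℚ ((ℂ ⊗[ℚ] W) [⋀^Fin 2]→ₗ[ℂ] ℂ)}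
    (hH : ∀ ω ∈ H, IsRationalForm ω) (s : ℂ ≃+* ℂ) {η : (ℂ ⊗[ℚ] W) [⋀^Fin 2]→ₗ[ℂ] ℂ}
    (hη : η ∈ Submodule.span ℂ (H : Set ((ℂ ⊗[ℚ] W) [⋀^Fin 2]→ₗ[ℂ] ℂ))) :
    ∃ η' ∈ Submodule.span ℂ (H : Set ((ℂ ⊗[ℚ] W) [⋀^Fin 2]→ₗ[ℂ] ℂ)),
      ∀ x y, η' ![galoisMap W s x, galoisMap W s y] = s (η ![x, y]) := by
  induction hη using Submodule.span_induction with
  | mem ω hω => exact ⟨ω, Submodule.subset_span hω, (hH ω hω).apply_galoisMap s⟩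
  | zero => exact ⟨0, Submodule.zero_mem _, by simp⟩
  | add a b _ _ ha hb =>
    obtain ⟨a', ha', ha⟩ := ha
    obtain ⟨b', hb', hb⟩ := hb
    exact ⟨a' + b', Submodule.add_mem _ ha' hb', fun x y => by simp [ha, hb]⟩
  | smul c a _ ha =>
    obtain ⟨a', ha', ha⟩ := ha
    exact ⟨s c • a', Submodule.smul_mem _ _ ha', fun x y => by simp [ha]⟩

/-- The rational alternating forms span the space of all alternating forms. -/
theorem span_isRationalForm [FiniteDimensional ℚ W] {H : Submodule ℚ ((ℂ ⊗[ℚ] W) [⋀^Fin 2]→ₗ[ℂ] ℂ)}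
    (hH : ∀ ω, IsRationalForm ω → ω ∈ H) :
    Submodule.span ℂ (H : Set ((ℂ ⊗[ℚ] W) [⋀^Fin 2]→ₗ[ℂ] ℂ)) = ⊤ := by
  refine eq_top_iff.2 fun ω _ => ?_
  let b := (Module.finBasis ℚ W).baseChange ℂ
  rw [← Submodule.smul_mem_iff _ (two_ne_zero : (2 : ℂ) ≠ 0), two_smul_eq_sum_wedge b]
  refine Submodule.sum_mem _ fun i _ => Submodule.sum_mem _ fun j _ => Submodule.smul_mem _ _
    (Submodule.subset_span (hH _ fun v w => ?_))
  refine ⟨(Module.finBasis ℚ W).repr v i * (Module.finBasis ℚ W).repr w j -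
    (Module.finBasis ℚ W).repr v j * (Module.finBasis ℚ W).repr w i, ?_⟩
  rw [wedge_apply]
  simp [b, Rat.smul_def]

end Basic

variable {E : Type v} [Field E] [NumberField E]

theorem embEval_galoisMap (s : ℂ ≃+* ℂ) (r : ℂ ⊗[ℚ] E) (σ : E →+* ℂ) :
    embEval (embeddingAction E s σ) (galoisMap E s r) = s (embEval σ r) := by
  induction r with
  | zero => simp
  | add a b ha hb => simp only [map_add, ha, hb]
  | tmul z e =>
    rw [galoisMap_tmul, embEval_tmul, embEval_tmul, map_mul]
    rfl

theorem galoisMap_embIdem (s : ℂ ≃+* ℂ) (σ : E →+* ℂ) :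
    galoisMap E s (embIdem σ) = embIdem (embeddingAction E s σ) := by
  classical
  refine embEval_ext fun τ => ?_
  obtain ⟨τ, rfl⟩ := (embeddingAction E s).surjective τ
  rw [embEval_galoisMap, embEval_embIdem, embEval_embIdem]
  by_cases h : τ = σ <;> simp [h]

variable {W : Type u} [AddCommGroup W] [Module ℚ W] {ρ : E →ₐ[ℚ] Module.End ℚ W}

theorem galoisMap_complexAction (ρ : E →ₐ[ℚ] Module.End ℚ W) (s : ℂ ≃+* ℂ) (r : ℂ ⊗[ℚ] E)
    (x : ℂ ⊗[ℚ] W) :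
    galoisMap W s (complexAction ρ r x) = complexAction ρ (galoisMap E s r) (galoisMap W s x) := by
  induction r with
  | zero => simp
  | add a b ha hb => simp only [map_add, LinearMap.add_apply, ha, hb]
  | tmul z e =>
    induction x with
    | zero => simp
    | add a b ha hb => simp only [map_add, ha, hb]
    | tmul z' w => simp

theorem galoisMap_embIdem_action (s : ℂ ≃+* ℂ) (σ : E →+* ℂ) (x : ℂ ⊗[ℚ] W) :
    galoisMap W s (complexAction ρ (embIdem σ) x) =
      complexAction ρ (embIdem (embeddingAction E s σ)) (galoisMap W s x) := by
  rw [galoisMap_complexAction, galoisMap_embIdem]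

variable (θ : ComplexFrame ρ)

theorem ComplexFrame.embIdem_eigenBasis_self (j : Fin 2) (σ : E →+* ℂ) :
    complexAction ρ (embIdem σ) (θ.eigenBasis ⟨j, σ⟩) = θ.eigenBasis ⟨j, σ⟩ := by
  rw [θ.complexAction_eigenBasis, embEval_embIdem, if_pos rfl, one_smul]

theorem ComplexFrame.embIdem_eigenBasis_of_ne {σ τ : E →+* ℂ} (h : τ ≠ σ) (j : Fin 2) :
    complexAction ρ (embIdem σ) (θ.eigenBasis ⟨j, τ⟩) = 0 := by
  rw [θ.complexAction_eigenBasis, embEval_embIdem, if_neg h, zero_smul]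

theorem ComplexFrame.apply_embIdem_eq_zero {ω : (ℂ ⊗[ℚ] W) [⋀^Fin 2]→ₗ[ℂ] ℂ} {σ τ : E →+* ℂ}
    (h : ∀ j k, ω ![θ.eigenBasis ⟨j, σ⟩, θ.eigenBasis ⟨k, τ⟩] = 0) (x y : ℂ ⊗[ℚ] W) :
    ω ![complexAction ρ (embIdem σ) x, complexAction ρ (embIdem τ) y] = 0 := by
  have : (bilinOfAlt ω).compl₁₂ (complexAction ρ (embIdem σ)) (complexAction ρ (embIdem τ)) = 0 := by
    refine θ.eigenBasis.ext ?_
    rintro ⟨j, α⟩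
    refine θ.eigenBasis.ext ?_
    rintro ⟨k, β⟩
    rw [LinearMap.compl₁₂_apply]
    by_cases hα : α = σ
    · by_cases hβ : β = τ
      · subst hα hβ
        rw [θ.embIdem_eigenBasis_self, θ.embIdem_eigenBasis_self, bilinOfAlt_apply, h]
        rfl
      · rw [θ.embIdem_eigenBasis_of_ne hβ, map_zero]; rfl
    · rw [θ.embIdem_eigenBasis_of_ne hα, map_zero]; rfl
  exact LinearMap.congr_fun (LinearMap.congr_fun this x) y

/-- The map `s ⊗ 1` carries `W_σ` to `W_{sσ}` but need not respect the eigenlines, so the conjugate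
of a wedge need not be a wedge. It is still nonzero on `W_{sσ} × W_{sτ}`, and
`wedge_mem_of_apply_ne_zero` applies to it. -/
theorem wedge_galois_mem [FiniteDimensional ℚ W]
    {H : Submodule ℚ ((ℂ ⊗[ℚ] W) [⋀^Fin 2]→ₗ[ℂ] ℂ)} (hH : ∀ ω ∈ H, IsRationalForm ω)
    (hN : resSL ρ ≤ formStabilizer
      (Submodule.span ℂ (H : Set ((ℂ ⊗[ℚ] W) [⋀^Fin 2]→ₗ[ℂ] ℂ)))) (s : ℂ ≃+* ℂ)
    {σ τ : E →+* ℂ} (hστ : σ ≠ τ) (h : wedge θ.eigenBasis ⟨0, σ⟩ ⟨0, τ⟩ ∈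
      Submodule.span ℂ (H : Set ((ℂ ⊗[ℚ] W) [⋀^Fin 2]→ₗ[ℂ] ℂ))) :
    wedge θ.eigenBasis ⟨0, embeddingAction E s σ⟩ ⟨0, embeddingAction E s τ⟩ ∈
      Submodule.span ℂ (H : Set ((ℂ ⊗[ℚ] W) [⋀^Fin 2]→ₗ[ℂ] ℂ)) := by
  obtain ⟨η, hη, hs⟩ := exists_galois_conjugate hH s h
  have h1 := hs (θ.eigenBasis ⟨0, σ⟩) (θ.eigenBasis ⟨0, τ⟩)
  rw [wedge_apply_self _ (by simpa using hστ), map_one, ← θ.embIdem_eigenBasis_self 0 σ,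
    ← θ.embIdem_eigenBasis_self 0 τ, galoisMap_embIdem_action, galoisMap_embIdem_action] at h1
  by_contra hcon
  have h2 := θ.apply_embIdem_eq_zero (ω := η) (fun j k => by
    by_contra hne
    exact hcon (wedge_mem_of_apply_ne_zero θ hN hη
      ((embeddingAction E s).injective.ne hστ) hne)) (galoisMap W s (θ.eigenBasis ⟨0, σ⟩))
      (galoisMap W s (θ.eigenBasis ⟨0, τ⟩))
  rw [h2] at h1
  exact zero_ne_one h1

end Galois

/-! ## Hodge structures and eigenframes -/

theorem alt_compLinearMap_eq_smul {R : Type v} [CommRing R] {M : Type u} [AddCommGroup M]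
    [Module R M] {κ : Type*} (b : Module.Basis κ R M) {f : M →ₗ[R] M} {d : κ → R}
    (hf : ∀ i, f (b i) = d i • b i) {ω : M [⋀^Fin 2]→ₗ[R] R} {c : R}
    (h : ∀ i j, ω ![b i, b j] = 0 ∨ d i * d j = c) : ω.compLinearMap f = c • ω := by
  refine alt_ext_basis b fun i j => ?_
  rw [alt_compLinearMap, hf, hf, ← bilinOfAlt_apply, map_smul, map_smul, LinearMap.smul_apply,
    bilinOfAlt_apply, AlternatingMap.smul_apply, smul_eq_mul, smul_eq_mul, smul_eq_mul]
  rcases h i j with h | h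
  · simp [h]
  · rw [← h]; ring

namespace ComplexTorus

variable {E : Type v} [Field E] [NumberField E] (T : ComplexTorus.{u})
  (ρ : E →ₐ[ℚ] Module.End ℚ T.H1Q)

theorem mem_H2Q_iff {ω : T.H2C} : ω ∈ T.H2Q ↔ IsRationalForm ω := by
  have h : ∀ v : Fin 2 → T.H1Q, (fun i => (1 : ℂ) ⊗ₜ[ℚ] v i) = ![1 ⊗ₜ v 0, 1 ⊗ₜ v 1] := fun v => by
    ext1 i
    fin_cases i <;> rfl
  constructor
  · intro hω v w
    obtain ⟨q, hq⟩ := hω ![v, w]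
    exact ⟨q, by rw [h] at hq; exact hq⟩
  · intro hω v
    rw [h]
    exact hω _ _

/-- Multiplication by `i` is in the Hodge group, so over `ℂ ⊗ E` it is a matrix of determinant `1`
and square `-1`, which can be diagonalized with eigenvalues `i` and `-i` at every embedding. -/
theorem exists_eigenFrame (hG : T.hodgeGroup = resSL ρ) (hdim : T.dim = Module.finrank ℚ E) :
    ∃ θ : ComplexFrame ρ, ∀ j σ, T.mulC Complex.I (θ.eigenBasis ⟨j, σ⟩) =
      (![Complex.I, -Complex.I] : Fin 2 → ℂ) j • θ.eigenBasis ⟨j, σ⟩ := by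
  let ε := Module.finBasis ℚ E
  obtain ⟨b, β, hβ⟩ := exists_basis_of_finrank ρ (by rw [T.finrank_H1Q, hdim]) ε
  let θ₀ := ComplexFrame.ofBasis ρ ε b β hβ
  have hmem : T.mulCEquiv Complex.I_ne_zero ∈ resSL ρ := by
    rw [← hG]
    exact T.mem_hodgeGroup Complex.norm_I (T.mulCEquiv_toLinearMap _)
  obtain ⟨A, hdet, hA⟩ := θ₀.mem_resSL_iff.1 hmem
  rw [T.mulCEquiv_toLinearMap] at hA
  have hAA : A * A = -1 := θ₀.ofMatrix_injective <| by
    have h1 : (-1 : Matrix (Fin 2) (Fin 2) (ℂ ⊗[ℚ] E)) = (-1 : ℂ) • 1 := (neg_one_smul ℂ _).symm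
    rw [θ₀.ofMatrix_mul, hA, T.mulC_I_mul_self, h1, θ₀.ofMatrix_smul, θ₀.ofMatrix_one]
    exact (neg_one_smul ℂ _).symm
  obtain ⟨θ, hθ⟩ := θ₀.exists_diagonal hAA hdet
  refine ⟨θ, fun j σ => ?_⟩
  rw [← hA, θ.eigenBasis_apply]
  have h2 : ∀ p : Fin 2 → ℂ ⊗[ℚ] E, p = ![p 0, p 1] := fun p => by
    ext1 i; fin_cases i <;> rfl
  rw [h2 (Pi.single j (embIdem σ)), hθ, ← map_smul]
  congr 1
  ext1 i
  fin_cases j <;> fin_cases i <;> simp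

variable {T ρ} {θ : ComplexFrame ρ}
  (hθ : ∀ j σ, T.mulC Complex.I (θ.eigenBasis ⟨j, σ⟩) =
    (![Complex.I, -Complex.I] : Fin 2 → ℂ) j • θ.eigenBasis ⟨j, σ⟩)
include hθ

theorem mulC_eigenBasis (z : ℂ) (x : Σ _ : Fin 2, E →+* ℂ) :
    T.mulC z (θ.eigenBasis x) =
      (![z, starRingEnd ℂ z] : Fin 2 → ℂ) x.1 • θ.eigenBasis x := by
  obtain ⟨j, σ⟩ := x
  rw [T.mulC_eq, LinearMap.add_apply, LinearMap.smul_apply, LinearMap.smul_apply, hθ,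
    Module.End.one_apply, smul_smul, ← add_smul]
  congr 1
  fin_cases j
  · simp
  · simp [Complex.ext_iff]

theorem eigenBasis_mem_hodgeM10 (σ : E →+* ℂ) : θ.eigenBasis ⟨0, σ⟩ ∈ T.hodgeM10 :=
  Module.End.mem_eigenspace_iff.2 (hθ 0 σ)

theorem eigenBasis_mem_hodge0M1 (σ : E →+* ℂ) : θ.eigenBasis ⟨1, σ⟩ ∈ T.hodge0M1 :=
  Module.End.mem_eigenspace_iff.2 (hθ 1 σ)

theorem repr_mulC_I (x : T.H1C) (j : Fin 2) (σ : E →+* ℂ) :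
    θ.eigenBasis.repr (T.mulC Complex.I x) ⟨j, σ⟩ =
      (![Complex.I, -Complex.I] : Fin 2 → ℂ) j * θ.eigenBasis.repr x ⟨j, σ⟩ := by
  classical
  have : θ.eigenBasis.coord ⟨j, σ⟩ ∘ₗ T.mulC Complex.I =
      (![Complex.I, -Complex.I] : Fin 2 → ℂ) j • θ.eigenBasis.coord ⟨j, σ⟩ := by
    refine θ.eigenBasis.ext ?_
    rintro ⟨k, τ⟩
    rw [LinearMap.comp_apply, hθ]
    by_cases h : (⟨k, τ⟩ : Σ _ : Fin 2, E →+* ℂ) = ⟨j, σ⟩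
    · cases h; simp
    · simp [h]
  exact LinearMap.congr_fun this x

theorem repr_eq_zero_of_mem_hodge0M1 {x : T.H1C} (hx : x ∈ T.hodge0M1) (σ : E →+* ℂ) :
    θ.eigenBasis.repr x ⟨0, σ⟩ = 0 := by
  have h := repr_mulC_I hθ x 0 σ
  rw [Module.End.mem_eigenspace_iff.1 hx, map_smul, Finsupp.smul_apply, smul_eq_mul] at h
  have h2 : (2 * Complex.I) * θ.eigenBasis.repr x ⟨0, σ⟩ = 0 := by
    simp only [Matrix.cons_val_zero] at h
    linear_combination -h
  simpa using h2

theorem apply_eq_zero_of_mem_H20 {ω : T.H2C} (hω : ω ∈ T.H20) {x y : Σ _ : Fin 2, E →+* ℂ}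
    (h : x.1 ≠ 0 ∨ y.1 ≠ 0) : ω ![θ.eigenBasis x, θ.eigenBasis y] = 0 := by
  obtain ⟨j, σ⟩ := x
  obtain ⟨k, τ⟩ := y
  have h0 := eigenBasis_mem_hodgeM10 hθ
  have h1 := eigenBasis_mem_hodge0M1 hθ
  fin_cases j <;> fin_cases k
  · simp at h
  · exact hω.1 _ (h0 σ) _ (h1 τ)
  · have := hω.1 _ (h0 τ) _ (h1 σ)
    exact (alt_swap ω _ _).trans (neg_eq_zero.2 this)
  · exact hω.2 _ (h1 σ) _ (h1 τ)

theorem compLinearMap_mulC_of_mem_H20 {ω : T.H2C} (hω : ω ∈ T.H20) (z : ℂ) :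
    ω.compLinearMap (T.mulC z) = (z * z) • ω := by
  refine alt_compLinearMap_eq_smul θ.eigenBasis (mulC_eigenBasis hθ z) fun x y => ?_
  by_cases h : x.1 ≠ 0 ∨ y.1 ≠ 0
  · exact Or.inl (apply_eq_zero_of_mem_H20 hθ hω h)
  · push Not at h
    simp [h.1, h.2]

theorem compLinearMap_mulC_of_mem_H11 {ω : T.H2C} (hω : ω ∈ T.H11) (z : ℂ) :
    ω.compLinearMap (T.mulC z) = (z * starRingEnd ℂ z) • ω := by
  refine alt_compLinearMap_eq_smul θ.eigenBasis (mulC_eigenBasis hθ z) ?_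
  rintro ⟨j, σ⟩ ⟨k, τ⟩
  have h0 := eigenBasis_mem_hodgeM10 hθ
  have h1 := eigenBasis_mem_hodge0M1 hθ
  fin_cases j <;> fin_cases k
  · exact Or.inl (hω.1 _ (h0 σ) _ (h0 τ))
  · simp
  · simp [mul_comm]
  · exact Or.inl (hω.2 _ (h1 σ) _ (h1 τ))

theorem compLinearMap_mulC_of_mem_H02 {ω : T.H2C} (hω : ω ∈ T.H02) (z : ℂ) :
    ω.compLinearMap (T.mulC z) = (starRingEnd ℂ z * starRingEnd ℂ z) • ω := by
  refine alt_compLinearMap_eq_smul θ.eigenBasis (mulC_eigenBasis hθ z) ?_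
  rintro ⟨j, σ⟩ ⟨k, τ⟩
  have h0 := eigenBasis_mem_hodgeM10 hθ
  have h1 := eigenBasis_mem_hodge0M1 hθ
  fin_cases j <;> fin_cases k
  · exact Or.inl (hω.1 _ (h0 σ) _ (h0 τ))
  · exact Or.inl (hω.2 _ (h0 σ) _ (h1 τ))
  · have := hω.2 _ (h0 τ) _ (h1 σ)
    exact Or.inl ((alt_swap ω _ _).trans (neg_eq_zero.2 this))
  · simp

theorem wedge_mem_H20 (σ τ : E →+* ℂ) : wedge θ.eigenBasis ⟨0, σ⟩ ⟨0, τ⟩ ∈ T.H20 := by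
  constructor
  · intro x _ y hy
    rw [wedge_apply, repr_eq_zero_of_mem_hodge0M1 hθ hy, repr_eq_zero_of_mem_hodge0M1 hθ hy]
    simp
  · intro x _ y hy
    rw [wedge_apply, repr_eq_zero_of_mem_hodge0M1 hθ hy, repr_eq_zero_of_mem_hodge0M1 hθ hy]
    simp

/-- The three Hodge components are scaled by `z²`, by the norm of `z` and by the square of its
conjugate. A sum of pieces of them is thus stable under all `z`, and its stabilizer is an algebraic
`ℚ`-subgroup. -/
theorem hodgeGroup_le_formStabilizer {H : Submodule ℚ T.H2C} (hH : T.IsHodgeSubstructure H) :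
    T.hodgeGroup ≤ formStabilizer (Submodule.span ℂ (H : Set T.H2C)) := by
  have hrat : ∀ ω ∈ H, IsRationalForm ω := fun ω hω => T.mem_H2Q_iff.1 (hH.1 hω)
  refine T.hodgeGroup_le (isAlgebraicQSubgroup_formStabilizer H hrat) fun z g _ hg => ?_
  rw [mem_formStabilizer_iff, hg]
  intro ω hω
  have h1 : ω ∈ T.complexify H := hω
  rw [hH.2] at h1
  obtain ⟨ω', h', c, hc, rfl⟩ := Submodule.mem_sup.1 h1
  obtain ⟨a, ha, b, hb, rfl⟩ := Submodule.mem_sup.1 h'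
  have h2 : (a + b + c).compLinearMap (T.mulC z) = (z * z) • a + (z * starRingEnd ℂ z) • b +
      (starRingEnd ℂ z * starRingEnd ℂ z) • c := by
    rw [← compLinearMap_mulC_of_mem_H20 hθ ha.2, ← compLinearMap_mulC_of_mem_H11 hθ hb.2,
      ← compLinearMap_mulC_of_mem_H02 hθ hc.2]
    rfl
  rw [h2]
  exact Submodule.add_mem _ (Submodule.add_mem _ (Submodule.smul_mem _ _ ha.1)
    (Submodule.smul_mem _ _ hb.1)) (Submodule.smul_mem _ _ hc.1)

end ComplexTorus

/-! ## The criterion for `2`-simplicity -/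

namespace ComplexTorus

variable {E : Type v} [Field E] [NumberField E] {T : ComplexTorus.{u}}
  {ρ : E →ₐ[ℚ] Module.End ℚ T.H1Q}

/-! ### Transitivity on pairs implies `2`-simplicity -/

section Sufficiency

variable {θ : ComplexFrame ρ}
  (hθ : ∀ j σ, T.mulC Complex.I (θ.eigenBasis ⟨j, σ⟩) =
    (![Complex.I, -Complex.I] : Fin 2 → ℂ) j • θ.eigenBasis ⟨j, σ⟩)
include hθ

theorem exists_apply_ne_zero_of_mem_H20 {ω : T.H2C} (hω : ω ∈ T.H20) (h0 : ω ≠ 0) :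
    ∃ σ τ, σ ≠ τ ∧ ω ![θ.eigenBasis ⟨0, σ⟩, θ.eigenBasis ⟨0, τ⟩] ≠ 0 := by
  by_contra! hcon
  refine h0 (alt_ext_basis θ.eigenBasis fun x y => ?_)
  rw [AlternatingMap.zero_apply]
  by_cases h : x.1 ≠ 0 ∨ y.1 ≠ 0
  · exact apply_eq_zero_of_mem_H20 hθ hω h
  · obtain ⟨j, σ⟩ := x
    obtain ⟨k, τ⟩ := y
    push Not at h
    obtain ⟨rfl, rfl⟩ : j = 0 ∧ k = 0 := h
    by_cases hστ : σ = τ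
    · rw [hστ]; exact alt_self ω _
    · exact hcon σ τ hστ

theorem H20_le_of_wedge_mem {N : Submodule ℂ T.H2C}
    (h : ∀ σ τ, σ ≠ τ → wedge θ.eigenBasis ⟨0, σ⟩ ⟨0, τ⟩ ∈ N) : T.H20 ≤ N := by
  intro ω hω
  rw [← Submodule.smul_mem_iff _ (two_ne_zero : (2 : ℂ) ≠ 0), two_smul_eq_sum_wedge θ.eigenBasis]
  refine N.sum_mem fun x _ => N.sum_mem fun y _ => ?_
  by_cases h' : x.1 ≠ 0 ∨ y.1 ≠ 0
  · rw [apply_eq_zero_of_mem_H20 hθ hω h', zero_smul]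
    exact N.zero_mem
  · obtain ⟨j, σ⟩ := x
    obtain ⟨k, τ⟩ := y
    push Not at h'
    obtain ⟨rfl, rfl⟩ : j = 0 ∧ k = 0 := h'
    by_cases hστ : σ = τ
    · rw [hστ, alt_self, zero_smul]
      exact N.zero_mem
    · exact N.smul_mem _ (h σ τ hστ)

theorem isTwoSimple_of_isAlmostDoublyTransitive (hG : T.hodgeGroup = resSL ρ)
    (hE : IsAlmostDoublyTransitive E) : T.IsTwoSimple := by
  intro H hH hne
  have hN : resSL ρ ≤ formStabilizer (Submodule.span ℂ (H : Set T.H2C)) :=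
    hG ▸ hodgeGroup_le_formStabilizer hθ hH
  have hrat : ∀ ω ∈ H, IsRationalForm ω := fun ω hω => T.mem_H2Q_iff.1 (hH.1 hω)
  obtain ⟨ω, hω, h0⟩ := Submodule.exists_mem_ne_zero_of_ne_bot hne
  obtain ⟨σ, τ, hστ, hv⟩ := exists_apply_ne_zero_of_mem_H20 hθ hω.2 h0
  have hw := wedge_mem_of_apply_ne_zero θ hN hω.1 hστ hv
  refine H20_le_of_wedge_mem hθ fun σ' τ' hστ' => ?_
  obtain ⟨s, hs⟩ := hE.2 {σ, τ} {σ', τ'} (Set.ncard_pair hστ) (Set.ncard_pair hστ')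
  have hs' := wedge_galois_mem θ hrat hN s hστ hw
  rw [Set.image_pair, Set.pair_eq_pair_iff] at hs
  rcases hs with ⟨h1, h2⟩ | ⟨h1, h2⟩
  · rw [h1, h2] at hs'
    exact hs'
  · rw [h1, h2, wedge_swap] at hs'
    exact (Submodule.neg_mem_iff _).1 hs'

end Sufficiency

/-! ### Hodge substructures attached to Galois-stable sets of pairs -/

section PairForms

variable (ρ) (B : (E →+* ℂ) → (E →+* ℂ) → Prop)

/-- The forms that vanish on the pairs of isotypic components outside `B`. -/
def pairForms : Submodule ℂ T.H2C where
  carrier := {ω | ∀ σ τ, ¬B σ τ → ∀ x y,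
    ω ![complexAction ρ (embIdem σ) x, complexAction ρ (embIdem τ) y] = 0}
  zero_mem' := by intro σ τ _ x y; simp
  add_mem' := by
    intro ω η hω hη σ τ h x y
    rw [AlternatingMap.add_apply, hω σ τ h, hη σ τ h, add_zero]
  smul_mem' := by
    intro c ω hω σ τ h x y
    rw [AlternatingMap.smul_apply, hω σ τ h, smul_zero]

variable {ρ B}

theorem complexAction_embIdem_of_ne {σ τ : E →+* ℂ} (h : σ ≠ τ) (x : T.H1C) :
    complexAction ρ (embIdem σ) (complexAction ρ (embIdem τ) x) = 0 := by
  rw [← Module.End.mul_apply, ← map_mul, embIdem_mul_of_ne h, map_zero, LinearMap.zero_apply]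

theorem sum_complexAction_embIdem (x : T.H1C) :
    ∑ σ : E →+* ℂ, complexAction ρ (embIdem σ) x = x := by
  rw [← LinearMap.sum_apply, ← map_sum, sum_embIdem, map_one, Module.End.one_apply]

open Classical in
/-- The projection onto the forms supported on `B`. -/
theorem exists_pair_projection (hsymm : ∀ σ τ, B σ τ → B τ σ) (ω : T.H2C) :
    ∃ ω' ∈ pairForms ρ B, ∀ x y, ω' ![x, y] = ∑ σ, ∑ τ, if B σ τ then
      ω ![complexAction ρ (embIdem σ) x, complexAction ρ (embIdem τ) y] else 0 := by
  let F : T.H1C →ₗ[ℂ] T.H1C →ₗ[ℂ] ℂ := ∑ σ, ∑ τ, if B σ τ then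
    (bilinOfAlt ω).compl₁₂ (complexAction ρ (embIdem σ)) (complexAction ρ (embIdem τ)) else 0
  have hF : ∀ x y, F x y = ∑ σ, ∑ τ, if B σ τ then
      ω ![complexAction ρ (embIdem σ) x, complexAction ρ (embIdem τ) y] else 0 := by
    intro x y
    simp only [F, LinearMap.sum_apply]
    refine Finset.sum_congr rfl fun σ _ => Finset.sum_congr rfl fun τ _ => ?_
    split_ifs <;> rfl
  -- Exchanging `σ` and `τ`, which the symmetry of `B` permits, changes the sign of the sum.
  have hFF : ∀ x, F x x = 0 := by
    intro x
    have h1 : F x x = -F x x := by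
      conv_lhs => rw [hF, Finset.sum_comm]
      rw [hF, ← Finset.sum_neg_distrib]
      refine Finset.sum_congr rfl fun σ _ => ?_
      rw [← Finset.sum_neg_distrib]
      refine Finset.sum_congr rfl fun τ _ => ?_
      by_cases h : B σ τ
      · rw [if_pos h, if_pos (hsymm _ _ h), alt_swap]
      · rw [if_neg h, if_neg (mt (hsymm _ _) h), neg_zero]
    exact self_eq_neg.1 h1
  refine ⟨altOfBilin F hFF, fun σ τ h x y => ?_, fun x y => hF x y⟩
  change F (complexAction ρ (embIdem σ) x) (complexAction ρ (embIdem τ) y) = 0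
  rw [hF]
  refine Finset.sum_eq_zero fun σ' _ => Finset.sum_eq_zero fun τ' _ => ?_
  split_ifs with h'
  · by_cases hσ : σ' = σ
    · by_cases hτ : τ' = τ
      · subst hσ hτ; exact absurd h' h
      · rw [complexAction_embIdem_of_ne hτ, ← bilinOfAlt_apply, map_zero]
    · rw [complexAction_embIdem_of_ne hσ, ← bilinOfAlt_apply, map_zero, LinearMap.zero_apply]
  · rfl

theorem eq_sum_of_mem_pairForms [∀ σ τ, Decidable (B σ τ)] {ω : T.H2C} (hω : ω ∈ pairForms ρ B)
    (x y : T.H1C) :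
    ω ![x, y] = ∑ σ, ∑ τ, if B σ τ then
      ω ![complexAction ρ (embIdem σ) x, complexAction ρ (embIdem τ) y] else 0 := by
  conv_lhs => rw [← bilinOfAlt_apply, ← sum_complexAction_embIdem (ρ := ρ) x,
    ← sum_complexAction_embIdem (ρ := ρ) y]
  simp only [map_sum, LinearMap.sum_apply, bilinOfAlt_apply]
  rw [Finset.sum_comm]
  refine Finset.sum_congr rfl fun σ _ => Finset.sum_congr rfl fun τ _ => ?_
  split_ifs with h
  · rfl
  · exact hω σ τ h x y

/-- On rational vectors an automorphism of `ℂ` only permutes the summands, as `B` is Galois-stable.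
The value is fixed by all of `Aut(ℂ)`, hence rational. -/
theorem isRationalForm_of_eq_sum [∀ σ τ, Decidable (B σ τ)]
    (hB : ∀ s σ τ, B (embeddingAction E s σ) (embeddingAction E s τ) ↔ B σ τ)
    {ω ω' : T.H2C} (hω : IsRationalForm ω)
    (h : ∀ x y, ω' ![x, y] = ∑ σ, ∑ τ, if B σ τ then
      ω ![complexAction ρ (embIdem σ) x, complexAction ρ (embIdem τ) y] else 0) :
    IsRationalForm ω' := by
  intro v w
  refine exists_rat_of_forall_ringEquiv fun s => ?_
  rw [h, map_sum]
  refine Eq.trans (Finset.sum_congr rfl fun σ _ => ?_) (Equiv.sum_comp (embeddingAction E s) _)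
  rw [map_sum]
  refine Eq.trans (Finset.sum_congr rfl fun τ _ => ?_) (Equiv.sum_comp (embeddingAction E s) _)
  by_cases hστ : B σ τ
  · rw [if_pos hστ, if_pos ((hB s σ τ).2 hστ), ← hω.apply_galoisMap s, galoisMap_embIdem_action,
      galoisMap_embIdem_action, galoisMap_tmul, galoisMap_tmul, map_one]
  · rw [if_neg hστ, if_neg (mt (hB s σ τ).1 hστ), map_zero]

/-- The rational forms supported on `B`. -/
def rationalPairForms (T : ComplexTorus.{u}) (ρ : E →ₐ[ℚ] Module.End ℚ T.H1Q)
    (B : (E →+* ℂ) → (E →+* ℂ) → Prop) : Submodule ℚ T.H2C :=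
  T.H2Q ⊓ (pairForms ρ B).restrictScalars ℚ

/-- The projection onto the forms supported on `B` preserves rationality and fixes those forms, and
rational forms span all forms. Hence the projections of rational forms span the image. -/
theorem complexify_rationalPairForms (hsymm : ∀ σ τ, B σ τ → B τ σ)
    (hB : ∀ s σ τ, B (embeddingAction E s σ) (embeddingAction E s τ) ↔ B σ τ) :
    T.complexify (rationalPairForms T ρ B) = pairForms ρ B := by
  classical
  refine le_antisymm (Submodule.span_le.2 fun ω hω => hω.2) fun ω hω => ?_
  have key : ∀ ω ∈ Submodule.span ℂ (T.H2Q : Set T.H2C),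
      ∃ ω' ∈ T.complexify (rationalPairForms T ρ B), ∀ x y, ω' ![x, y] = ∑ σ, ∑ τ, if B σ τ then
        ω ![complexAction ρ (embIdem σ) x, complexAction ρ (embIdem τ) y] else 0 := by
    intro ω hω
    induction hω using Submodule.span_induction with
    | mem ω hω =>
      obtain ⟨ω', h1, h2⟩ := exists_pair_projection (ρ := ρ) hsymm ω
      exact ⟨ω', Submodule.subset_span ⟨T.mem_H2Q_iff.2
        (isRationalForm_of_eq_sum hB (T.mem_H2Q_iff.1 hω) h2), h1⟩, h2⟩
    | zero => exact ⟨0, Submodule.zero_mem _, by simp⟩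
    | add a b _ _ ha hb =>
      obtain ⟨a', ha', ha⟩ := ha
      obtain ⟨b', hb', hb⟩ := hb
      refine ⟨a' + b', Submodule.add_mem _ ha' hb', fun x y => ?_⟩
      rw [AlternatingMap.add_apply, ha, hb, ← Finset.sum_add_distrib]
      refine Finset.sum_congr rfl fun σ _ => ?_
      rw [← Finset.sum_add_distrib]
      refine Finset.sum_congr rfl fun τ _ => ?_
      split_ifs <;> simp
    | smul c a _ ha =>
      obtain ⟨a', ha', ha⟩ := ha
      refine ⟨c • a', Submodule.smul_mem _ _ ha', fun x y => ?_⟩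
      rw [AlternatingMap.smul_apply, ha, Finset.smul_sum]
      refine Finset.sum_congr rfl fun σ _ => ?_
      rw [Finset.smul_sum]
      refine Finset.sum_congr rfl fun τ _ => ?_
      split_ifs <;> simp
  obtain ⟨ω', h1, h2⟩ := key ω <| by
    rw [span_isRationalForm fun ω h => T.mem_H2Q_iff.2 h]
    exact Submodule.mem_top
  have : ω = ω' := alt_ext fun x y => by rw [h2, ← eq_sum_of_mem_pairForms hω]
  rw [this]
  exact h1

theorem pairForms_compLinearMap {f : T.H1C →ₗ[ℂ] T.H1C}
    (hf : ∀ r x, f (complexAction ρ r x) = complexAction ρ r (f x)) {ω : T.H2C}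
    (hω : ω ∈ pairForms ρ B) : ω.compLinearMap f ∈ pairForms ρ B := by
  intro σ τ h x y
  rw [alt_compLinearMap, hf, hf]
  exact hω σ τ h _ _

/-- The projectors `p` and `q` onto the eigenspaces of multiplication by `i` commute with `ℂ ⊗ E`,
so composing with them preserves the support condition. The Hodge components of `ω` are `ω ∘ p`, `ω
∘ q` and the remainder, of type `(1,1)`. -/
theorem isHodgeSubstructure_rationalPairForms
    (hJ : ∀ r x, T.mulC Complex.I (complexAction ρ r x) = complexAction ρ r (T.mulC Complex.I x))
    (hsymm : ∀ σ τ, B σ τ → B τ σ)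
    (hB : ∀ s σ τ, B (embeddingAction E s σ) (embeddingAction E s τ) ↔ B σ τ) :
    T.IsHodgeSubstructure (rationalPairForms T ρ B) := by
  refine ⟨inf_le_left, ?_⟩
  rw [complexify_rationalPairForms hsymm hB]
  refine le_antisymm (fun ω hω => ?_) (sup_le (sup_le inf_le_left inf_le_left) inf_le_left)
  let p : T.H1C →ₗ[ℂ] T.H1C := (1 / 2 : ℂ) • (LinearMap.id - Complex.I • T.mulC Complex.I)
  let q : T.H1C →ₗ[ℂ] T.H1C := (1 / 2 : ℂ) • (LinearMap.id + Complex.I • T.mulC Complex.I)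
  have hpv : ∀ x, p x = (1 / 2 : ℂ) • (x - Complex.I • T.mulC Complex.I x) := fun _ => rfl
  have hqv : ∀ x, q x = (1 / 2 : ℂ) • (x + Complex.I • T.mulC Complex.I x) := fun _ => rfl
  have hp : ∀ r x, p (complexAction ρ r x) = complexAction ρ r (p x) := fun r x => by
    rw [hpv, hpv, hJ, map_smul, map_sub, map_smul]
  have hq : ∀ r x, q (complexAction ρ r x) = complexAction ρ r (q x) := fun r x => by
    rw [hqv, hqv, hJ, map_smul, map_add, map_smul]
  have hp0 : ∀ x ∈ T.hodgeM10, p x = x ∧ q x = 0 := by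
    intro x hx
    rw [hpv, hqv, Module.End.mem_eigenspace_iff.1 hx, smul_smul, Complex.I_mul_I]
    constructor <;> module
  have hq0 : ∀ x ∈ T.hodge0M1, p x = 0 ∧ q x = x := by
    intro x hx
    rw [hpv, hqv, Module.End.mem_eigenspace_iff.1 hx, smul_smul, mul_neg, Complex.I_mul_I]
    constructor <;> module
  have h0 : ∀ x : T.H1C, ω ![0, x] = 0 ∧ ω ![x, 0] = 0 := fun x => by
    rw [← bilinOfAlt_apply, ← bilinOfAlt_apply]
    simp only [map_zero, LinearMap.zero_apply, and_self]
  have hωp := pairForms_compLinearMap hp hω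
  have hωq := pairForms_compLinearMap hq hω
  have hdec : ω = ω.compLinearMap p + (ω - ω.compLinearMap p - ω.compLinearMap q) +
      ω.compLinearMap q := by abel
  rw [hdec]
  refine Submodule.add_mem_sup (Submodule.add_mem_sup ⟨hωp, ?_, ?_⟩
    ⟨Submodule.sub_mem _ (Submodule.sub_mem _ hω hωp) hωq, ?_, ?_⟩) ⟨hωq, ?_, ?_⟩
  · intro x hx y hy
    rw [alt_compLinearMap, (hq0 y hy).1, (h0 _).2]
  · intro x hx y hy
    rw [alt_compLinearMap, (hq0 y hy).1, (h0 _).2]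
  · intro x hx y hy
    rw [AlternatingMap.sub_apply, AlternatingMap.sub_apply, alt_compLinearMap, alt_compLinearMap,
      (hp0 x hx).1, (hp0 y hy).1, (hp0 x hx).2, (h0 _).1, sub_self, sub_self]
  · intro x hx y hy
    rw [AlternatingMap.sub_apply, AlternatingMap.sub_apply, alt_compLinearMap, alt_compLinearMap,
      (hq0 x hx).1, (hq0 y hy).2, (hq0 x hx).2, (h0 _).1, sub_zero, sub_self]
  · intro x hx y hy
    rw [alt_compLinearMap, (hp0 x hx).2, (h0 _).1]
  · intro x hx y hy
    rw [alt_compLinearMap, (hp0 x hx).2, (h0 _).1]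

end PairForms

/-- Let `B` be the orbit of `{σ₀, τ₀}`. The Hodge substructure of forms supported on `B` contains
the `(2,0)`-wedge of this pair, so by `2`-simplicity also that of `{σ, τ}`. The latter is nonzero on
`W_σ × W_τ`, which puts `{σ, τ}` in `B`. -/
theorem exists_image_pair_of_isTwoSimple {θ : ComplexFrame ρ}
    (hθ : ∀ j σ, T.mulC Complex.I (θ.eigenBasis ⟨j, σ⟩) =
      (![Complex.I, -Complex.I] : Fin 2 → ℂ) j • θ.eigenBasis ⟨j, σ⟩)
    (h2 : T.IsTwoSimple) {σ₀ τ₀ σ τ : E →+* ℂ} (h₀ : σ₀ ≠ τ₀) (h : σ ≠ τ) :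
    ∃ s, embeddingAction E s '' {σ₀, τ₀} = {σ, τ} := by
  let B : (E →+* ℂ) → (E →+* ℂ) → Prop := fun σ τ =>
    ∃ s, embeddingAction E s '' {σ₀, τ₀} = {σ, τ}
  have hsymm : ∀ σ τ, B σ τ → B τ σ := fun σ τ ⟨s, hs⟩ => ⟨s, hs.trans (Set.pair_comm _ _)⟩
  have hB1 : ∀ s σ τ, B σ τ → B (embeddingAction E s σ) (embeddingAction E s τ) := by
    rintro s σ τ ⟨t, ht⟩
    refine ⟨s * t, ?_⟩
    rw [← Set.image_pair, ← ht, map_mul, Equiv.Perm.coe_mul, Set.image_comp]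
  have hB : ∀ s σ τ, B (embeddingAction E s σ) (embeddingAction E s τ) ↔ B σ τ := by
    refine fun s σ τ => ⟨fun h => ?_, hB1 s σ τ⟩
    have := hB1 s⁻¹ _ _ h
    simpa using this
  have hJ : ∀ r x,
      T.mulC Complex.I (complexAction ρ r x) = complexAction ρ r (T.mulC Complex.I x) := by
    intro r x
    have : T.mulC Complex.I * complexAction ρ r = complexAction ρ r * T.mulC Complex.I := by
      refine θ.eigenBasis.ext ?_
      rintro ⟨j, α⟩
      rw [Module.End.mul_apply, Module.End.mul_apply, θ.complexAction_eigenBasis, hθ, map_smul,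
        map_smul, θ.complexAction_eigenBasis, hθ, smul_comm]
    exact LinearMap.congr_fun this x
  have hcx := complexify_rationalPairForms (T := T) (ρ := ρ) hsymm hB
  have hle := h2 _ (isHodgeSubstructure_rationalPairForms hJ hsymm hB) <| by
    rw [hcx, Submodule.ne_bot_iff]
    refine ⟨wedge θ.eigenBasis ⟨0, σ₀⟩ ⟨0, τ₀⟩, ⟨fun α β hαβ => ?_, wedge_mem_H20 hθ σ₀ τ₀⟩,
      fun h0 => ?_⟩
    · refine θ.apply_embIdem_eq_zero fun j k => ?_
      classical
      rw [wedge_apply, Module.Basis.repr_self, Module.Basis.repr_self]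
      by_cases h1 : α = σ₀ ∧ β = τ₀
      · obtain ⟨rfl, rfl⟩ := h1
        exact absurd ⟨1, by simp⟩ hαβ
      · by_cases h2 : α = τ₀ ∧ β = σ₀
        · obtain ⟨rfl, rfl⟩ := h2
          exact absurd ⟨1, by simp [Set.pair_comm]⟩ hαβ
        · simp only [Finsupp.single_apply, Sigma.mk.injEq, heq_eq_eq]
          split_ifs <;> simp_all
    · have h1 := wedge_apply_self θ.eigenBasis
        (i := (⟨0, σ₀⟩ : Σ _ : Fin 2, E →+* ℂ)) (j := ⟨0, τ₀⟩) (by simpa using h₀)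
      rw [h0] at h1
      exact zero_ne_one h1
  by_contra hcon
  have hw := hle (wedge_mem_H20 hθ σ τ)
  rw [hcx] at hw
  have h1 := hw σ τ hcon (θ.eigenBasis ⟨0, σ⟩) (θ.eigenBasis ⟨0, τ⟩)
  rw [θ.embIdem_eigenBasis_self, θ.embIdem_eigenBasis_self,
    wedge_apply_self _ (by simpa using h)] at h1
  exact one_ne_zero h1

theorem isAlmostDoublyTransitive_of_isTwoSimple {θ : ComplexFrame ρ}
    (hθ : ∀ j σ, T.mulC Complex.I (θ.eigenBasis ⟨j, σ⟩) =
      (![Complex.I, -Complex.I] : Fin 2 → ℂ) j • θ.eigenBasis ⟨j, σ⟩)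
    (hE : 2 < Module.finrank ℚ E) (h2 : T.IsTwoSimple) : IsAlmostDoublyTransitive E := by
  have hpair : ∀ A B : Set (E →+* ℂ), A.ncard = 2 → B.ncard = 2 →
      ∃ s, embeddingAction E s '' A = B := by
    intro A B hA hB
    obtain ⟨σ₀, τ₀, h₀, rfl⟩ := Set.ncard_eq_two.1 hA
    obtain ⟨σ, τ, h, rfl⟩ := Set.ncard_eq_two.1 hB
    exact exists_image_pair_of_isTwoSimple hθ h2 h₀ h
  refine ⟨fun x y => ?_, hpair⟩
  by_cases hxy : x = y
  · exact ⟨1, by simp [hxy]⟩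
  -- A third embedding `z` exists because the degree exceeds `2`. An automorphism taking `{x, z}` to
  -- `{y, z}` either sends `x` to `y`, or sends `x` to `z` and `z` to `y`; in the second case its
  -- square is used.
  obtain ⟨z, hz⟩ : ∃ z, z ∉ ({x, y} : Set (E →+* ℂ)) := by
    by_contra! hall
    have h1 : (Set.univ : Set (E →+* ℂ)).ncard = 2 := by
      rw [← Set.ncard_pair hxy, Set.eq_univ_of_forall hall]
    rw [Set.ncard_univ, Nat.card_eq_fintype_card, NumberField.Embeddings.card] at h1
    omega
  simp only [Set.mem_insert_iff, Set.mem_singleton_iff, not_or] at hz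
  obtain ⟨s, hs⟩ := hpair {x, z} {y, z} (Set.ncard_pair (Ne.symm hz.1))
    (Set.ncard_pair (Ne.symm hz.2))
  rw [Set.image_pair, Set.pair_eq_pair_iff] at hs
  rcases hs with ⟨h1, -⟩ | ⟨h1, h3⟩
  · exact ⟨s, h1⟩
  · exact ⟨s * s, by rw [map_mul, Equiv.Perm.mul_apply, h1, h3]⟩

theorem isTwoSimple_iff (hG : T.hodgeGroup = resSL ρ) (hdim : T.dim = Module.finrank ℚ E)
    (hE : 2 < Module.finrank ℚ E) : T.IsTwoSimple ↔ IsAlmostDoublyTransitive E := by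
  obtain ⟨θ, hθ⟩ := T.exists_eigenFrame ρ hG hdim
  exact ⟨isAlmostDoublyTransitive_of_isTwoSimple hθ hE,
    isTwoSimple_of_isAlmostDoublyTransitive hθ hG⟩

end ComplexTorus

end

/-! ### The main theorem -/

theorem mainTheorem6 (E : Type u) [Field E] [NumberField E] (hE : 2 < Module.finrank ℚ E) :
    (∃ T : ComplexTorus.{0}, T.IsSimple ∧ T.dim = Module.finrank ℚ E ∧
      ∃ ι : E ≃ₐ[ℚ] T.EndAlg, T.hodgeGroup = resSL (T.rationalRep.comp (ι : E →ₐ[ℚ] T.EndAlg))) ∧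
    (∀ T : ComplexTorus.{v}, T.IsSimple → T.dim = Module.finrank ℚ E →
      ∀ ι : E ≃ₐ[ℚ] T.EndAlg,
        T.hodgeGroup = resSL (T.rationalRep.comp (ι : E →ₐ[ℚ] T.EndAlg)) →
          (T.IsTwoSimple ↔ IsAlmostDoublyTransitive E)) := by
  exact ⟨exists_torus E, fun T _ hdim ι hG => ComplexTorus.isTwoSimple_iff hG hdim hE⟩
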